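/- Let $G=SO_e(4,1)$ be the identity component of the group of real $5\times5$ matrices $g$ with $\det g=1$ and $g^{T}\gamma g=\gamma$, where $\gamma=\mathrm{diag}(1,1,1,1,-1)$. Let $K=\{g\in G: (g^{T})^{-1}=g\}=S(O(4)\times O(1))_e\cong SO(4)$ be its maximal compact subgroup, and let $\mathfrak g=\{X\in\mathfrak{gl}(5,\mathbb C): X^{T}\gamma=-\gamma X\}$ be the complexified Lie algebra of $G$. Let $\mathfrak g=\mathfrak k\oplus\mathfrak p$ be the decomposition into the $+1$ and $-1$ eigenspaces of $\theta(X)=-X^{T}$. Let $U(\mathfrak g)$ be the universal enveloping algebra of $\mathfrak g$, and let $C(\mathfrak p)$ be the Clifford algebra of $\mathfrak p$ with respect to the trace form $B(X,Y)=\mathrm{tr}(XY)$, with the relations $vw+wv=-2B(v,w)$. The group $K$ acts on $U(\mathfrak g)$ and on $C(\mathfrak p)$ through the adjoint action $\mathrm{Ad}(k)X=kXk^{-1}$, and diagonally on the algebra $U(\mathfrak g)\otimes C(\mathfrak p)$. With $e_{ij}$ the matrix units, put $$H_1=ie_{12}-ie_{21},\qquad H_2=ie_{34}-ie_{43},$$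 $$E_1=\tfrac12(e_{13}-e_{24}-ie_{23}-ie_{14}-e_{31}+e_{42}+ie_{32}+ie_{41}),$$ $$E_2=\tfrac12(e_{13}+e_{24}-ie_{23}+ie_{14}-e_{31}-e_{42}+ie_{32}-ie_{41}),$$ $$F_1=-\tfrac12(e_{13}-e_{24}+ie_{23}+ie_{14}-e_{31}+e_{42}-ie_{32}-ie_{41}),$$ $$F_2=-\tfrac12(e_{13}+e_{24}+ie_{23}-ie_{14}-e_{31}-e_{42}-ie_{32}+ie_{41}),$$ which form a basis of $\mathfrak k$, and $$E_3=e_{15}-ie_{25}+e_{51}-ie_{52},\quad E_4=e_{35}-ie_{45}+e_{53}-ie_{54},$$ $$F_3=e_{15}+ie_{25}+e_{51}+ie_{52},\quad F_4=e_{35}+ie_{45}+e_{53}+ie_{54},$$ which form a basis of $\mathfrak p$. Let $\rho=\sigma\otimes\tau: S(\mathfrak g)\otimes\bigwedge(\mathfrak p)\to U(\mathfrak g)\otimes C(\mathfrak p)$, where $\sigma(x_1\cdots x_n)=\frac1{n!}\sum_{s\in S_n}x_{s(1)}\cdots x_{s(n)}$ is the symmetrization map and $\tau(v_1\wedge\cdots\wedge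 v_n)=\frac1{n!}\sum_{s\in S_n}\mathrm{sgn}(s)\,v_{s(1)}\cdots v_{s(n)}$ is the Chevalley map, and put $$a_1=\big((H_1+H_2)^2+4E_1F_1\big)\otimes 1,\quad a_2=\big((H_1-H_2)^2+4E_2F_2\big)\otimes 1,\quad \mathbf{i}=1\otimes E_3\wedge E_4\wedge F_3\wedge F_4 .$$ Let $D=\sum_j b_j\otimes d_j$ be the Dirac operator, where $(b_j)$ is a basis of $\mathfrak p$ and $(d_j)$ is its dual basis with respect to $B$. Let $\alpha:\mathfrak k\to C(\mathfrak p)$ be the composition of $\mathrm{ad}:\mathfrak k\to\mathfrak{so}(\mathfrak p)$, the isomorphism $\mathfrak{so}(\mathfrak p)\cong\bigwedge^2\mathfrak p$ and $\tau$, that is, $\alpha(X)=-\frac14\sum_j[X,b_j]\,d_j$, and let $$D_{\mathfrak k}=E_1\otimes\alpha(2F_1)+E_2\otimes\alpha(2F_2)+F_1\otimes\alpha(2E_1)+F_2\otimes\alpha(2E_2)+(H_1-H_2)\otimes\alpha(H_1-H_2)+(H_1+H_2)\otimes\alpha(H_1+H_2)$$ be the $\mathfrak k$-Dirac operator. Then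 the algebra $(U(\mathfrak g)\otimes C(\mathfrak p))^{K}$ of $K$-invariants is generated, as a unital $\mathbb C$-algebra, by the five elements $\rho(a_1)$, $\rho(a_2)$, $\rho(\mathbf{i})$, $D$ and $D_{\mathfrak k}$. -/

import Mathlib

open scoped Matrix TensorProduct

attribute [local instance 100] LieRing.ofAssociativeRing

noncomputable section

namespace SOe41

/-- Rows and columns are indexed by `Fin 4 ⊕ Fin 1`, the fifth coordinate being `Sum.inr 0`. -/
abbrev Idx : Type := Fin 4 ⊕ Fin 1

/-- The matrix `γ = diag(1, 1, 1, 1, -1)`. -/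
abbrev gam (R : Type) [CommRing R] : Matrix Idx Idx R :=
  LieAlgebra.Orthogonal.indefiniteDiagonal (Fin 4) (Fin 1) R

/-! ### The groups -/

/-- `G = SO_e(4,1)`, the identity component of `SO(4,1)`: the matrices of determinant one that
preserve the form `γ` and whose last diagonal entry is positive. -/
def G : Set (Matrix Idx Idx ℝ) :=
  {g | gᵀ * gam ℝ * g = gam ℝ ∧ g.det = 1 ∧ 0 < g (Sum.inr 0) (Sum.inr 0)}

/-- The maximal compact subgroup `K` of `G`: the fixed points in `G` of the Cartan involution
`g ↦ (gᵀ)⁻¹`. It consists of the matrices `diag(k, 1)` with `k ∈ SO(4)`. -/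
def K : Set (Matrix Idx Idx ℝ) := {g | g ∈ G ∧ gᵀ * g = 1}

/-! ### The Lie algebra and its Cartan decomposition -/

/-- The complexification `{x ∈ 𝔤𝔩(5, ℂ) | xᵀ γ = - γ x}` of `𝔰𝔬(4,1)`, as a Lie algebra over `ℂ`. -/
abbrev LieG : LieSubalgebra ℂ (Matrix Idx Idx ℂ) :=
  LieAlgebra.Orthogonal.so' (Fin 4) (Fin 1) ℂ

theorem mem_LieG (X : Matrix Idx Idx ℂ) : X ∈ LieG ↔ Xᵀ * gam ℂ = gam ℂ * (-X) := by
  change X ∈ skewAdjointMatricesLieSubalgebra (gam ℂ) ↔ _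
  rw [mem_skewAdjointMatricesLieSubalgebra, mem_skewAdjointMatricesSubmodule]
  exact Iff.rfl

/-- `𝔨`, the fixed points in `𝔤` of the Cartan involution `θ(X) = -Xᵀ`. -/
def LieK : Submodule ℂ LieG where
  carrier := {X | -(X : Matrix Idx Idx ℂ)ᵀ = X}
  add_mem' {X Y} (hX : -(X : Matrix Idx Idx ℂ)ᵀ = X) (hY : -(Y : Matrix Idx Idx ℂ)ᵀ = Y) := by
    change -((X : Matrix Idx Idx ℂ) + (Y : Matrix Idx Idx ℂ))ᵀ =
      (X : Matrix Idx Idx ℂ) + (Y : Matrix Idx Idx ℂ)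
    rw [Matrix.transpose_add, neg_add, hX, hY]
  zero_mem' := by
    change -(0 : Matrix Idx Idx ℂ)ᵀ = 0
    simp
  smul_mem' c X (hX : -(X : Matrix Idx Idx ℂ)ᵀ = X) := by
    change -(c • (X : Matrix Idx Idx ℂ))ᵀ = c • (X : Matrix Idx Idx ℂ)
    rw [Matrix.transpose_smul, ← smul_neg, hX]

/-- `𝔭`, the `-1` eigenspace in `𝔤` of the Cartan involution `θ(X) = -Xᵀ`. -/
def LieP : Submodule ℂ LieG where
  carrier := {X | -(X : Matrix Idx Idx ℂ)ᵀ = -X}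
  add_mem' {X Y} (hX : -(X : Matrix Idx Idx ℂ)ᵀ = -X) (hY : -(Y : Matrix Idx Idx ℂ)ᵀ = -Y) := by
    change -((X : Matrix Idx Idx ℂ) + (Y : Matrix Idx Idx ℂ))ᵀ =
      -((X : Matrix Idx Idx ℂ) + (Y : Matrix Idx Idx ℂ))
    rw [Matrix.transpose_add, neg_add, hX, hY, neg_add]
  zero_mem' := by
    change -(0 : Matrix Idx Idx ℂ)ᵀ = -0
    simp
  smul_mem' c X (hX : -(X : Matrix Idx Idx ℂ)ᵀ = -X) := by
    change -(c • (X : Matrix Idx Idx ℂ))ᵀ = -(c • (X : Matrix Idx Idx ℂ))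
    rw [Matrix.transpose_smul, ← smul_neg, hX, smul_neg]

theorem mem_LieK {X : LieG} : X ∈ LieK ↔ -(X : Matrix Idx Idx ℂ)ᵀ = X := Iff.rfl

theorem mem_LieP {X : LieG} : X ∈ LieP ↔ (X : Matrix Idx Idx ℂ)ᵀ = X :=
  neg_inj (a := (X : Matrix Idx Idx ℂ)ᵀ)

/-- The bracket `[𝔨, 𝔭] ⊆ 𝔭`. -/
theorem lie_mem_LieP (X : LieK) (v : LieP) : ⁅(X : LieG), (v : LieG)⁆ ∈ LieP := by
  rw [mem_LieP]
  have hX : ((X : LieG) : Matrix Idx Idx ℂ)ᵀ = -((X : LieG) : Matrix Idx Idx ℂ) := by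
    have h := mem_LieK.1 X.2
    rw [← neg_eq_iff_eq_neg]; exact h
  have hv := mem_LieP.1 v.2
  rw [LieSubalgebra.coe_bracket, Matrix.lie_transpose, hX, hv,
    LieRing.of_associative_ring_bracket, LieRing.of_associative_ring_bracket]
  noncomm_ring

/-! ### The Clifford algebra -/

/-- The trace form `B(X, Y) = tr(XY)` on `𝔭`. -/
def B : LinearMap.BilinForm ℂ LieP :=
  LinearMap.mk₂ ℂ
    (fun X Y => Matrix.trace
      (((X : LieG) : Matrix Idx Idx ℂ) * ((Y : LieG) : Matrix Idx Idx ℂ)))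
    (by intro X Y Z; simp [add_mul])
    (by intro c X Y; simp)
    (by intro X Y Z; simp [mul_add])
    (by intro c X Y; simp)

theorem B_apply (X Y : LieP) :
    B X Y = Matrix.trace
      (((X : LieG) : Matrix Idx Idx ℂ) * ((Y : LieG) : Matrix Idx Idx ℂ)) := rfl

/-- The quadratic form `v ↦ -B(v, v)` on `𝔭`. -/
def Q : QuadraticForm ℂ LieP := (-B).toQuadraticMap

/-- The Clifford algebra `C(𝔭)` of `𝔭` with respect to `B`, with `v w + w v = -2 B(v, w)`. -/
abbrev Cl : Type := CliffordAlgebra Q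

/-- The universal enveloping algebra `U(𝔤)`. -/
abbrev U : Type := UniversalEnvelopingAlgebra ℂ LieG

/-- The (ordinary, ungraded) tensor product algebra `U(𝔤) ⊗ C(𝔭)`. -/
abbrev UC : Type := U ⊗[ℂ] Cl

/-! ### The action of `K` -/

/-- The complex matrix with the same entries as an element of `K`. -/
abbrev toC (k : K) : Matrix Idx Idx ℂ := (k : Matrix Idx Idx ℝ).map Complex.ofReal

theorem toC_transpose_mul (k : K) : (toC k)ᵀ * toC k = 1 := by
  have h := congrArg (fun M : Matrix Idx Idx ℝ => M.map Complex.ofRealHom) k.2.2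
  simp only [Matrix.map_mul, Matrix.map_one _ (map_zero _) (map_one _), Matrix.transpose_map] at h
  exact h

theorem toC_mul_transpose (k : K) : toC k * (toC k)ᵀ = 1 :=
  mul_eq_one_comm.1 (toC_transpose_mul k)

theorem gam_map : (gam ℝ).map Complex.ofReal = gam ℂ := by
  ext i j
  rcases i with i | i <;> rcases j with j | j <;>
    simp [LieAlgebra.Orthogonal.indefiniteDiagonal, Matrix.diagonal_apply, apply_ite]

theorem toC_preserves (k : K) : (toC k)ᵀ * gam ℂ * toC k = gam ℂ := by
  have h := congrArg (fun M : Matrix Idx Idx ℝ => M.map Complex.ofRealHom) k.2.1.1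
  have e : (gam ℝ).map Complex.ofRealHom = gam ℂ := gam_map
  simp only [Matrix.map_mul, Matrix.transpose_map, e] at h
  exact h

theorem conj_mem (k : K) (X : LieG) :
    toC k * (X : Matrix Idx Idx ℂ) * (toC k)ᵀ ∈ LieG := by
  have hX : (X : Matrix Idx Idx ℂ)ᵀ * gam ℂ = gam ℂ * (-(X : Matrix Idx Idx ℂ)) :=
    (mem_LieG _).1 X.2
  have h1 := toC_transpose_mul k
  have h2 := toC_mul_transpose k
  have h3 : gam ℂ * toC k = toC k * gam ℂ := by
    calc gam ℂ * toC k = (toC k * (toC k)ᵀ) * gam ℂ * toC k := by rw [h2, one_mul]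
      _ = toC k * ((toC k)ᵀ * gam ℂ * toC k) := by noncomm_ring
      _ = _ := by rw [toC_preserves]
  have h4 : (toC k)ᵀ * gam ℂ = gam ℂ * (toC k)ᵀ := by
    calc (toC k)ᵀ * gam ℂ = ((toC k)ᵀ * gam ℂ) * (toC k * (toC k)ᵀ) := by rw [h2, mul_one]
      _ = ((toC k)ᵀ * gam ℂ * toC k) * (toC k)ᵀ := by noncomm_ring
      _ = _ := by rw [toC_preserves]
  rw [mem_LieG]
  simp only [Matrix.transpose_mul, Matrix.transpose_transpose]
  calc toC k * ((X : Matrix Idx Idx ℂ)ᵀ * (toC k)ᵀ) * gam ℂ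
      = toC k * (X : Matrix Idx Idx ℂ)ᵀ * ((toC k)ᵀ * gam ℂ) := by noncomm_ring
    _ = toC k * ((X : Matrix Idx Idx ℂ)ᵀ * gam ℂ) * (toC k)ᵀ := by rw [h4]; noncomm_ring
    _ = -((toC k * gam ℂ) * (X : Matrix Idx Idx ℂ) * (toC k)ᵀ) := by rw [hX]; noncomm_ring
    _ = _ := by rw [← h3]; noncomm_ring

/-- The adjoint action `Ad(k) X = k X k⁻¹` of `k ∈ K` on `𝔤` (here `k⁻¹ = kᵀ`). -/
def Ad (k : K) : LieG →ₗ⁅ℂ⁆ LieG where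
  toFun X := ⟨toC k * (X : Matrix Idx Idx ℂ) * (toC k)ᵀ, conj_mem k X⟩
  map_add' X Y := by
    apply Subtype.ext
    simp [mul_add, add_mul]
  map_smul' c X := by
    apply Subtype.ext
    simp
  map_lie' := by
    intro X Y
    apply Subtype.ext
    have h1 := toC_transpose_mul k
    simp only [LieSubalgebra.coe_bracket, LieRing.of_associative_ring_bracket]
    have key : ∀ P R : Matrix Idx Idx ℂ,
        toC k * P * (toC k)ᵀ * (toC k * R * (toC k)ᵀ) = toC k * (P * R) * (toC k)ᵀ := by
      intro P R
      calc _ = toC k * P * ((toC k)ᵀ * toC k) * R * (toC k)ᵀ := by noncomm_ring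
        _ = _ := by rw [h1]; noncomm_ring
    rw [key, key]
    noncomm_ring

theorem Ad_coe (k : K) (X : LieG) :
    (Ad k X : Matrix Idx Idx ℂ) = toC k * (X : Matrix Idx Idx ℂ) * (toC k)ᵀ := rfl

theorem Ad_mem_LieP (k : K) (v : LieG) (hv : v ∈ LieP) : Ad k v ∈ LieP := by
  rw [mem_LieP] at *
  rw [Ad_coe, Matrix.transpose_mul, Matrix.transpose_mul, Matrix.transpose_transpose, hv,
    Matrix.mul_assoc]

/-- The restriction of `Ad(k)` to an isometry of `𝔭`. -/
def AdP (k : K) : Q →qᵢ Q where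
  toLinearMap := (Ad k : LieG →ₗ[ℂ] LieG).restrict (Ad_mem_LieP k)
  map_app' v := by
    change -(B _ _) = -(B v v)
    rw [B_apply, B_apply]
    change -(Matrix.trace ((toC k * ((v : LieG) : Matrix Idx Idx ℂ) * (toC k)ᵀ) *
      (toC k * ((v : LieG) : Matrix Idx Idx ℂ) * (toC k)ᵀ))) = _
    have h1 := toC_transpose_mul k
    have key : ∀ P : Matrix Idx Idx ℂ,
        toC k * P * (toC k)ᵀ * (toC k * P * (toC k)ᵀ) = toC k * (P * P * (toC k)ᵀ) := by
      intro P
      calc _ = toC k * P * ((toC k)ᵀ * toC k) * P * (toC k)ᵀ := by noncomm_ring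
        _ = _ := by rw [h1]; noncomm_ring
    rw [key, Matrix.trace_mul_comm, Matrix.mul_assoc, h1, Matrix.mul_one]

/-- The action of `k ∈ K` on `U(𝔤)` extending `Ad(k)`. -/
def actU (k : K) : U →ₐ[ℂ] U :=
  UniversalEnvelopingAlgebra.lift ℂ ((UniversalEnvelopingAlgebra.ι ℂ).comp (Ad k))

/-- The action of `k ∈ K` on `C(𝔭)` extending `Ad(k)`. -/
def actCl (k : K) : Cl →ₐ[ℂ] Cl := CliffordAlgebra.map (AdP k)

/-- The diagonal action of `k ∈ K` on `U(𝔤) ⊗ C(𝔭)`. -/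
def act (k : K) : UC →ₐ[ℂ] UC := Algebra.TensorProduct.map (actU k) (actCl k)

/-- The algebra `(U(𝔤) ⊗ C(𝔭))^K` of `K`-invariants. -/
def invariants : Subalgebra ℂ UC := ⨅ k : K, AlgHom.equalizer (act k) (AlgHom.id ℂ UC)

theorem mem_invariants (x : UC) : x ∈ invariants ↔ ∀ k : K, act k x = x := by
  simp [invariants, Algebra.mem_iInf, AlgHom.mem_equalizer]

/-! ### The basis of `𝔤` -/

/-- The element of `𝔨` with upper left block `A - Aᵀ`. -/
def kElt (A : Matrix (Fin 4) (Fin 4) ℂ) : LieK :=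
  ⟨⟨Matrix.fromBlocks (A - Aᵀ) 0 0 0, by
    rw [mem_LieG, gam, LieAlgebra.Orthogonal.indefiniteDiagonal, ← Matrix.fromBlocks_diagonal]
    simp [Matrix.fromBlocks_transpose, Matrix.fromBlocks_multiply, Matrix.fromBlocks_neg]⟩, by
    rw [mem_LieK]
    simp [Matrix.fromBlocks_transpose, Matrix.fromBlocks_neg]⟩

/-- The element `∑ i, v i (e_{i5} + e_{5i})` of `𝔭`. -/
def pElt (v : Fin 4 → ℂ) : LieP :=
  ⟨⟨Matrix.fromBlocks 0 (Matrix.of fun i _ => v i) (Matrix.of fun _ j => v j) 0, by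
    rw [mem_LieG, gam, LieAlgebra.Orthogonal.indefiniteDiagonal, ← Matrix.fromBlocks_diagonal]
    have e1 : (Matrix.diagonal fun _ : Fin 4 => (1 : ℂ)) = 1 := Matrix.diagonal_one
    have e2 : (Matrix.diagonal fun _ : Fin 1 => (-1 : ℂ)) = -1 := by
      ext i j; fin_cases i; fin_cases j; simp
    rw [e1, e2]
    simp [Matrix.fromBlocks_transpose, Matrix.fromBlocks_multiply, Matrix.fromBlocks_neg]
    exact ⟨rfl, rfl⟩⟩, by
    rw [mem_LieP]
    simp [Matrix.fromBlocks_transpose]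
    exact ⟨rfl, rfl⟩⟩

/-- `e i j c` is the matrix `c e_{i+1, j+1}`. -/
abbrev e (i j : Fin 4) (c : ℂ) : Matrix (Fin 4) (Fin 4) ℂ := Matrix.single i j c

/-- `H₁ = i e₁₂ - i e₂₁`. -/
def H1 : LieK := kElt (e 0 1 Complex.I)
/-- `H₂ = i e₃₄ - i e₄₃`. -/
def H2 : LieK := kElt (e 2 3 Complex.I)
/-- `E₁ = (e₁₃ - e₂₄ - i e₂₃ - i e₁₄ - e₃₁ + e₄₂ + i e₃₂ + i e₄₁) / 2`. -/
def E1 : LieK := (1 / 2 : ℂ) • kElt (e 0 2 1 - e 1 3 1 - e 1 2 Complex.I - e 0 3 Complex.I)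
/-- `E₂ = (e₁₃ + e₂₄ - i e₂₃ + i e₁₄ - e₃₁ - e₄₂ + i e₃₂ - i e₄₁) / 2`. -/
def E2 : LieK := (1 / 2 : ℂ) • kElt (e 0 2 1 + e 1 3 1 - e 1 2 Complex.I + e 0 3 Complex.I)
/-- `F₁ = -(e₁₃ - e₂₄ + i e₂₃ + i e₁₄ - e₃₁ + e₄₂ - i e₃₂ - i e₄₁) / 2`. -/
def F1 : LieK := (-1 / 2 : ℂ) • kElt (e 0 2 1 - e 1 3 1 + e 1 2 Complex.I + e 0 3 Complex.I)
/-- `F₂ = -(e₁₃ + e₂₄ + i e₂₃ - i e₁₄ - e₃₁ - e₄₂ - i e₃₂ + i e₄₁) / 2`. -/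
def F2 : LieK := (-1 / 2 : ℂ) • kElt (e 0 2 1 + e 1 3 1 + e 1 2 Complex.I - e 0 3 Complex.I)
/-- `E₃ = e₁₅ - i e₂₅ + e₅₁ - i e₅₂`. -/
def E3 : LieP := pElt ![1, -Complex.I, 0, 0]
/-- `E₄ = e₃₅ - i e₄₅ + e₅₃ - i e₅₄`. -/
def E4 : LieP := pElt ![0, 0, 1, -Complex.I]
/-- `F₃ = e₁₅ + i e₂₅ + e₅₁ + i e₅₂`. -/
def F3 : LieP := pElt ![1, Complex.I, 0, 0]
/-- `F₄ = e₃₅ + i e₄₅ + e₅₃ + i e₅₄`. -/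
def F4 : LieP := pElt ![0, 0, 1, Complex.I]

/-- The basis `E₃, E₄, F₃, F₄` of `𝔭`. -/
def bas : Fin 4 → LieP := ![E3, E4, F3, F4]

/-- The basis of `𝔭` dual to `bas` with respect to `B`. -/
def dual : Fin 4 → LieP := fun i => (1 / 4 : ℂ) • ![F3, F4, E3, E4] i

theorem B_pElt (v w : Fin 4 → ℂ) : B (pElt v) (pElt w) = 2 * ∑ i, v i * w i := by
  rw [B_apply]
  change Matrix.trace (Matrix.fromBlocks 0 _ _ 0 * Matrix.fromBlocks 0 _ _ 0) = _
  rw [Matrix.fromBlocks_multiply]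
  simp [Matrix.trace, Matrix.mul_apply, two_mul]

/-- `bas` and `dual` are dual to each other with respect to the trace form. -/
theorem B_bas_dual (i j : Fin 4) : B (bas i) (dual j) = if i = j then 1 else 0 := by
  fin_cases i <;> fin_cases j <;>
    simp [bas, dual, E3, E4, F3, F4, B_pElt, Fin.sum_univ_four] <;> norm_num

/-! ### The five elements -/

/-- The inclusion `𝔤 → U(𝔤)`. -/
abbrev iU : LieG →ₗ⁅ℂ⁆ U := UniversalEnvelopingAlgebra.ι ℂ

/-- The inclusion `𝔭 → C(𝔭)`. -/
abbrev iC : LieP →ₗ[ℂ] Cl := CliffordAlgebra.ι Q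

/-- The value `σ(x₁ ⋯ xₙ) = (1 / n!) ∑_s x_{s(1)} ⋯ x_{s(n)}` of the symmetrization map
`σ : S(𝔤) → U(𝔤)` on a product of `n` elements of `𝔤`. -/
def sigma {n : ℕ} (x : Fin n → LieG) : U :=
  (1 / (n.factorial : ℂ)) • ∑ s : Equiv.Perm (Fin n), (List.ofFn fun i => iU (x (s i))).prod

/-- The value `τ(v₁ ∧ ⋯ ∧ vₙ) = (1 / n!) ∑_s sgn(s) v_{s(1)} ⋯ v_{s(n)}` of the Chevalley map
`τ : ⋀ 𝔭 → C(𝔭)` on a product of `n` elements of `𝔭`. -/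
def tau {n : ℕ} (v : Fin n → LieP) : Cl :=
  (1 / (n.factorial : ℂ)) • ∑ s : Equiv.Perm (Fin n),
    ((Equiv.Perm.sign s : ℤ) : ℂ) • (List.ofFn fun i => iC (v (s i))).prod

/-- `ρ(a₁)`, where `a₁ = (H₁ + H₂)² + 4 E₁ F₁ ∈ S(𝔤)` and `ρ = σ ⊗ τ`. -/
def rhoA1 : UC :=
  (sigma ![((H1 + H2 : LieK) : LieG), ((H1 + H2 : LieK) : LieG)]
    + (4 : ℂ) • sigma ![(E1 : LieG), (F1 : LieG)]) ⊗ₜ[ℂ] 1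

/-- `ρ(a₂)`, where `a₂ = (H₁ - H₂)² + 4 E₂ F₂ ∈ S(𝔤)` and `ρ = σ ⊗ τ`. -/
def rhoA2 : UC :=
  (sigma ![((H1 - H2 : LieK) : LieG), ((H1 - H2 : LieK) : LieG)]
    + (4 : ℂ) • sigma ![(E2 : LieG), (F2 : LieG)]) ⊗ₜ[ℂ] 1

/-- `ρ(i)`, where `i = 1 ⊗ E₃ ∧ E₄ ∧ F₃ ∧ F₄`. -/
def rhoI : UC := 1 ⊗ₜ[ℂ] tau ![E3, E4, F3, F4]

/-- The Dirac operator `D = ∑ i, b_i ⊗ d_i`, with `b_i` a basis of `𝔭` and `d_i` the dual basis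
with respect to `B`. -/
def D : UC := ∑ i, iU (bas i : LieG) ⊗ₜ[ℂ] iC (dual i)

/-- The map `α : 𝔨 → C(𝔭)`, the composition of `ad : 𝔨 → 𝔰𝔬(𝔭)`, `𝔰𝔬(𝔭) ≅ ⋀² 𝔭` and
`τ : ⋀² 𝔭 → C(𝔭)`: explicitly `α(X) = -(1/4) ∑ i, [X, b_i] d_i`. -/
def alpha (X : LieK) : Cl :=
  (-1 / 4 : ℂ) • ∑ i, iC ⟨⁅(X : LieG), (bas i : LieG)⁆, lie_mem_LieP X (bas i)⟩ * iC (dual i)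

/-- The summand `X ⊗ α(Y)` for `X, Y ∈ 𝔨`. -/
def kTerm (X Y : LieK) : UC := iU (X : LieG) ⊗ₜ[ℂ] alpha Y

/-- The `𝔨`-Dirac operator. -/
def Dk : UC :=
  kTerm E1 ((2 : ℂ) • F1) + kTerm E2 ((2 : ℂ) • F2)
    + kTerm F1 ((2 : ℂ) • E1) + kTerm F2 ((2 : ℂ) • E2)
    + kTerm (H1 - H2) (H1 - H2) + kTerm (H1 + H2) (H1 + H2)

end SOe41

end

/-!
# The `K`-invariants of `U(𝔤) ⊗ C(𝔭)` for `SO_e(4,1)`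

The Clifford algebra `C(𝔭)` is the matrix algebra of the four-dimensional spinor space `S`
(`spinEquiv`), so `U(𝔤) ⊗ C(𝔭)` is the algebra of `4 × 4` matrices over `U(𝔤)` (`toMat`). Under
`𝔨 ≅ 𝔰𝔩₂ × 𝔰𝔩₂` the space `S` is the sum of two planes, here called blocks, each with an invariant
symplectic form. The image of `i` is a multiple of the difference of the two block projections. By the
exceptional isomorphism `𝔰𝔬(5) ≅ 𝔰𝔭(4)`, the Lie algebra `𝔤` is the symmetric square of `S`; the
resulting matrix of elements of `𝔤` is the *moment matrix*, an endomorphism of `S` with entries in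
`U(𝔤)`. Its diagonal blocks are the `𝔨`-Dirac operator and the other two blocks are multiples of those
of the Dirac operator (`moment_eq`), so that `ρ(i)`, `D` and `D_𝔨` generate the same algebra as the
block projections and the moment matrix. The elements `ρ(a₁)` and `ρ(a₂)` are the Casimir elements of
the two ideals of `𝔨`; up to sign they lift the determinants of the diagonal blocks.

The graded version of the claim is a statement of classical invariant theory
(`mem_of_isInvariant_end`): the `𝔰𝔩₂ × 𝔰𝔩₂`-equivariant polynomial maps from symmetric bilinear forms
on `S` to endomorphisms of `S` are generated by the tautological one, the block projections
and the determinants of the diagonal blocks. The proof uses Cayley's Omega process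
(`mem_of_isWeight`): an invariant is turned into a polynomial in indeterminate vectors of the blocks,
on which the Omega operators of the two blocks act within the algebra generated by bilinear forms, and
the Capelli identity (`capelli_iterate`) recovers the invariant. The process produces traces of
diagonal blocks of words in the generators. These are eliminated by the Cayley-Hamilton identity for
`2 × 2` matrices and by cyclicity of the trace (`trace_smul_one_mem`).

The passage to `U(𝔤)` is by induction on the filtration (`mem_of_lieOpU_eq_zero`). It needs neither
the Poincaré-Birkhoff-Witt theorem nor averaging over `K`: a symbol of an invariant, which may not be
unique, is made invariant by the extremal projector of each `𝔰𝔩₂` (`exists_isSymbol_killed`).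
The only consequence of `K`-invariance that is used is that invariants commute with the diagonal copy
of `𝔨` (`commute_delta`). This follows from the rotations by the angle one in coordinate planes, which
separate integral weights because `π` is irrational.

Conversely, the five elements are invariant. The Dirac operators are contractions along invariant
forms, and `ρ(i)` is alternating. The Casimir elements are invariant by a Cayley-Hamilton identity for
the diagonal blocks of the moment matrix (`block_sq`, `act_casimir`).
-/

noncomputable section

namespace SpinorInvariants
open MvPolynomial

/-! ### The spinor space and vectors of indeterminates -/

/-- The index set of a basis of the spinor space: the first component is the half spinor space (a
block), the second one the basis vector in it. -/
abbrev I : Type := Fin 2 × Fin 2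

/-- The standard symplectic form in dimension two. -/
def eps (A : Type*) [Ring A] : Matrix (Fin 2) (Fin 2) A := !![0, 1; -1, 0]

/-- The symplectic form on the spinor space: the orthogonal sum of the standard forms of the two
blocks. -/
def symp (A : Type*) [Ring A] : Matrix I I A :=
  Matrix.of fun i j => if i.1 = j.1 then eps A i.2 j.2 else 0

/-- The projection of the spinor space to the block `b`. -/
def proj (A : Type*) [Ring A] (b : Fin 2) : Matrix I I A :=
  Matrix.diagonal fun i => if i.1 = b then 1 else 0

/-! ### Cayley's Omega operators -/

section Omega

variable {A : Type} [CommRing A]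

/-- Labels `(b, r, i)` of indeterminates: coordinate `i` of the vector `r` in the block `b`. -/
abbrev YVar : Type := Fin 2 × Fin 2 × Fin 2

/-- Polynomials in the coordinates of two indeterminate vectors `y_{b,0}`, `y_{b,1}` in each block.
-/
abbrev YPoly (A : Type) [CommRing A] : Type := MvPolynomial YVar A

/-- The vectors paired by forms: the indeterminate vector `y_{b,r}` of the block `b`, labelled by
`Sum.inl (b, r)`, and the constant vectors `z t`, labelled by `Sum.inr t`. -/
def vec (z : Fin 2 → I → A) : I ⊕ Fin 2 → I → YPoly A
  | Sum.inl a, i => if i.1 = a.1 then X (a.1, a.2, i.2) else 0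
  | Sum.inr t, i => C (z t i)

variable (z : Fin 2 → I → A)

/-- The product of the matrix `N` with a vector of the family `vec`. -/
def mulVec (N : Matrix I I A) (c : I ⊕ Fin 2) (i : I) : YPoly A := ∑ j, C (N i j) * vec z c j

/-- The value `vₐᵀ N v_c` of the bilinear form `N` on two vectors of the family `vec`. -/
def form (N : Matrix I I A) (a c : I ⊕ Fin 2) : YPoly A := ∑ i, vec z a i * mulVec z N c i

theorem pderiv_vec (b r i : Fin 2) (a : I ⊕ Fin 2) (k : I) :
    pderiv (b, r, i) (vec z a k) = if a = Sum.inl (b, r) ∧ k = (b, i) then 1 else 0 := by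
  rcases a with ⟨a1, a2⟩ | t
  · obtain ⟨k1, k2⟩ := k
    simp only [vec, Sum.inl.injEq, Prod.mk.injEq]
    by_cases h : k1 = a1
    · subst h
      simp only [if_true, pderiv_X, Pi.single_apply, Prod.mk.injEq]
      congr 1
      simp only [eq_iff_iff]
      tauto
    · rw [if_neg h, map_zero, if_neg]
      rintro ⟨⟨rfl, -⟩, rfl, -⟩
      exact h rfl
  · simp [vec]

theorem pderiv_mulVec (b r i : Fin 2) (N : Matrix I I A) (c : I ⊕ Fin 2) (k : I) :
    pderiv (b, r, i) (mulVec z N c k) = if c = Sum.inl (b, r) then C (N k (b, i)) else 0 := by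
  simp only [mulVec, map_sum, pderiv_C_mul, pderiv_vec]
  by_cases h : c = Sum.inl (b, r) <;> simp [h]

theorem pderiv_form (b r i : Fin 2) (N : Matrix I I A) (a c : I ⊕ Fin 2) :
    pderiv (b, r, i) (form z N a c) =
      (if a = Sum.inl (b, r) then mulVec z N c (b, i) else 0) +
      (if c = Sum.inl (b, r) then mulVec z Nᵀ a (b, i) else 0) := by
  simp only [form, map_sum, pderiv_mul, pderiv_vec, pderiv_mulVec, Finset.sum_add_distrib]
  congr 1
  · by_cases h : a = Sum.inl (b, r) <;> simp [h]
  · by_cases h : c = Sum.inl (b, r) <;> simp [h, mulVec, mul_comm]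

/-- The determinant of the block components of two vectors `N v_c` and `N' v_d` is again a form: two
forms are joined through the symplectic form of the block. -/
theorem join (b : Fin 2) (N N' : Matrix I I A) (c d : I ⊕ Fin 2) :
    mulVec z N c (b, 0) * mulVec z N' d (b, 1) - mulVec z N c (b, 1) * mulVec z N' d (b, 0)
      = form z (Nᵀ * (proj A b * symp A) * N') c d := by
  have key : proj A b * symp A = Matrix.of fun i j =>
      if i = (b, 0) ∧ j = (b, 1) then 1 else if i = (b, 1) ∧ j = (b, 0) then -1 else 0 := by
    ext ⟨i1, i2⟩ ⟨j1, j2⟩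
    fin_cases b <;> fin_cases i1 <;> fin_cases i2 <;> fin_cases j1 <;> fin_cases j2 <;>
      simp [proj, symp, eps]
  have key2 : ∀ i j, (Nᵀ * (proj A b * symp A) * N') i j =
      N (b, 0) i * N' (b, 1) j - N (b, 1) i * N' (b, 0) j := by
    intro i j
    rw [key]
    fin_cases b <;> simp [Matrix.mul_apply, Fintype.sum_prod_type] <;> ring
  simp only [form, mulVec, key2]
  rw [Finset.sum_mul_sum, Finset.sum_mul_sum, ← Finset.sum_sub_distrib]
  refine Finset.sum_congr rfl fun i _ => ?_
  rw [Finset.mul_sum, ← Finset.sum_sub_distrib]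
  refine Finset.sum_congr rfl fun j _ => ?_
  simp only [map_sub, map_mul]
  ring

/-- Cayley's Omega operator of the block `b`: the determinant of the derivatives with respect to the
coordinates of `y_{b,0}` and `y_{b,1}`. -/
def Om (b : Fin 2) (g : YPoly A) : YPoly A :=
  pderiv (b, 0, 0) (pderiv (b, 1, 1) g) - pderiv (b, 0, 1) (pderiv (b, 1, 0) g)

/-- The part of the second order operator `Om b` by which it fails to be a derivation. -/
def cross (b : Fin 2) (g h : YPoly A) : YPoly A :=
  pderiv (b, 0, 0) g * pderiv (b, 1, 1) h - pderiv (b, 0, 1) g * pderiv (b, 1, 0) h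
  + (pderiv (b, 0, 0) h * pderiv (b, 1, 1) g - pderiv (b, 0, 1) h * pderiv (b, 1, 0) g)

theorem Om_mul (b : Fin 2) (g h : YPoly A) :
    Om b (g * h) = Om b g * h + g * Om b h + cross b g h := by
  simp only [Om, cross, pderiv_mul, map_add]
  ring

theorem Om_form (b : Fin 2) (N : Matrix I I A) (a c : I ⊕ Fin 2) :
    Om b (form z N a c) =
      ((if a = Sum.inl (b, 0) ∧ c = Sum.inl (b, 1) then 1 else 0)
        - (if a = Sum.inl (b, 1) ∧ c = Sum.inl (b, 0) then 1 else 0)) *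
      C (N (b, 0) (b, 1) - N (b, 1) (b, 0)) := by
  have e : ∀ r : Fin 2, (Sum.inl (b, r) : I ⊕ Fin 2) = Sum.inl (b, 1 - r) ↔ False := by
    intro r; fin_cases r <;> simp
  simp only [Om, pderiv_form, map_add, apply_ite (pderiv _), pderiv_mulVec, map_zero,
    Matrix.transpose_apply]
  by_cases h1 : a = Sum.inl (b, 0)
  · subst h1
    by_cases h2 : c = Sum.inl (b, 1)
    · subst h2; simp
    · simp [h2]
  · by_cases h1' : a = Sum.inl (b, 1)
    · subst h1'
      by_cases h2 : c = Sum.inl (b, 0)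
      · subst h2; simp
      · simp [h2]
    · simp [h1, h1']

variable [Algebra ℂ A]

/-- The algebra generated by the constants from `J` and all forms with matrix in `S`. -/
def forms (J : Subalgebra ℂ A) (S : Set (Matrix I I A)) : Subalgebra ℂ (YPoly A) :=
  Algebra.adjoin ℂ ({g | ∃ r ∈ J, C r = g} ∪ {g | ∃ N ∈ S, ∃ a c, form z N a c = g})

theorem form_mem {J : Subalgebra ℂ A} {S : Set (Matrix I I A)} {N : Matrix I I A} (hN : N ∈ S)
    (a c) : form z N a c ∈ forms z J S :=
  Algebra.subset_adjoin (Or.inr ⟨N, hN, a, c, rfl⟩)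

theorem C_mem {J : Subalgebra ℂ A} {S : Set (Matrix I I A)} {r : A} (hr : r ∈ J) :
    C r ∈ forms z J S :=
  Algebra.subset_adjoin (Or.inl ⟨r, hr, rfl⟩)

theorem cross_form_mem {J : Subalgebra ℂ A} {S : Set (Matrix I I A)}
    (hT : ∀ N ∈ S, Nᵀ ∈ S)
    (hmul : ∀ b, ∀ N ∈ S, ∀ N' ∈ S, N * (proj A b * symp A) * N' ∈ S)
    (b : Fin 2) {N N' : Matrix I I A} (hN : N ∈ S) (hN' : N' ∈ S) (a c a' c' : I ⊕ Fin 2) :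
    pderiv (b, 0, 0) (form z N a c) * pderiv (b, 1, 1) (form z N' a' c')
      - pderiv (b, 0, 1) (form z N a c) * pderiv (b, 1, 0) (form z N' a' c') ∈ forms z J S := by
  have hj : ∀ M ∈ S, ∀ M' ∈ S, ∀ c d, mulVec z M c (b, 0) * mulVec z M' d (b, 1)
      - mulVec z M c (b, 1) * mulVec z M' d (b, 0) ∈ forms z J S := by
    intro M hM M' hM' c d
    rw [join]
    exact form_mem z (hmul b _ (hT M hM) _ hM') c d
  simp only [pderiv_form]
  have e : ∀ (p q r s : Prop) [Decidable p] [Decidable q] [Decidable r] [Decidable s]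
      (x0 x1 y0 y1 u0 u1 w0 w1 : YPoly A),
      ((if p then x0 else 0) + (if q then y0 else 0)) * ((if r then u1 else 0) + (if s then w1 else 0))
      - ((if p then x1 else 0) + (if q then y1 else 0)) * ((if r then u0 else 0) + (if s then w0 else 0))
      = (if p ∧ r then x0 * u1 - x1 * u0 else 0) + (if p ∧ s then x0 * w1 - x1 * w0 else 0)
       + (if q ∧ r then y0 * u1 - y1 * u0 else 0) + (if q ∧ s then y0 * w1 - y1 * w0 else 0) := by
    intro p q r s _ _ _ _ x0 x1 y0 y1 u0 u1 w0 w1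
    by_cases hp : p <;> by_cases hq : q <;> by_cases hr : r <;> by_cases hs : s <;>
      simp only [hp, hq, hr, hs, if_true, if_false, and_true, and_false, and_self] <;> ring
  rw [e]
  have h0 : ∀ (p : Prop) [Decidable p] (x : YPoly A), x ∈ forms z J S →
      (if p then x else 0) ∈ forms z J S := by
    intro p _ x hx; split_ifs; exacts [hx, zero_mem _]
  exact add_mem (add_mem (add_mem (h0 _ _ (hj _ hN _ hN' _ _)) (h0 _ _ (hj _ hN _ (hT _ hN') _ _)))
    (h0 _ _ (hj _ (hT _ hN) _ hN' _ _))) (h0 _ _ (hj _ (hT _ hN) _ (hT _ hN') _ _))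

theorem cross_mem {J : Subalgebra ℂ A} {S : Set (Matrix I I A)}
    (hT : ∀ N ∈ S, Nᵀ ∈ S)
    (hmul : ∀ b, ∀ N ∈ S, ∀ N' ∈ S, N * (proj A b * symp A) * N' ∈ S)
    (b : Fin 2) {g h : YPoly A} (hg : g ∈ forms z J S) (hh : h ∈ forms z J S) :
    cross b g h ∈ forms z J S := by
  have alg : ∀ r : ℂ, (algebraMap ℂ (YPoly A) r) = C (algebraMap ℂ A r) := fun r => rfl
  induction hg using Algebra.adjoin_induction with
  | mem g hg =>
    induction hh using Algebra.adjoin_induction with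
    | mem h hh =>
      rcases hg with ⟨r, hr, rfl⟩ | ⟨N, hN, a, c, rfl⟩
      · simp [cross]
      · rcases hh with ⟨r, hr, rfl⟩ | ⟨N', hN', a', c', rfl⟩
        · simp [cross]
        · exact add_mem (cross_form_mem z hT hmul b hN hN' _ _ _ _)
            (cross_form_mem z hT hmul b hN' hN _ _ _ _)
    | algebraMap r => simp [cross, alg]
    | add x y hx hy ihx ihy =>
      have : cross b g (x + y) = cross b g x + cross b g y := by simp only [cross, map_add]; ring
      rw [this]; exact add_mem ihx ihy
    | mul x y hx hy ihx ihy =>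
      have : cross b g (x * y) = cross b g x * y + x * cross b g y := by
        simp only [cross, pderiv_mul]; ring
      rw [this]; exact add_mem (mul_mem ihx hy) (mul_mem hx ihy)
  | algebraMap r => simp [cross, alg]
  | add x y hx hy ihx ihy =>
    have : cross b (x + y) h = cross b x h + cross b y h := by simp only [cross, map_add]; ring
    rw [this]; exact add_mem ihx ihy
  | mul x y hx hy ihx ihy =>
    have : cross b (x * y) h = cross b x h * y + x * cross b y h := by
      simp only [cross, pderiv_mul]; ring
    rw [this]; exact add_mem (mul_mem ihx hy) (mul_mem hx ihy)

/-- The Omega operator preserves the algebra of forms when `S` is closed under transposition and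
joining and the block traces of its elements lie in `J`. -/
theorem Om_mem {J : Subalgebra ℂ A} {S : Set (Matrix I I A)}
    (hT : ∀ N ∈ S, Nᵀ ∈ S)
    (hmul : ∀ b, ∀ N ∈ S, ∀ N' ∈ S, N * (proj A b * symp A) * N' ∈ S)
    (htr : ∀ b, ∀ N ∈ S, N (b, 0) (b, 1) - N (b, 1) (b, 0) ∈ J)
    (b : Fin 2) {g : YPoly A} (hg : g ∈ forms z J S) : Om b g ∈ forms z J S := by
  have alg : ∀ r : ℂ, (algebraMap ℂ (YPoly A) r) = C (algebraMap ℂ A r) := fun r => rfl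
  induction hg using Algebra.adjoin_induction with
  | mem g hg =>
    rcases hg with ⟨r, hr, rfl⟩ | ⟨N, hN, a, c, rfl⟩
    · simp [Om]
    · rw [Om_form]
      have h0 : ∀ (p : Prop) [Decidable p], (if p then (1 : YPoly A) else 0) ∈ forms z J S := by
        intro p _; split_ifs; exacts [one_mem _, zero_mem _]
      exact mul_mem (sub_mem (h0 _) (h0 _)) (C_mem z (htr b N hN))
  | algebraMap r => simp [Om, alg]
  | add x y hx hy ihx ihy =>
    have : Om b (x + y) = Om b x + Om b y := by simp only [Om, map_add]; ring
    rw [this]; exact add_mem ihx ihy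
  | mul x y hx hy ihx ihy =>
    rw [Om_mul]
    exact add_mem (add_mem (mul_mem ihx hy) (mul_mem hx ihy)) (cross_mem z hT hmul b hx hy)

end Omega

/-! ### The Capelli identity -/

section Capelli

variable {A : Type} [CommRing A]

theorem pderiv_comm {σ : Type*} (i j : σ) (g : MvPolynomial σ A) :
    pderiv i (pderiv j g) = pderiv j (pderiv i g) := by
  classical
  have h : ⁅(pderiv i : Derivation A (MvPolynomial σ A) (MvPolynomial σ A)),
      (pderiv j : Derivation A (MvPolynomial σ A) (MvPolynomial σ A))⁆ = 0 := by
    apply derivation_ext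
    intro k
    simp [Derivation.commutator_apply, pderiv_X, Pi.single_apply, apply_ite]
  have := congrArg (fun D => D g) h
  simpa [Derivation.commutator_apply, sub_eq_zero] using this

/-- The polarization operator replacing `y_{b,l}` by `y_{b,k}`. -/
def pol (b k l : Fin 2) : Derivation A (YPoly A) (YPoly A) :=
  ∑ j : Fin 2, (X (b, k, j) : YPoly A) • pderiv (b, l, j)

theorem pol_apply (b k l : Fin 2) (g : YPoly A) :
    pol b k l g = X (b, k, 0) * pderiv (b, l, 0) g + X (b, k, 1) * pderiv (b, l, 1) g := by
  simp [pol, Fin.sum_univ_two]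

/-- The determinant of the two indeterminate vectors of the block `b`. -/
def ydet (b : Fin 2) : YPoly A := X (b, 0, 0) * X (b, 1, 1) - X (b, 0, 1) * X (b, 1, 0)

/-- The Capelli identity. -/
theorem capelli (b : Fin 2) (g : YPoly A) :
    ydet b * Om b g = pol b 0 0 (pol b 1 1 g) + pol b 1 1 g - pol b 1 0 (pol b 0 1 g) := by
  simp only [ydet, Om, pol_apply, map_add, pderiv_mul, pderiv_X, Pi.single_apply, Prod.mk.injEq]
  simp
  ring

theorem pol_comm_Om_of_ne {b b' : Fin 2} (h : b' ≠ b) (k l : Fin 2) (g : YPoly A) :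
    pol b' k l (Om b g) = Om b (pol b' k l g) := by
  simp only [Om, pol_apply, map_add, map_sub, pderiv_mul, pderiv_X, Pi.single_apply, Prod.mk.injEq,
    h, false_and, if_false, zero_mul, zero_add]
  simp only [pderiv_comm (σ := YVar) (b', _, _) (b, _, _)]

theorem pol_zero_one_Om (b : Fin 2) (g : YPoly A) :
    pol b 0 1 (Om b g) = Om b (pol b 0 1 g) := by
  simp only [Om, pol_apply, map_add, map_sub, pderiv_mul, pderiv_X, Pi.single_apply, Prod.mk.injEq]
  simp only [pderiv_comm (σ := YVar) (b, 1, 1) (b, 0, _), pderiv_comm (σ := YVar) (b, 1, 0) (b, 0, _),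
     pderiv_comm (σ := YVar) (b, 1, 1) (b, 1, 0)]
  simp
  ring

theorem pol_diag_Om (b k : Fin 2) (g : YPoly A) :
    pol b k k (Om b g) = Om b (pol b k k g) - Om b g := by
  fin_cases k <;>
  simp only [Om, pol_apply, map_add, map_sub, pderiv_mul, pderiv_X, Pi.single_apply,
    Prod.mk.injEq, Fin.zero_eta, Fin.mk_one] <;>
  simp only [pderiv_comm (σ := YVar) (b, 1, 1) (b, 0, _), pderiv_comm (σ := YVar) (b, 1, 0) (b, 0, _),
     pderiv_comm (σ := YVar) (b, 0, 1) (b, 0, 0), pderiv_comm (σ := YVar) (b, 1, 1) (b, 1, 0)] <;>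
  simp <;>
  ring

theorem Om_natCast_mul (b : Fin 2) (n : ℕ) (g : YPoly A) : Om b ((n : YPoly A) * g) = n * Om b g := by
  simp only [Om, ← nsmul_eq_mul, map_nsmul, ← smul_sub]

theorem pol_natCast_mul (b k l : Fin 2) (n : ℕ) (g : YPoly A) :
    pol b k l ((n : YPoly A) * g) = n * pol b k l g := by
  simp

variable [Algebra ℂ A]

/-- A vector killed by the raising polarization whose two degrees in the block `b` equal `p` is, up
to a nonzero scalar, the `p`-th power of the determinant times its `p`-fold image under Omega, and
that image has degree zero in the block. -/
theorem capelli_iterate (b : Fin 2) (p : ℕ) (g : YPoly A) (h01 : pol b 0 1 g = 0)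
    (hd : ∀ k, pol b k k g = (p : YPoly A) * g) :
    (∃ c : ℂ, c ≠ 0 ∧ ydet b ^ p * (Om b)^[p] g = c • g) ∧ ∀ k, pol b k k ((Om b)^[p] g) = 0 := by
  induction p generalizing g with
  | zero => exact ⟨⟨1, one_ne_zero, by simp⟩, fun k => by simpa using hd k⟩
  | succ p ih =>
    have h1 : pol b 0 1 (Om b g) = 0 := by rw [pol_zero_one_Om, h01]; simp [Om]
    have h2 : ∀ k, pol b k k (Om b g) = (p : YPoly A) * Om b g := by
      intro k
      rw [pol_diag_Om, hd, Om_natCast_mul]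
      push_cast; ring
    obtain ⟨⟨c, hc, e⟩, h3⟩ := ih (Om b g) h1 h2
    -- in degree `p + 1` the Capelli operator acts by `(p + 1)² + (p + 1)`
    refine ⟨⟨c * ((p + 1) * (p + 2)), by
      refine mul_ne_zero hc ?_
      exact_mod_cast (by positivity : 0 < (p + 1) * (p + 2)).ne', ?_⟩, h3⟩
    rw [Function.iterate_succ_apply, pow_succ', mul_assoc, e, mul_smul_comm, capelli, h01, hd,
      pol_natCast_mul, hd, map_zero, mul_smul]
    congr 1
    have e2 : ((p : ℂ) + 1) * (p + 2) = (((p + 1) * (p + 2) : ℕ) : ℂ) := by push_cast; ring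
    rw [e2, Nat.cast_smul_eq_nsmul, nsmul_eq_mul]
    push_cast
    ring

omit [Algebra ℂ A] in
theorem iterate_comm_of_ne {b b' : Fin 2} (h : b' ≠ b) (k l : Fin 2) (p : ℕ) (g : YPoly A) :
    pol b' k l ((Om b)^[p] g) = (Om b)^[p] (pol b' k l g) := by
  induction p generalizing g with
  | zero => rfl
  | succ p ih => rw [Function.iterate_succ_apply, ih, pol_comm_Om_of_ne h,
      ← Function.iterate_succ_apply]

/-- Euler's identity: a polynomial of degree zero in all indeterminate vectors is constant. -/
theorem eq_C_of_pol_eq_zero (g : YPoly A) (h : ∀ b k, pol b k k g = 0) :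
    g = C (constantCoeff g) := by
  -- the sum of the four degree operators is the Euler operator
  have h0 : ∑ i : YVar, X i * pderiv i g = 0 := by
    simp only [Fintype.sum_prod_type, Fin.sum_univ_two]
    have h1 := h 0 0
    have h2 := h 0 1
    have h3 := h 1 0
    have h4 := h 1 1
    rw [pol_apply] at h1 h2 h3 h4
    linear_combination h1 + h2 + h3 + h4
  have hX : ∀ (i : YVar) (m : YVar →₀ ℕ), coeff m (X i * pderiv i g) = (m i : A) * coeff m g := by
    intro i m
    clear h h0
    induction g using MvPolynomial.induction_on' with
    | monomial u a =>
      rw [X_mul_pderiv_monomial, coeff_smul, coeff_monomial]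
      split_ifs with hu
      · subst hu; simp
      · simp
    | add p q hp hq => rw [map_add, mul_add, coeff_add, hp, hq, coeff_add, mul_add]
  ext m
  rw [coeff_C]
  split_ifs with hm
  · subst hm; rfl
  · have h1 := congrArg (coeff m) h0
    simp only [coeff_sum, hX, coeff_zero, ← Finset.sum_mul] at h1
    have hpos : (∑ i, m i) ≠ 0 := by
      intro hs
      apply hm
      ext i
      simpa using (Finset.sum_eq_zero_iff.1 hs i (Finset.mem_univ i)).symm
    have h2 : ((∑ i, m i : ℕ) : ℂ) • coeff m g = 0 := by
      rw [Algebra.smul_def, map_natCast]; push_cast; exact h1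
    exact (smul_eq_zero_iff_right (by exact_mod_cast hpos)).1 h2

end Capelli

/-! ### The action on matrices over the symmetric algebra -/

section Action

/-- The coordinate algebra of symmetric matrices indexed by the basis of the spinor space. -/
abbrev R : Type := MvPolynomial (Sym2 I) ℂ

/-- The generic symmetric matrix. -/
def gen : Matrix I I R := Matrix.of fun i j => X s(i, j)

theorem gen_apply (i j : I) : gen i j = X s(i, j) := rfl

theorem gen_transpose : genᵀ = gen := by
  ext1 i j
  simp only [Matrix.transpose_apply, gen_apply, Sym2.eq_swap]

/-- A complex matrix as a matrix over `R`. -/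
abbrev const (m : Matrix I I ℂ) : Matrix I I R := m.map (algebraMap ℂ R)

theorem actGen_symm (m : Matrix I I ℂ) (i j : I) :
    ((const m)ᵀ * gen + gen * const m) i j = ((const m)ᵀ * gen + gen * const m) j i := by
  have h : ((const m)ᵀ * gen + gen * const m)ᵀ = (const m)ᵀ * gen + gen * const m := by
    rw [Matrix.transpose_add, Matrix.transpose_mul, Matrix.transpose_mul, gen_transpose,
      Matrix.transpose_transpose, add_comm]
  exact congrFun (congrFun h j) i

/-- The derivation of `R` by which the Lie algebra of complex matrices acts on the generic symmetric
matrix as on a bilinear form: the generic matrix `S` is sent to `mᵀ S + S m`. -/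
def act (m : Matrix I I ℂ) : Derivation ℂ R R :=
  mkDerivation ℂ (Sym2.lift ⟨fun i j => ((const m)ᵀ * gen + gen * const m) i j, actGen_symm m⟩)

theorem act_X (m : Matrix I I ℂ) (i j : I) :
    act m (X s(i, j)) = ((const m)ᵀ * gen + gen * const m) i j := by
  rw [act, mkDerivation_X, Sym2.lift_mk]

theorem gen_map_act (m : Matrix I I ℂ) : gen.map (act m) = (const m)ᵀ * gen + gen * const m := by
  ext1 i j
  rw [Matrix.map_apply, gen_apply, act_X]

theorem const_mul_map (m : Matrix I I ℂ) (D : Derivation ℂ R R) (f : Matrix I I R) :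
    (const m * f).map D = const m * f.map D := by
  ext1 i j
  simp [Matrix.mul_apply]

theorem mul_const_map (m : Matrix I I ℂ) (D : Derivation ℂ R R) (f : Matrix I I R) :
    (f * const m).map D = f.map D * const m := by
  ext1 i j
  simp only [Matrix.mul_apply, Matrix.map_apply, map_sum, mul_comm _ (algebraMap ℂ R _),
    ← Algebra.smul_def, Derivation.map_smul]

theorem map_derivation_add (D : Derivation ℂ R R) (f g : Matrix I I R) :
    (f + g).map D = f.map D + g.map D := by
  ext1 i j; simp

theorem const_mul (m m' : Matrix I I ℂ) : const (m * m') = const m * const m' :=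
  Matrix.map_mul (f := algebraMap ℂ R)

theorem const_sub (m m' : Matrix I I ℂ) : const (m - m') = const m - const m' :=
  Matrix.map_sub _ (map_sub _) _ _

theorem const_transpose (m : Matrix I I ℂ) : const mᵀ = (const m)ᵀ := rfl

theorem act_lie (m m' : Matrix I I ℂ) : ⁅act m, act m'⁆ = act (m * m' - m' * m) := by
  apply derivation_ext
  intro s
  induction s using Sym2.ind with
  | _ i j =>
    have h1 : ∀ m m' : Matrix I I ℂ, (gen.map (act m')).map (act m) =
        (const m')ᵀ * ((const m)ᵀ * gen + gen * const m) +
          ((const m)ᵀ * gen + gen * const m) * const m' := by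
      intro m m'
      rw [gen_map_act, map_derivation_add, ← const_transpose, const_mul_map, mul_const_map,
        gen_map_act]
    have h2 : (gen.map (act m')).map (act m) - (gen.map (act m)).map (act m')
        = gen.map (act (m * m' - m' * m)) := by
      rw [h1, h1, gen_map_act, const_sub, const_mul, const_mul, Matrix.transpose_sub,
        Matrix.transpose_mul, Matrix.transpose_mul]
      noncomm_ring
    exact congrFun (congrFun h2 i) j

theorem act_sub (m m' : Matrix I I ℂ) : act (m - m') = act m - act m' := by
  apply derivation_ext
  intro s
  induction s using Sym2.ind with
  | _ i j =>
    rw [Derivation.sub_apply, act_X, act_X, act_X, const_sub, ← Matrix.sub_apply,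
      Matrix.transpose_sub, Matrix.sub_mul, Matrix.mul_sub, add_sub_add_comm]

/-- The action of a complex matrix on matrices over `R`: the action on the entries, together with `f
↦ m f + f mᵀ`. The matrices killed by it are the equivariant maps. -/
def lieOp (m : Matrix I I ℂ) : Module.End ℂ (Matrix I I R) :=
  (act m).toLinearMap.mapMatrix + LinearMap.mulLeft ℂ (const m) + LinearMap.mulRight ℂ (const m)ᵀ

theorem lieOp_apply (m : Matrix I I ℂ) (f : Matrix I I R) :
    lieOp m f = f.map (act m) + const m * f + f * (const m)ᵀ := rfl

theorem lieOp_lie (m m' : Matrix I I ℂ) (f : Matrix I I R) :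
    lieOp m (lieOp m' f) - lieOp m' (lieOp m f) = lieOp (m * m' - m' * m) f := by
  have h : (f.map (act m')).map (act m) - (f.map (act m)).map (act m')
      = f.map (act (m * m' - m' * m)) := by
    rw [← act_lie]
    ext1 i j
    simp [Derivation.commutator_apply]
  simp only [lieOp_apply, map_derivation_add, ← const_transpose, const_mul_map, mul_const_map]
  rw [← h, Matrix.transpose_sub, Matrix.transpose_mul, Matrix.transpose_mul,
    const_sub, const_sub, const_mul, const_mul, const_mul, const_mul]
  noncomm_ring

theorem lieOp_sub (m m' : Matrix I I ℂ) (f : Matrix I I R) :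
    lieOp (m - m') f = lieOp m f - lieOp m' f := by
  have h : f.map (act (m - m')) = f.map (act m) - f.map (act m') := by
    rw [act_sub]; ext1 i j; simp
  rw [lieOp_apply, lieOp_apply, lieOp_apply, h, const_sub, Matrix.transpose_sub]
  noncomm_ring

end Action

/-! ### Restitution of invariant matrices to forms -/

section Restitution

/-- Polynomials over `R` in the coordinates of two vectors `z₀`, `z₁` of the spinor space. -/
abbrev R2 : Type := MvPolynomial (Fin 2 × I) R

/-- The two vectors of indeterminates adjoined in `R2`. -/
def zvec (t : Fin 2) (i : I) : R2 := X (t, i)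

theorem form_transpose {A : Type} [CommRing A] (z : Fin 2 → I → A) (N : Matrix I I A)
    (a c : I ⊕ Fin 2) : form z Nᵀ a c = form z N c a := by
  simp only [form, mulVec, Finset.mul_sum]
  rw [Finset.sum_comm]
  refine Finset.sum_congr rfl fun i _ => Finset.sum_congr rfl fun j _ => ?_
  rw [Matrix.transpose_apply]; ring

theorem pol_form {A : Type} [CommRing A] (z : Fin 2 → I → A) (b k l : Fin 2) (N : Matrix I I A)
    (a c : I ⊕ Fin 2) : pol b k l (form z N a c) =
      (if a = Sum.inl (b, l) then form z N (Sum.inl (b, k)) c else 0) +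
      (if c = Sum.inl (b, l) then form z N a (Sum.inl (b, k)) else 0) := by
  have h : ∀ (N : Matrix I I A) c, form z N (Sum.inl (b, k)) c =
      X (b, k, 0) * mulVec z N c (b, 0) + X (b, k, 1) * mulVec z N c (b, 1) := by
    intro N c
    fin_cases b <;> simp [form, vec, Fintype.sum_prod_type, Fin.sum_univ_two]
  rw [← form_transpose z N (Sum.inl (b, k)) a, h, h, pol_apply, pderiv_form, pderiv_form]
  split_ifs <;> ring

/-- The substitution of the basis vectors of the spinor space by the indeterminate vectors: the
entry of the generic matrix at `i`, `j` is sent to its value on `y_i` and `y_j`. -/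
def subst : R →ₐ[ℂ] YPoly R2 :=
  aeval (Sym2.lift ⟨fun i j => form zvec (gen.map C) (Sum.inl i) (Sum.inl j), fun i j => by
    change form zvec (gen.map C) (Sum.inl i) (Sum.inl j) = form zvec (gen.map C) _ _
    rw [← form_transpose, ← Matrix.transpose_map, gen_transpose]⟩)

theorem subst_X (i j : I) :
    subst (X s(i, j)) = form zvec (gen.map C) (Sum.inl i) (Sum.inl j) := by
  rw [subst, aeval_X, Sym2.lift_mk]

/-- The matrix unit `(k, l)` of the block `b`. -/
abbrev unit (b k l : Fin 2) : Matrix I I ℂ := Matrix.single (b, k) (b, l) 1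

theorem const_unit (b k l : Fin 2) : const (unit b k l) = Matrix.single (b, k) (b, l) 1 := by
  rw [const, Matrix.map_single, map_one]

theorem single_mul_apply' {A : Type} [Ring A] (p q i j : I) (f : Matrix I I A) :
    (Matrix.single p q (1 : A) * f) i j = if i = p then f q j else 0 := by
  split_ifs with h
  · subst h; simp
  · simp [h]

theorem mul_single_apply' {A : Type} [Ring A] (p q i j : I) (f : Matrix I I A) :
    (f * Matrix.single p q (1 : A)) i j = if j = q then f i p else 0 := by
  split_ifs with h
  · subst h; simp
  · simp [h]

/-- Substitution intertwines the infinitesimal action of the blocks with polarization. -/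
theorem pol_subst (b k l : Fin 2) (r : R) :
    pol b k l (subst r) = subst (act (unit b k l) r) := by
  induction r using MvPolynomial.induction_on with
  | C a =>
    have e : (C a : R) = algebraMap ℂ R a := rfl
    have e2 : (algebraMap ℂ (YPoly R2)) a = algebraMap R2 (YPoly R2) (algebraMap ℂ R2 a) := rfl
    rw [e, AlgHom.commutes, Derivation.map_algebraMap, map_zero, e2, Derivation.map_algebraMap]
  | add p q hp hq => simp only [map_add, hp, hq]
  | mul_X p s hp =>
    have hX : pol b k l (subst (X s)) = subst (act (unit b k l) (X s)) := by
      induction s using Sym2.ind with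
      | _ i j =>
        rw [subst_X, pol_form, act_X, const_unit, Matrix.transpose_single, Matrix.add_apply,
          single_mul_apply', mul_single_apply']
        simp only [Sum.inl.injEq, gen_apply, map_add, apply_ite subst, map_zero, subst_X]
    rw [map_mul, Derivation.leibniz, Derivation.leibniz, hp, hX]
    simp only [smul_eq_mul, map_add, map_mul]

/-- The symplectic pairing of the indeterminate vector `y_i` with the vector `z_t`. -/
def covec (t : Fin 2) (i : I) : YPoly R2 := form zvec (symp R2) (Sum.inl i) (Sum.inr t)

theorem pol_covec (b k l : Fin 2) (t : Fin 2) (i : I) :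
    pol b k l (covec t i) = if i = (b, l) then covec t (b, k) else 0 := by
  simp [covec, pol_form]

/-- The polynomial in the indeterminate vectors attached to a matrix `f` over `R`: its entries are
substituted, and its rows and columns are contracted with `covec 0` and `covec 1`. -/
def restit (f : Matrix I I R) : YPoly R2 := ∑ i, ∑ j, subst (f i j) * (covec 0 i * covec 1 j)

theorem restit_add (f g : Matrix I I R) : restit (f + g) = restit f + restit g := by
  simp [restit, add_mul, Finset.sum_add_distrib]

/-- Restitution intertwines the action on matrices with polarization, so that matrices killed by the
raising operators become polynomials killed by the raising polarizations. -/
theorem pol_restit (b k l : Fin 2) (f : Matrix I I R) :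
    pol b k l (restit f) = restit (lieOp (unit b k l) f) := by
  rw [lieOp_apply, restit_add, restit_add, const_unit, Matrix.transpose_single]
  have h1 : restit (Matrix.single (b, k) (b, l) 1 * f) =
      ∑ j, subst (f (b, l) j) * (covec 0 (b, k) * covec 1 j) := by
    simp only [restit, single_mul_apply', apply_ite subst, map_zero, ite_mul, zero_mul]
    rw [Finset.sum_comm]
    simp
  have h2 : restit (f * Matrix.single (b, l) (b, k) 1) =
      ∑ i, subst (f i (b, l)) * (covec 0 i * covec 1 (b, k)) := by
    simp only [restit, mul_single_apply', apply_ite subst, map_zero, ite_mul, zero_mul]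
    simp
  rw [h1, h2]
  simp only [restit, map_sum, Derivation.leibniz, pol_subst, pol_covec, smul_eq_mul, mul_add,
    Finset.sum_add_distrib, Matrix.map_apply]
  have h3 : ∑ i, ∑ j, subst (f i j) * (covec 1 j * if i = (b, l) then covec 0 (b, k) else 0)
      = ∑ j, subst (f (b, l) j) * (covec 0 (b, k) * covec 1 j) := by
    rw [Finset.sum_comm]
    simp [mul_comm]
  have h4 : ∑ i, ∑ j, subst (f i j) * (covec 0 i * if j = (b, l) then covec 1 (b, k) else 0)
      = ∑ i, subst (f i (b, l)) * (covec 0 i * covec 1 (b, k)) := by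
    simp
  rw [h3, h4]
  have h5 : ∑ i, ∑ j, covec 0 i * covec 1 j * subst (act (unit b k l) (f i j))
    = ∑ i, ∑ j, subst (act (unit b k l) (f i j)) * (covec 0 i * covec 1 j) := by
    simp only [mul_comm]
  rw [h5]
  ring

end Restitution

/-! ### The first fundamental theorem by the Omega process -/

section FirstFundamentalTheorem

/-- The value of the bilinear form `N` on two of the vectors `z₀`, `z₁`. -/
def bilin (N : Matrix I I R) (a c : Fin 2) : R2 := ∑ i, ∑ j, zvec a i * (C (N i j) * zvec c j)

/-- The matrix of the part of `g` of bidegree `(1, 1)` in `z₀` and `z₁`. -/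
def mixedCoeff (g : R2) : Matrix I I R :=
  Matrix.of fun i j => constantCoeff (pderiv (0, i) (pderiv (1, j) g))

theorem mixedCoeff_bilin (N : Matrix I I R) (a c : Fin 2) :
    mixedCoeff (bilin N a c) =
      (if a = 0 ∧ c = 1 then N else 0) + (if a = 1 ∧ c = 0 then Nᵀ else 0) := by
  have hz : ∀ (t t' : Fin 2) (i j : I), pderiv (R := R) (t', j) (zvec t i) =
      if t = t' ∧ i = j then 1 else 0 := by
    intro t t' i j
    simp [zvec, pderiv_X, Pi.single_apply]
  ext1 i j
  simp only [mixedCoeff, Matrix.of_apply, bilin, map_sum, pderiv_mul, hz, map_add]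
  fin_cases a <;> fin_cases c <;>
    simp [zvec, apply_ite]

/-- The closure properties under which the Omega process stays within given forms: `S` holds the
matrices of the forms, `J` the constants, and `T` the conclusion to be reached. The set `S` contains
the generic matrix and the symplectic form, and is closed under transposition and under joining
through a block; the block traces of its elements lie in `J`, and `T` contains the `J`-span of `S`.
-/
structure IsFormSystem (J : Subalgebra ℂ R) (S : Set (Matrix I I R))
    (T : Submodule ℂ (Matrix I I R)) : Prop where
  transpose_mem : ∀ N ∈ S, Nᵀ ∈ S
  mul_mem : ∀ b, ∀ N ∈ S, ∀ N' ∈ S, N * (proj R b * symp R) * N' ∈ S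
  trace_mem : ∀ b, ∀ N ∈ S, N (b, 0) (b, 1) - N (b, 1) (b, 0) ∈ J
  gen_mem : gen ∈ S
  symp_mem : symp R ∈ S
  le : S ⊆ T
  smul_mem : ∀ r ∈ J, ∀ N ∈ T, r • N ∈ T

variable {J : Subalgebra ℂ R} {S : Set (Matrix I I R)} {T : Submodule ℂ (Matrix I I R)}

/-- The constants from `J` in `R2`. -/
abbrev CJ (J : Subalgebra ℂ R) : Subalgebra ℂ R2 :=
  J.map (Algebra.ofId R R2 |>.restrictScalars ℂ)

/-- The matrices from `S` over `R2`. -/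
abbrev CS (S : Set (Matrix I I R)) : Set (Matrix I I R2) := (fun N => N.map C) '' S

/-- In a polynomial in constants from `J` and bilinear forms from `S`, the part of bidegree `(1, 1)`
is a combination of forms from `S` with coefficients in `J`. -/
theorem mixedCoeff_mem (h : IsFormSystem J S T) {g : R2}
    (hg : g ∈ Algebra.adjoin ℂ ({g | ∃ r ∈ J, C r = g} ∪ {g : R2 | ∃ N ∈ S, ∃ a c, bilin N a c = g})) :
    mixedCoeff g ∈ T := by
  suffices hs : constantCoeff g ∈ J ∧ (∀ v, constantCoeff (pderiv v g) = 0) ∧ mixedCoeff g ∈ T from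
    hs.2.2
  have hC : ∀ r : R, mixedCoeff (C r) = 0 := by intro r; ext1 i j; simp [mixedCoeff]
  induction hg using Algebra.adjoin_induction with
  | mem g hg =>
    rcases hg with ⟨r, hr, rfl⟩ | ⟨N, hN, a, c, rfl⟩
    · exact ⟨by simpa using hr, by simp, by rw [hC]; exact zero_mem _⟩
    · refine ⟨by simp [bilin, zvec], by simp [bilin, zvec], ?_⟩
      rw [mixedCoeff_bilin]
      refine add_mem ?_ ?_ <;> split_ifs
      exacts [h.le hN, zero_mem _, h.le (h.transpose_mem _ hN), zero_mem _]
  | algebraMap r =>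
    have e : algebraMap ℂ R2 r = C (algebraMap ℂ R r) := rfl
    rw [e]
    exact ⟨by rw [constantCoeff_C]; exact algebraMap_mem _ r, by simp,
      by rw [hC]; exact zero_mem _⟩
  | add x y _ _ ihx ihy =>
    refine ⟨by rw [map_add]; exact add_mem ihx.1 ihy.1, fun v => by simp [ihx.2.1, ihy.2.1], ?_⟩
    have e : mixedCoeff (x + y) = mixedCoeff x + mixedCoeff y := by
      ext1 i j; simp [mixedCoeff]
    rw [e]; exact add_mem ihx.2.2 ihy.2.2
  | mul x y _ _ ihx ihy =>
    refine ⟨by rw [map_mul]; exact mul_mem ihx.1 ihy.1,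
      fun v => by simp [ihx.2.1, ihy.2.1], ?_⟩
    have e : mixedCoeff (x * y) =
        constantCoeff y • mixedCoeff x + constantCoeff x • mixedCoeff y := by
      ext1 i j
      simp only [mixedCoeff, Matrix.of_apply, pderiv_mul, map_add, map_mul, ihx.2.1, ihy.2.1,
        Matrix.add_apply, Matrix.smul_apply, smul_eq_mul]
      ring
    rw [e]; exact add_mem (h.smul_mem _ ihy.1 _ ihx.2.2) (h.smul_mem _ ihx.1 _ ihy.2.2)

theorem constantCoeff_forms_mem {g : YPoly R2} (hg : g ∈ forms zvec (CJ J) (CS S)) :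
    constantCoeff g ∈
      Algebra.adjoin ℂ ({g | ∃ r ∈ J, C r = g} ∪ {g : R2 | ∃ N ∈ S, ∃ a c, bilin N a c = g}) := by
  induction hg using Algebra.adjoin_induction with
  | mem g hg =>
    rcases hg with ⟨r, ⟨r', hr', rfl⟩, rfl⟩ | ⟨_, ⟨N, hN, rfl⟩, a, c, rfl⟩
    · rw [constantCoeff_C]
      exact Algebra.subset_adjoin (Or.inl ⟨r', hr', rfl⟩)
    · have hv : ∀ a i, constantCoeff (vec zvec (Sum.inl a) i) = 0 := by
        intro a i; simp only [vec]; split_ifs <;> simp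
      rcases a with a | a
      · have : constantCoeff (form zvec (N.map C) (Sum.inl a) c) = 0 := by
          simp [form, hv]
        rw [this]; exact zero_mem _
      rcases c with c | c
      · have : constantCoeff (form zvec (N.map C) (Sum.inr a) (Sum.inl c)) = 0 := by
          simp [form, mulVec, hv]
        rw [this]; exact zero_mem _
      · refine Algebra.subset_adjoin (Or.inr ⟨N, hN, a, c, ?_⟩)
        simp [form, mulVec, vec, bilin, Finset.mul_sum]
  | algebraMap r =>
    have e : algebraMap ℂ (YPoly R2) r = C (algebraMap ℂ R2 r) := rfl
    rw [e, constantCoeff_C]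
    exact algebraMap_mem _ r
  | add x y _ _ ihx ihy => rw [map_add]; exact add_mem ihx ihy
  | mul x y _ _ ihx ihy => rw [map_mul]; exact mul_mem ihx ihy

theorem map_symp : (symp R).map C = symp R2 := by
  ext1 i j
  simp only [symp, Matrix.map_apply, Matrix.of_apply]
  obtain ⟨i1, i2⟩ := i; obtain ⟨j1, j2⟩ := j
  fin_cases i2 <;> fin_cases j2 <;> simp [eps, apply_ite]

theorem map_proj_mul_symp (b : Fin 2) : (proj R b * symp R).map C = proj R2 b * symp R2 := by
  rw [Matrix.map_mul, map_symp]
  congr 1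
  ext1 i j
  by_cases h : i = j <;> by_cases h' : i.1 = b <;> simp_all [proj]

theorem restit_mem (h : IsFormSystem J S T) (f : Matrix I I R) :
    restit f ∈ forms zvec (CJ J) (CS S) := by
  have hs : ∀ r, subst r ∈ forms zvec (CJ J) (CS S) := by
    intro r
    induction r using MvPolynomial.induction_on with
    | C a => exact (subst.commutes a).symm ▸ algebraMap_mem _ a
    | add p q hp hq => rw [map_add]; exact add_mem hp hq
    | mul_X p s hp =>
      rw [map_mul]
      refine mul_mem hp ?_
      induction s using Sym2.ind with
      | _ i j => rw [subst_X]; exact form_mem zvec (S := CS S) ⟨gen, h.gen_mem, rfl⟩ _ _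
  have hc : ∀ t i, covec t i ∈ forms zvec (CJ J) (CS S) := fun t i =>
    form_mem zvec (S := CS S) ⟨symp R, h.symp_mem, map_symp⟩ _ _
  exact sum_mem fun i _ => sum_mem fun j _ => mul_mem (hs _) (mul_mem (hc _ _) (hc _ _))

theorem Om_iterate_mem (h : IsFormSystem J S T) (b : Fin 2) (p : ℕ) {g : YPoly R2}
    (hg : g ∈ forms zvec (CJ J) (CS S)) : (Om b)^[p] g ∈ forms zvec (CJ J) (CS S) := by
  induction p with
  | zero => exact hg
  | succ p ih =>
    rw [Function.iterate_succ_apply']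
    refine Om_mem zvec ?_ ?_ ?_ b ih
    · rintro _ ⟨N, hN, rfl⟩; exact ⟨_, h.transpose_mem _ hN, rfl⟩
    · rintro b _ ⟨N, hN, rfl⟩ _ ⟨N', hN', rfl⟩
      refine ⟨_, h.mul_mem b _ hN _ hN', ?_⟩
      simp only [← map_proj_mul_symp, Matrix.map_mul]
    · rintro b _ ⟨N, hN, rfl⟩
      exact ⟨_, h.trace_mem b _ hN, by simp⟩

/-- The specialization of the indeterminate vectors to the basis vectors of the spinor space. It
undoes the substitution, and sends the determinants of the blocks to one. -/
def evalOne : YPoly R2 →ₐ[R2] R2 := aeval fun v => if v.2.1 = v.2.2 then 1 else 0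

theorem evalOne_ydet (b : Fin 2) : evalOne (ydet b) = 1 := by
  simp [evalOne, ydet]

theorem evalOne_vec_inl (a i : I) : evalOne (vec zvec (Sum.inl a) i) = if i = a then 1 else 0 := by
  obtain ⟨a1, a2⟩ := a; obtain ⟨i1, i2⟩ := i
  simp only [vec, Prod.mk.injEq]
  split_ifs with h1 h2 h2 <;> simp_all [evalOne]
  exact fun h => h2 h.symm

theorem evalOne_C (r : R2) : evalOne (C r) = r := by
  simp [evalOne]

theorem evalOne_form_inl (N : Matrix I I R2) (a c : I) :
    evalOne (form zvec N (Sum.inl a) (Sum.inl c)) = N a c := by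
  simp [form, mulVec, evalOne_vec_inl]

theorem evalOne_covec (t : Fin 2) (i : I) : evalOne (covec t i) = (symp R2).mulVec (zvec t) i := by
  simp only [covec, form, mulVec, map_sum, map_mul, evalOne_vec_inl, evalOne_C]
  simp [vec, Matrix.mulVec, dotProduct]

theorem evalOne_subst (r : R) : evalOne (subst r) = C r := by
  have : (evalOne.restrictScalars ℂ).comp subst = (Algebra.ofId R R2).restrictScalars ℂ := by
    apply MvPolynomial.algHom_ext
    intro s
    induction s using Sym2.ind with
    | _ i j =>
      simp only [AlgHom.comp_apply, subst_X, AlgHom.restrictScalars_apply, evalOne_form_inl]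
      rfl
  exact congrArg (fun F => F r) this

theorem bilin_eq (N : Matrix I I R) (a c : Fin 2) :
    bilin N a c = zvec a ⬝ᵥ (N.map C).mulVec (zvec c) := by
  simp only [bilin, Matrix.mulVec, dotProduct, Finset.mul_sum, Matrix.map_apply]

theorem evalOne_restit (f : Matrix I I R) :
    evalOne (restit f) = bilin ((symp R)ᵀ * f * symp R) 0 1 := by
  have h : evalOne (restit f) =
      (symp R2).mulVec (zvec 0) ⬝ᵥ (f.map C).mulVec ((symp R2).mulVec (zvec 1)) := by
    simp only [restit, map_sum, map_mul, evalOne_subst, evalOne_covec, dotProduct]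
    refine Finset.sum_congr rfl fun i _ => ?_
    simp only [Matrix.mulVec, dotProduct, Matrix.map_apply]
    rw [Finset.mul_sum]
    exact Finset.sum_congr rfl fun j _ => by ring
  rw [h, bilin_eq, Matrix.map_mul, Matrix.map_mul, Matrix.transpose_map, map_symp,
    ← Matrix.mulVec_mulVec, ← Matrix.mulVec_mulVec, Matrix.dotProduct_mulVec (zvec 0),
    Matrix.vecMul_transpose]

/-- The Omega process: the restitution of a matrix killed by the raising operators, with both
weights equal to `p b` in the block `b`, is reduced by `p b` applications of the Omega operators to
a constant, without leaving the algebra of forms. By the Capelli identity this constant is a nonzero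
multiple of the original matrix, after the specialization which makes the determinants equal to one.
-/
theorem mem_of_isWeight (h : IsFormSystem J S T) (p : Fin 2 → ℕ) (f : Matrix I I R)
    (he : ∀ b, lieOp (unit b 0 1) f = 0)
    (hd : ∀ b k, lieOp (unit b k k) f = (p b : ℂ) • f) :
    (symp R)ᵀ * f * symp R ∈ T := by
  have hsmul : ∀ (c : ℂ) (f : Matrix I I R), restit (c • f) = c • restit f := by
    intro c f; simp [restit, Finset.smul_sum]
  have h01 : ∀ b, pol b 0 1 (restit f) = 0 := by
    intro b; rw [pol_restit, he]; simp [restit]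
  have hdd : ∀ b k, pol b k k (restit f) = (p b : YPoly R2) * restit f := by
    intro b k
    rw [pol_restit, hd, hsmul, Nat.cast_smul_eq_nsmul, nsmul_eq_mul]
  -- apply the Omega operators of the first block, and then those of the second one
  obtain ⟨⟨c0, hc0, e0⟩, k0⟩ := capelli_iterate 0 (p 0) (restit f) (h01 0) (hdd 0)
  set g0 := (Om 0)^[p 0] (restit f) with hg0
  have hOm : ∀ (n : ℕ) (g : YPoly R2) m, (Om 0)^[m] ((n : YPoly R2) * g) = n * (Om 0)^[m] g := by
    intro n g m
    induction m generalizing g with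
    | zero => rfl
    | succ m ih => rw [Function.iterate_succ_apply, Om_natCast_mul, ih, Function.iterate_succ_apply]
  have hO0 : ∀ m, (Om 0)^[m] (0 : YPoly R2) = 0 := by
    intro m; simpa using hOm 0 0 m
  obtain ⟨⟨c1, hc1, e1⟩, k1⟩ := capelli_iterate 1 (p 1) g0
    (by rw [hg0, iterate_comm_of_ne (by decide), h01, hO0])
    (fun k => by rw [hg0, iterate_comm_of_ne (by decide), hdd, hOm])
  set g1 := (Om 1)^[p 1] g0 with hg1
  have hC : g1 = C (constantCoeff g1) := by
    apply eq_C_of_pol_eq_zero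
    intro b k
    rcases (show b = 0 ∨ b = 1 by omega) with rfl | rfl
    · rw [hg1, iterate_comm_of_ne (by decide), k0]
      have hO1 : ∀ m, (Om 1)^[m] (0 : YPoly R2) = 0 := by
        intro m
        induction m with
        | zero => rfl
        | succ m ih => rw [Function.iterate_succ_apply']; rw [ih]; simp [Om]
      exact hO1 _
    · exact k1 k
  have hmem : mixedCoeff (constantCoeff g1) ∈ T :=
    mixedCoeff_mem h (constantCoeff_forms_mem
      (Om_iterate_mem h 1 _ (Om_iterate_mem h 0 _ (restit_mem h f))))
  -- specializing the Capelli identities identifies the resulting constant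
  have hev : constantCoeff g1 = (c1 * c0) • bilin ((symp R)ᵀ * f * symp R) 0 1 := by
    have a0 := congrArg (evalOne.restrictScalars ℂ) e0
    have a1 := congrArg (evalOne.restrictScalars ℂ) e1
    rw [map_mul, map_pow, map_smul] at a0 a1
    simp only [AlgHom.restrictScalars_apply, evalOne_ydet, one_pow, one_mul] at a0 a1
    rw [a0, hC, evalOne_C, evalOne_restit, smul_smul] at a1
    exact a1
  have hms : ∀ (c : ℂ) g, mixedCoeff (c • g) = c • mixedCoeff g := by
    intro c g
    have hp : ∀ v (g : R2), pderiv v (c • g) = c • pderiv v g := by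
      intro v g
      rw [← algebraMap_smul R c g, Derivation.map_smul, algebraMap_smul]
    ext1 i j
    simp only [mixedCoeff, Matrix.of_apply, Matrix.smul_apply, hp]
    rw [← algebraMap_smul R c, constantCoeff_smul, algebraMap_smul]
  rw [hev, hms, mixedCoeff_bilin] at hmem
  simp only [and_self, if_true] at hmem
  rw [if_neg (by decide), add_zero] at hmem
  have := T.smul_mem (c1 * c0)⁻¹ hmem
  rwa [smul_smul, inv_mul_cancel₀ (mul_ne_zero hc1 hc0), one_smul] at this

end FirstFundamentalTheorem

/-! ### Eigenvectors and the extremal projector -/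

section LinearAlgebra

variable {V : Type*} [AddCommGroup V] [Module ℂ V]

/-- A stable subspace contains the components of its elements along distinct eigenvalues. -/
theorem mem_of_sum_eigenvectors_mem (T : Module.End ℂ V) (W : Submodule ℂ V)
    (hW : ∀ x ∈ W, T x ∈ W) {ι : Type*} (s : Finset ι) (μ : ι → ℂ) (hμ : Function.Injective μ)
    (x : ι → V) (hx : ∀ i, T (x i) = μ i • x i) (h : ∑ i ∈ s, x i ∈ W) : ∀ i ∈ s, x i ∈ W := by
  classical
  induction s using Finset.induction_on generalizing x with
  | empty => simp
  | insert a s ha ih =>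
    have h1 : ∑ i ∈ s, (μ i - μ a) • x i ∈ W := by
      have := W.sub_mem (hW _ h) (W.smul_mem (μ a) h)
      rw [Finset.sum_insert ha, map_add, smul_add, hx, add_sub_add_left_eq_sub, map_sum,
        Finset.smul_sum, ← Finset.sum_sub_distrib] at this
      simpa only [hx, ← sub_smul] using this
    have h2 : ∀ i ∈ s, x i ∈ W := by
      intro i hi
      have := ih (fun i => (μ i - μ a) • x i) (fun i => by
        rw [map_smul, hx, smul_comm]) h1 i hi
      have hne : μ i - μ a ≠ 0 := sub_ne_zero.2 fun e => ha (hμ e ▸ hi)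
      simpa [smul_smul, inv_mul_cancel₀ hne] using W.smul_mem (μ i - μ a)⁻¹ this
    intro i hi
    rcases Finset.mem_insert.1 hi with rfl | hi
    · rw [Finset.sum_insert ha] at h
      exact (W.add_mem_iff_left (W.sum_mem h2)).1 h
    · exact h2 i hi

theorem mem_iSup_inf_eigenspace (T : Module.End ℂ V) (s : Set ℂ) (W : Submodule ℂ V)
    (hW : ∀ x ∈ W, T x ∈ W) {x : V} (hx : x ∈ W) (hx' : x ∈ ⨆ μ : s, T.eigenspace μ) :
    x ∈ ⨆ μ : s, W ⊓ T.eigenspace μ := by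
  obtain ⟨f, hf, rfl⟩ := (Submodule.mem_iSup_iff_exists_finsupp _ _).1 hx'
  have h := mem_of_sum_eigenvectors_mem T W hW f.support (fun μ : s => (μ : ℂ))
    Subtype.val_injective f (fun μ => Module.End.mem_eigenspace_iff.1 (hf μ)) hx
  exact Submodule.sum_mem _ fun μ hμ => Submodule.mem_iSup_of_mem μ ⟨h μ hμ, hf μ⟩

/-- A sum of eigenvectors is projected to the kernel of `T` by a polynomial in `T` with constant
term one. -/
theorem exists_polynomial_mul_eq_zero (T : Module.End ℂ V) {x : V}
    (hx : x ∈ ⨆ μ : ℂ, T.eigenspace μ) :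
    ∃ q : Polynomial ℂ, q.eval 0 = 1 ∧ T (Polynomial.aeval T q x) = 0 := by
  have hc : ∀ (p q : Polynomial ℂ) (y : V), T (Polynomial.aeval T q y) = 0 →
      T (Polynomial.aeval T (p * q) y) = 0 := by
    intro p q y h
    have e : T * Polynomial.aeval T (p * q) = Polynomial.aeval T p * (T * Polynomial.aeval T q) := by
      have hX : T = Polynomial.aeval T (Polynomial.X : Polynomial ℂ) := by simp
      conv_lhs => rw [hX, Polynomial.aeval_X]
      conv_rhs => enter [2, 1]; rw [hX]
      conv_lhs => enter [1]; rw [hX]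
      simp only [← map_mul]
      congr 1
      ring
    rw [← Module.End.mul_apply, e, Module.End.mul_apply, Module.End.mul_apply, h, map_zero]
  induction hx using Submodule.iSup_induction' with
  | mem μ x hx =>
    rw [Module.End.mem_eigenspace_iff] at hx
    by_cases hμ : μ = 0
    · exact ⟨1, by simp, by simp [hx, hμ]⟩
    · refine ⟨1 - Polynomial.C μ⁻¹ * Polynomial.X, by simp, ?_⟩
      simp [hx, smul_smul, hμ]
  | zero => exact ⟨1, by simp, by simp⟩
  | add x y _ _ ihx ihy =>
    obtain ⟨p, hp, hpx⟩ := ihx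
    obtain ⟨q, hq, hqy⟩ := ihy
    refine ⟨q * p, by simp [hp, hq], ?_⟩
    rw [map_add, map_add, hc q p x hpx, mul_comm, hc p q y hqy, add_zero]

variable (E F H : Module.End ℂ V)

/-- The coefficients of the extremal projector of `𝔰𝔩₂` on vectors of weight zero. -/
def extremalCoeff (k : ℕ) : ℂ := (-1) ^ k / (k.factorial * (k + 1).factorial)

/-- The truncation at `N` of the extremal projector of `𝔰𝔩₂` on vectors of weight zero. -/
def extremalProj (N : ℕ) : Module.End ℂ V :=
  ∑ k ∈ Finset.range N, extremalCoeff k • (F ^ k * E ^ k)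

variable {E F H}

theorem weight_pow_raise (hHE : ∀ v, H (E v) = E (H v) + (2 : ℂ) • E v) {v : V} (hv : H v = 0)
    (k : ℕ) : H ((E ^ k) v) = (2 * k : ℂ) • (E ^ k) v := by
  induction k with
  | zero => simp [hv]
  | succ k ih =>
    rw [pow_succ', Module.End.mul_apply, hHE, ih, map_smul, ← add_smul]
    congr 1; push_cast; ring

theorem weight_pow_lower (hHF : ∀ v, H (F v) = F (H v) - (2 : ℂ) • F v) {v : V} {c : ℂ}
    (hv : H v = c • v) (k : ℕ) : H ((F ^ k) v) = (c - 2 * k : ℂ) • (F ^ k) v := by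
  induction k with
  | zero => simp [hv]
  | succ k ih =>
    rw [pow_succ', Module.End.mul_apply, hHF, ih, map_smul, ← sub_smul]
    congr 1; push_cast; ring

theorem raise_lower_pow (hEF : ∀ v, E (F v) = F (E v) + H v)
    (hHF : ∀ v, H (F v) = F (H v) - (2 : ℂ) • F v) {v : V} {c : ℂ} (hv : H v = c • v) (k : ℕ) :
    E ((F ^ (k + 1)) v) = (F ^ (k + 1)) (E v) + ((k + 1) * (c - k) : ℂ) • (F ^ k) v := by
  induction k with
  | zero => simp [hEF, hv]
  | succ k ih =>
    rw [pow_succ', Module.End.mul_apply, hEF, ih, weight_pow_lower hHF hv, map_add, map_smul,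
      Module.End.mul_apply, add_assoc]
    congr 1
    rw [pow_succ' F k, Module.End.mul_apply, ← add_smul]
    congr 1; push_cast; ring

/-- The extremal projector maps to vectors killed by the raising operator. -/
theorem raise_extremalProj (hEF : ∀ v, E (F v) = F (E v) + H v)
    (hHE : ∀ v, H (E v) = E (H v) + (2 : ℂ) • E v)
    (hHF : ∀ v, H (F v) = F (H v) - (2 : ℂ) • F v) {v : V} (hv : H v = 0) {N : ℕ}
    (hN : (E ^ N) v = 0) : E (extremalProj E F N v) = 0 := by
  -- the sum telescopes: the partial sums are killed up to their last term
  have key : ∀ N, E (extremalProj E F (N + 1) v) = extremalCoeff N • (F ^ N) ((E ^ (N + 1)) v) := by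
    intro N
    induction N with
    | zero => simp [extremalProj, extremalCoeff]
    | succ N ih =>
      have e : extremalProj E F (N + 1 + 1) = extremalProj E F (N + 1) +
          extremalCoeff (N + 1) • (F ^ (N + 1) * E ^ (N + 1)) := by
        rw [extremalProj, Finset.sum_range_succ]; rfl
      rw [e, LinearMap.add_apply, map_add, ih, LinearMap.smul_apply, map_smul,
        Module.End.mul_apply, raise_lower_pow hEF hHF (weight_pow_raise hHE hv (N + 1)), smul_add,
        pow_succ' E (N + 1), Module.End.mul_apply, add_comm, add_assoc, smul_smul, ← add_smul]
      have : extremalCoeff (N + 1) * ((N + 1) * (2 * (N + 1 : ℕ) - N)) + extremalCoeff N = 0 := by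
        have h1 : ((N.factorial : ℕ) : ℂ) ≠ 0 := by exact_mod_cast N.factorial_ne_zero
        have h2 : (N + 1 : ℂ) ≠ 0 := by exact_mod_cast N.succ_ne_zero
        have h3 : (N + 1 + 1 : ℂ) ≠ 0 := by exact_mod_cast (N + 1).succ_ne_zero
        simp only [extremalCoeff, Nat.factorial_succ]
        push_cast
        field_simp
        ring
      rw [this, zero_smul, add_zero]
  rcases N with - | N
  · have : v = 0 := by simpa using hN
    simp [this]
  · rw [key, hN, map_zero, smul_zero]

theorem weight_extremalProj (hHE : ∀ v, H (E v) = E (H v) + (2 : ℂ) • E v)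
    (hHF : ∀ v, H (F v) = F (H v) - (2 : ℂ) • F v) {v : V} (hv : H v = 0) (N : ℕ) :
    H (extremalProj E F N v) = 0 := by
  simp only [extremalProj, LinearMap.sum_apply, map_sum, LinearMap.smul_apply, map_smul,
    Module.End.mul_apply]
  refine Finset.sum_eq_zero fun k _ => ?_
  rw [weight_pow_lower hHF (weight_pow_raise hHE hv k), sub_self, zero_smul, smul_zero]

/-- Leibniz rule for nilpotency: a product of nilpotent vectors is nilpotent. -/
theorem pow_smul_eq_zero {A : Type*} [CommRing A] [Algebra ℂ A] [Module A V]
    (D : Module.End ℂ A) (L : Module.End ℂ V) (hL : ∀ (r : A) (v : V), L (r • v) = D r • v + r • L v)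
    (a b : ℕ) (r : A) (v : V) (hr : (D ^ a) r = 0) (hv : (L ^ b) v = 0) :
    (L ^ (a + b)) (r • v) = 0 := by
  induction hn : a + b generalizing a b r v with
  | zero =>
    obtain ⟨rfl, rfl⟩ : a = 0 ∧ b = 0 := by omega
    have : r = 0 := by simpa using hr
    simp [this]
  | succ n ih =>
    rw [pow_succ, Module.End.mul_apply, hL, map_add]
    have h1 : (L ^ n) (D r • v) = 0 := by
      rcases a with - | a
      · have : r = 0 := by simpa using hr
        simp [this]
      · rw [pow_succ, Module.End.mul_apply] at hr
        exact ih a b _ _ hr hv (by omega)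
    have h2 : (L ^ n) (r • L v) = 0 := by
      rcases b with - | b
      · have : v = 0 := by simpa using hv
        simp [this]
      · rw [pow_succ, Module.End.mul_apply] at hv
        exact ih a b _ _ hr hv (by omega)
    rw [h1, h2, add_zero]

theorem pow_apply_eq_zero_of_le {L : Module.End ℂ V} {a b : ℕ} (h : a ≤ b) {v : V}
    (hv : (L ^ a) v = 0) : (L ^ b) v = 0 := by
  obtain ⟨c, rfl⟩ := Nat.exists_eq_add_of_le' h
  rw [pow_add, Module.End.mul_apply, hv, map_zero]

theorem mem_maxGenEigenspace_zero {L : Module.End ℂ V} {v : V} :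
    v ∈ L.maxGenEigenspace 0 ↔ ∃ k, (L ^ k) v = 0 := by
  rw [Module.End.mem_maxGenEigenspace, zero_smul, sub_zero]

end LinearAlgebra

/-! ### Weights and the reduction to weight vectors -/

section Weights

theorem lieOp_smul (m : Matrix I I ℂ) (r : R) (f : Matrix I I R) :
    lieOp m (r • f) = act m r • f + r • lieOp m f := by
  have h : (r • f).map (act m) = act m r • f + r • f.map (act m) := by
    ext1 i j
    simp [add_comm, mul_comm]
  rw [lieOp_apply, h, lieOp_apply, Matrix.mul_smul, Matrix.smul_mul, smul_add, smul_add]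
  abel

theorem act_gen_diagonal (h : I → ℂ) (i j : I) :
    act (Matrix.diagonal h) (X s(i, j)) = (h i + h j) • (X s(i, j) : R) := by
  rw [act_X, ← const_transpose, Matrix.diagonal_transpose, const, Matrix.diagonal_map (map_zero _),
    Matrix.add_apply, Matrix.diagonal_mul, Matrix.mul_diagonal, gen_apply, mul_comm _ (algebraMap _ _ _),
    ← add_mul, ← map_add, ← Algebra.smul_def]

theorem map_act_single (m : Matrix I I ℂ) (i j : I) :
    (Matrix.single i j (1 : R)).map (act m) = 0 := by
  rw [Matrix.map_single, Derivation.map_one_eq_zero, Matrix.single_zero]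

theorem lieOp_diagonal_single (h : I → ℂ) (i j : I) :
    lieOp (Matrix.diagonal h) (Matrix.single i j 1) = (h i + h j) • Matrix.single i j (1 : R) := by
  rw [lieOp_apply, map_act_single, const,
    Matrix.diagonal_map (map_zero _), Matrix.diagonal_transpose]
  ext1 p q
  rw [Matrix.add_apply, Matrix.add_apply, Matrix.zero_apply, Matrix.diagonal_mul,
    Matrix.mul_diagonal, Matrix.smul_apply, Matrix.single_apply, Algebra.smul_def, map_add]
  split_ifs with hpq
  · rw [hpq.1, hpq.2]; simp
  · simp

/-- Diagonal matrices act diagonalizably, with eigenvalues in the additive monoid generated by their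
entries. -/
theorem mem_iSup_eigenspace_lieOp_diagonal (h : I → ℂ) (M : AddSubmonoid ℂ) (hM : ∀ i, h i ∈ M)
    (f : Matrix I I R) : f ∈ ⨆ μ : (M : Set ℂ), (lieOp (Matrix.diagonal h)).eigenspace μ := by
  have key : ∀ (r : R) (i j : I),
      r • Matrix.single i j (1 : R) ∈ ⨆ μ : (M : Set ℂ), (lieOp (Matrix.diagonal h)).eigenspace μ := by
    intro r i j
    have hr : r ∈ Submodule.span ℂ {r : R | ∃ μ ∈ M, act (Matrix.diagonal h) r = μ • r} := by
      induction r using MvPolynomial.induction_on with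
      | C a =>
        refine Submodule.subset_span ⟨0, zero_mem _, ?_⟩
        rw [zero_smul]; exact Derivation.map_algebraMap _ a
      | add p q hp hq => exact add_mem hp hq
      | mul_X p s hp =>
        induction hp using Submodule.span_induction with
        | mem r hr =>
          obtain ⟨μ, hμ, e⟩ := hr
          induction s using Sym2.ind with
          | _ i j =>
            refine Submodule.subset_span ⟨μ + (h i + h j), add_mem hμ (add_mem (hM i) (hM j)), ?_⟩
            rw [Derivation.leibniz, e, act_gen_diagonal]
            rw [smul_eq_mul, smul_eq_mul, mul_smul_comm, mul_smul_comm, add_smul μ, mul_comm r,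
              add_comm]
        | zero => simp
        | add x y _ _ ihx ihy => rw [add_mul]; exact add_mem ihx ihy
        | smul c x _ ih => rw [smul_mul_assoc]; exact Submodule.smul_mem _ _ ih
    induction hr using Submodule.span_induction with
    | mem r hr =>
      obtain ⟨μ, hμ, e⟩ := hr
      refine Submodule.mem_iSup_of_mem ⟨μ + (h i + h j), add_mem hμ (add_mem (hM i) (hM j))⟩ ?_
      rw [Module.End.mem_eigenspace_iff, lieOp_smul, e, lieOp_diagonal_single,
        add_smul μ, smul_assoc, smul_comm r]
    | zero => simp
    | add x y _ _ ihx ihy => rw [add_smul]; exact add_mem ihx ihy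
    | smul c x _ ih => rw [smul_assoc]; exact Submodule.smul_mem _ _ ih
  rw [Matrix.matrix_eq_sum_single f]
  refine Submodule.sum_mem _ fun i _ => Submodule.sum_mem _ fun j _ => ?_
  have := key (f i j) i j
  rwa [Matrix.smul_single, smul_eq_mul, mul_one] at this

/-- The raising operators act locally nilpotently. -/
theorem exists_lieOp_unit_pow_eq_zero (b : Fin 2) (f : Matrix I I R) :
    ∃ N, (lieOp (unit b 0 1) ^ N) f = 0 := by
  set m := unit b 0 1 with hm
  have hmm : m * m = 0 := by
    rw [hm]; exact Matrix.single_mul_single_of_ne _ _ _ _ (by simp) _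
  have hc : const m * const m = 0 := by
    rw [← const_mul, hmm]; exact Matrix.map_zero _ (map_zero _)
  have hc' : (const m)ᵀ * (const m)ᵀ = 0 := by
    rw [← Matrix.transpose_mul, hc, Matrix.transpose_zero]
  -- on the generators the third power vanishes, since `m` has square zero
  have hX : ∀ s, ((act m : R →ₗ[ℂ] R) ^ 3) (X s) = 0 := by
    intro s
    induction s using Sym2.ind with
    | _ i j =>
      have h2 : (gen.map (act m)).map (act m) =
          (const m)ᵀ * gen * const m + (const m)ᵀ * gen * const m := by
        rw [gen_map_act, map_derivation_add, ← const_transpose, const_mul_map, mul_const_map,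
          gen_map_act, mul_add, add_mul, const_transpose, ← mul_assoc, hc', zero_mul, zero_add,
          mul_assoc gen, hc, mul_zero, add_zero, ← mul_assoc]
      have h1 : ((const m)ᵀ * gen * const m).map (act m) = 0 := by
        rw [mul_const_map, ← const_transpose, const_mul_map, gen_map_act, mul_add, add_mul,
          const_transpose, ← mul_assoc, hc', zero_mul, zero_mul, zero_add, mul_assoc, mul_assoc, hc,
          mul_zero, mul_zero]
      have h3 : ((gen.map (act m)).map (act m)).map (act m) = 0 := by
        rw [h2, map_derivation_add, h1, add_zero]
      exact congrFun (congrFun h3 i) j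
  have hr : ∀ r : R, ∃ N, ((act m : R →ₗ[ℂ] R) ^ N) r = 0 := by
    intro r
    induction r using MvPolynomial.induction_on with
    | C a => exact ⟨1, by rw [pow_one]; exact Derivation.map_algebraMap _ a⟩
    | add p q hp hq =>
      obtain ⟨a, ha⟩ := hp
      obtain ⟨b, hb⟩ := hq
      exact ⟨a + b, by rw [map_add, pow_apply_eq_zero_of_le (Nat.le_add_right a b) ha,
        pow_apply_eq_zero_of_le (Nat.le_add_left b a) hb, add_zero]⟩
    | mul_X p s hp =>
      obtain ⟨a, ha⟩ := hp
      refine ⟨a + 3, pow_smul_eq_zero (A := R) (V := R) (act m) (act m) (fun r v => ?_) a 3 p (X s) ha (hX s)⟩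
      simp only [Derivation.coeFn_coe, smul_eq_mul, Derivation.leibniz]
      ring
  have hs : ∀ i j, (lieOp m ^ 3) (Matrix.single i j (1 : R)) = 0 := by
    intro i j
    set e := Matrix.single i j (1 : R)
    have h0 : e.map (act m) = 0 := map_act_single m i j
    have h1 : lieOp m e = const m * e + e * (const m)ᵀ := by rw [lieOp_apply, h0, zero_add]
    have h2 : lieOp m (lieOp m e) = const m * e * (const m)ᵀ + const m * e * (const m)ᵀ := by
      rw [h1, lieOp_apply, map_derivation_add, const_mul_map, ← const_transpose, mul_const_map, h0,
        mul_zero, zero_mul, add_zero, zero_add, mul_add, add_mul, const_transpose,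
        ← mul_assoc, hc, zero_mul, zero_add, mul_assoc e, hc', mul_zero, add_zero, ← mul_assoc]
    have h3 : (const m * e * (const m)ᵀ).map (act m) = 0 := by
      rw [← const_transpose, mul_const_map, const_mul_map, h0, mul_zero, zero_mul]
    change lieOp m (lieOp m (lieOp m e)) = 0
    rw [h2, map_add, lieOp_apply, h3, ← mul_assoc, ← mul_assoc, hc, mul_assoc (const m * e), hc']
    simp
  have hf : ∀ (r : R) i j,
      r • Matrix.single i j (1 : R) ∈ Module.End.maxGenEigenspace (lieOp m) 0 := by
    intro r i j
    obtain ⟨a, ha⟩ := hr r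
    have h := pow_smul_eq_zero (A := R) (V := Matrix I I R) (act m) (lieOp m) (lieOp_smul m) a 3 r
      (Matrix.single i j 1) ha (hs i j)
    exact mem_maxGenEigenspace_zero.2 ⟨a + 3, h⟩
  have hmem : f ∈ Module.End.maxGenEigenspace (lieOp m) 0 := by
    rw [Matrix.matrix_eq_sum_single f]
    refine Submodule.sum_mem _ fun i _ => Submodule.sum_mem _ fun j _ => ?_
    have := hf (f i j) i j
    rwa [Matrix.smul_single, smul_eq_mul, mul_one] at this
  exact mem_maxGenEigenspace_zero.1 hmem

theorem lieOp_comm {m m' : Matrix I I ℂ} (h : m * m' = m' * m) (f : Matrix I I R) :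
    lieOp m (lieOp m' f) = lieOp m' (lieOp m f) := by
  have h0 := lieOp_lie m m' f
  have h1 := lieOp_sub (m * m') (m' * m) f
  rw [h, sub_self, sub_self] at h1
  rw [h, sub_self] at h0
  exact sub_eq_zero.1 (h0.trans h1)

theorem unit_mul_unit (b k l b' k' l' : Fin 2) :
    unit b k l * unit b' k' l' = if b = b' ∧ l = k' then unit b k l' else 0 := by
  split_ifs with h
  · obtain ⟨rfl, rfl⟩ := h
    simp [unit]
  · refine Matrix.single_mul_single_of_ne _ _ _ _ ?_ _
    simpa [Prod.ext_iff] using h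

/-- The semisimple element of the `𝔰𝔩₂` of the block `b`. -/
def cartan (b : Fin 2) : Matrix I I ℂ := unit b 0 0 - unit b 1 1

variable {J : Subalgebra ℂ R} {S : Set (Matrix I I R)} {T : Submodule ℂ (Matrix I I R)}

theorem unit_eq_diagonal (b k : Fin 2) : unit b k k = Matrix.diagonal (Pi.single (b, k) 1) := by
  rw [unit, Matrix.diagonal_single]

/-- The first fundamental theorem: a matrix invariant under the `𝔰𝔩₂` of both blocks is, up to a
twist by the symplectic form, a combination of forms. The invariant is decomposed into eigenvectors
for the `𝔤𝔩₂` of the blocks; these have integral weights `(n, n)` in each block, so the Omega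
process applies. -/
theorem mem_of_isInvariant (h : IsFormSystem J S T) (f : Matrix I I R)
    (he : ∀ b, lieOp (unit b 0 1) f = 0) (hH : ∀ b, lieOp (cartan b) f = 0) :
    (symp R)ᵀ * f * symp R ∈ T := by
  let W : Submodule ℂ (Matrix I I R) :=
    ⨅ b, LinearMap.ker (lieOp (unit b 0 1)) ⊓ LinearMap.ker (lieOp (cartan b))
  have hW : ∀ x, x ∈ W ↔ ∀ b, lieOp (unit b 0 1) x = 0 ∧ lieOp (cartan b) x = 0 := by
    intro x; simp [W]
  let M : AddSubmonoid ℂ := AddMonoidHom.mrange (Nat.castAddMonoidHom ℂ)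
  have hM : ∀ (a : I) i, (Pi.single a 1 : I → ℂ) i ∈ M := by
    intro a i
    by_cases hi : i = a
    · subst hi; exact ⟨1, by simp⟩
    · exact ⟨0, by simp [hi]⟩
  -- the `𝔤𝔩₂` weight operator of each block preserves the space of invariants
  have hTW : ∀ b, ∀ x ∈ W, lieOp (unit b 0 0) x ∈ W := by
    intro b x hx
    rw [hW] at hx ⊢
    intro b'
    have hcart : cartan b' * unit b 0 0 = unit b 0 0 * cartan b' := by
      rw [cartan, sub_mul, mul_sub]
      simp only [unit_mul_unit]
      by_cases hb : b' = b
      · subst hb; simp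
      · simp [hb, Ne.symm hb]
    refine ⟨?_, by rw [lieOp_comm hcart, (hx b').2, map_zero]⟩
    by_cases hb : b' = b
    · subst hb
      have e : unit b' 0 0 * unit b' 0 1 - unit b' 0 1 * unit b' 0 0 = unit b' 0 1 := by
        simp
      have h1 := lieOp_lie (unit b' 0 0) (unit b' 0 1) x
      rw [(hx b').1, LinearMap.map_zero, e, (hx b').1] at h1
      exact (sub_eq_zero.1 h1).symm
    · rw [lieOp_comm (by simp [hb, Ne.symm hb]), (hx b').1, map_zero]
  let T' : Submodule ℂ (Matrix I I R) :=
    T.comap (LinearMap.mulRight ℂ (symp R) ∘ₗ LinearMap.mulLeft ℂ (symp R)ᵀ)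
  change f ∈ T'
  have hf : f ∈ W := (hW f).2 fun b => ⟨he b, hH b⟩
  have h0 := mem_iSup_inf_eigenspace _ _ W (hTW 0) hf (by
    rw [unit_eq_diagonal]; exact mem_iSup_eigenspace_lieOp_diagonal _ M (hM _) f)
  refine (iSup_le ?_ : (⨆ μ : (M : Set ℂ), W ⊓ (lieOp (unit 0 0 0)).eigenspace μ) ≤ T') h0
  rintro ⟨_, n0, rfl⟩ x ⟨hxW, hx0⟩
  have h1 := mem_iSup_inf_eigenspace (lieOp (unit 1 0 0)) _
    (W ⊓ (lieOp (unit 0 0 0)).eigenspace n0) (fun y hy => ⟨hTW 1 y hy.1, ?_⟩) ⟨hxW, hx0⟩ (by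
    rw [unit_eq_diagonal]; exact mem_iSup_eigenspace_lieOp_diagonal _ M (hM _) x)
  · refine (iSup_le ?_ : (⨆ μ : (M : Set ℂ), W ⊓ (lieOp (unit 0 0 0)).eigenspace n0 ⊓
      (lieOp (unit 1 0 0)).eigenspace μ) ≤ T') h1
    rintro ⟨_, n1, rfl⟩ y ⟨⟨hyW, hy0⟩, hy1⟩
    replace hy0 := Module.End.mem_eigenspace_iff.1 hy0
    replace hy1 := Module.End.mem_eigenspace_iff.1 hy1
    have hyW' := (hW y).1 hyW
    refine mem_of_isWeight h ![n0, n1] y (fun b => (hyW' b).1) ?_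
    have hd : ∀ b, lieOp (unit b 1 1) y = lieOp (unit b 0 0) y := by
      intro b
      have := (hyW' b).2
      rw [cartan, lieOp_sub, sub_eq_zero] at this
      exact this.symm
    intro b k
    fin_cases b <;> fin_cases k
    · exact hy0
    · exact (hd 0).trans hy0
    · exact hy1
    · exact (hd 1).trans hy1
  · have hy0 := Module.End.mem_eigenspace_iff.1 hy.2
    refine Module.End.mem_eigenspace_iff.2 ?_
    rw [lieOp_comm (by simp), hy0, map_smul]

end Weights

/-! ### The filtration and ordered products -/

section Filtration

variable {U : Type} [Ring U] [Algebra ℂ U] (x : Sym2 I → U)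

/-- The linear map from polynomials to `U` replacing a monomial by the product of the elements `x s`
in an arbitrary fixed order (that of `Multiset.toList`). No compatibility between the orders is
needed, as they agree up to lower order terms. -/
def ordered : R →ₗ[ℂ] U :=
  (basisMonomials (Sym2 I) ℂ).constr ℂ fun m => ((Finsupp.toMultiset m).toList.map x).prod

theorem ordered_monomial (m : Sym2 I →₀ ℕ) (c : ℂ) :
    ordered x (monomial m c) = c • ((Finsupp.toMultiset m).toList.map x).prod := by
  have h : (monomial m c : R) = c • basisMonomials (Sym2 I) ℂ m := by
    rw [coe_basisMonomials, smul_monomial, smul_eq_mul, mul_one]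
  rw [h, map_smul, ordered, Module.Basis.constr_basis]

theorem ordered_C (c : ℂ) : ordered x (C c) = algebraMap ℂ U c := by
  rw [← monomial_zero', ordered_monomial]
  simp [Algebra.algebraMap_eq_smul_one]

theorem ordered_X (s : Sym2 I) : ordered x (X s) = x s := by
  rw [X, ordered_monomial]
  simp

/-- The filtration of `U` by the number of factors, with index shifted by one: `fil x (n + 1)` is
spanned by the products of at most `n` of the elements `x s`, and `fil x 0` is zero. -/
def fil : ℕ → Submodule ℂ U
  | 0 => ⊥
  | n + 1 => (1 ⊔ Submodule.span ℂ (Set.range x)) ^ n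

theorem fil_succ (n : ℕ) : fil x (n + 1) = (1 ⊔ Submodule.span ℂ (Set.range x)) ^ n := rfl

theorem fil_le_succ (n : ℕ) : fil x n ≤ fil x (n + 1) := by
  rcases n with - | n
  · exact bot_le
  · rw [fil_succ, fil_succ]
    calc _ = (1 ⊔ Submodule.span ℂ (Set.range x)) ^ n * 1 := (mul_one _).symm
      _ ≤ _ := by rw [pow_succ]; exact mul_le_mul_right le_sup_left _

theorem fil_mono : Monotone (fil x) := monotone_nat_of_le_succ (fil_le_succ x)

variable {x}

theorem mul_mem_fil {a b : ℕ} {u v : U} (hu : u ∈ fil x (a + 1)) (hv : v ∈ fil x b) :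
    u * v ∈ fil x (a + b) := by
  rcases b with - | b
  · rw [(Submodule.mem_bot ℂ).1 hv, mul_zero]; exact zero_mem _
  · rw [← add_assoc, fil_succ, pow_add]; exact Submodule.mul_mem_mul hu hv

theorem mul_mem_fil' {a b : ℕ} {u v : U} (hu : u ∈ fil x a) (hv : v ∈ fil x (b + 1)) :
    u * v ∈ fil x (a + b) := by
  rcases a with - | a
  · rw [(Submodule.mem_bot ℂ).1 hu, zero_mul]; exact zero_mem _
  · rw [show a + 1 + b = (a + b) + 1 by ring, fil_succ, pow_add]; exact Submodule.mul_mem_mul hu hv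

theorem span_le_fil_two : Submodule.span ℂ (Set.range x) ≤ fil x 2 := by
  rw [fil_succ, pow_one]; exact le_sup_right

theorem mem_fil_two (s : Sym2 I) : x s ∈ fil x 2 :=
  span_le_fil_two (Submodule.subset_span ⟨s, rfl⟩)

theorem list_prod_mem_fil (l : List (Sym2 I)) : (l.map x).prod ∈ fil x (l.length + 1) := by
  induction l with
  | nil => rw [fil_succ]; exact Submodule.mem_one.2 ⟨1, map_one _⟩
  | cons a l ih =>
    rw [List.map_cons, List.prod_cons, List.length_cons, add_comm l.length 1, add_assoc]
    exact mul_mem_fil (mem_fil_two a) ih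

theorem card_toMultiset_of_isHomogeneous {n : ℕ} {p : R} (hp : p.IsHomogeneous n)
    {m : Sym2 I →₀ ℕ} (hm : m ∈ p.support) : (Finsupp.toMultiset m).card = n := by
  rw [Finsupp.card_toMultiset, ← hp (mem_support_iff.1 hm)]
  exact DFunLike.congr_fun (Finsupp.degree_eq_weight_one (σ := Sym2 I) (R := ℕ)) m

theorem ordered_mem_fil {n : ℕ} {p : R} (hp : p.IsHomogeneous n) : ordered x p ∈ fil x (n + 1) := by
  rw [p.as_sum, map_sum]
  refine Submodule.sum_mem _ fun m hm => ?_
  rw [ordered_monomial]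
  refine Submodule.smul_mem _ _ ?_
  have h : (Finsupp.toMultiset m).toList.length = n := by
    rw [Multiset.length_toList, card_toMultiset_of_isHomogeneous hp hm]
  rw [← h]
  exact list_prod_mem_fil _

variable (x) in
/-- The commutators of the elements `x s` lie in their span. -/
def IsLieClosed : Prop :=
  ∀ s t, x s * x t - x t * x s ∈ Submodule.span ℂ (Set.range x)

/-- Reordering a product changes it by terms of lower order. -/
theorem list_prod_perm (hx : IsLieClosed x) {l l' : List (Sym2 I)} (h : l.Perm l') :
    (l.map x).prod - (l'.map x).prod ∈ fil x l.length := by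
  induction h with
  | nil => simp
  | cons a _ ih =>
    simp only [List.map_cons, List.prod_cons, List.length_cons, ← mul_sub]
    rw [add_comm]
    exact mul_mem_fil (mem_fil_two a) ih
  | swap a b l =>
    simp only [List.map_cons, List.prod_cons, List.length_cons, ← mul_assoc, ← sub_mul]
    rw [show l.length + 1 + 1 = 1 + (l.length + 1) by ring]
    exact mul_mem_fil (span_le_fil_two (hx b a)) (list_prod_mem_fil l)
  | trans h1 h2 ih1 ih2 =>
    rw [← sub_add_sub_cancel]
    exact add_mem ih1 (h1.length_eq ▸ ih2)

/-- Ordered products are multiplicative up to terms of lower order. -/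
theorem ordered_mul (hx : IsLieClosed x) {a b : ℕ} {p q : R} (hp : p.IsHomogeneous a)
    (hq : q.IsHomogeneous b) : ordered x (p * q) - ordered x p * ordered x q ∈ fil x (a + b) := by
  have key : ∀ (m m' : Sym2 I →₀ ℕ) (c c' : ℂ), m ∈ p.support → m' ∈ q.support →
      ordered x (monomial m c * monomial m' c') - ordered x (monomial m c) * ordered x (monomial m' c')
        ∈ fil x (a + b) := by
    intro m m' c c' hm hm'
    rw [monomial_mul, ordered_monomial, ordered_monomial, ordered_monomial, smul_mul_smul_comm,
      ← smul_sub, ← List.prod_append, ← List.map_append]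
    refine Submodule.smul_mem _ _ ?_
    have hperm : (Finsupp.toMultiset (m + m')).toList.Perm
        ((Finsupp.toMultiset m).toList ++ (Finsupp.toMultiset m').toList) := by
      rw [← Multiset.coe_eq_coe, ← Multiset.coe_add]
      simp
    have hl : (Finsupp.toMultiset (m + m')).toList.length = a + b := by
      rw [Multiset.length_toList, map_add, Multiset.card_add, card_toMultiset_of_isHomogeneous hp hm,
        card_toMultiset_of_isHomogeneous hq hm']
    exact hl ▸ list_prod_perm hx hperm
  conv => arg 2; rw [p.as_sum, q.as_sum]
  rw [Finset.sum_mul_sum, map_sum, map_sum, map_sum, Finset.sum_mul_sum, ← Finset.sum_sub_distrib]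
  refine Submodule.sum_mem _ fun m hm => ?_
  rw [map_sum, ← Finset.sum_sub_distrib]
  exact Submodule.sum_mem _ fun m' hm' => key m m' _ _ hm hm'

/-- Every element of order `n` has a homogeneous symbol of degree `n`. The symbol need not be
unique: the Poincaré-Birkhoff-Witt theorem is not used. -/
theorem exists_ordered_sub_mem (hx : IsLieClosed x) (n : ℕ) {u : U} (hu : u ∈ fil x (n + 1)) :
    ∃ p : R, p.IsHomogeneous n ∧ u - ordered x p ∈ fil x n := by
  induction n generalizing u with
  | zero =>
    rw [fil_succ, pow_zero] at hu
    obtain ⟨c, rfl⟩ := Submodule.mem_one.1 hu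
    exact ⟨C c, isHomogeneous_C _ c, by rw [ordered_C, sub_self]; exact zero_mem _⟩
  | succ n ih =>
    let W : Submodule ℂ U :=
      { carrier := {u | ∃ p : R, p.IsHomogeneous (n + 1) ∧ u - ordered x p ∈ fil x (n + 1)}
        zero_mem' := ⟨0, isHomogeneous_zero _ _ _, by simp⟩
        add_mem' := by
          rintro u v ⟨p, hp, hu⟩ ⟨q, hq, hv⟩
          refine ⟨p + q, hp.add hq, ?_⟩
          rw [map_add, add_sub_add_comm]; exact add_mem hu hv
        smul_mem' := by
          rintro c u ⟨p, hp, hu⟩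
          refine ⟨c • p, ?_, ?_⟩
          · exact (homogeneousSubmodule (Sym2 I) ℂ (n + 1)).smul_mem c hp
          · rw [map_smul, ← smul_sub]; exact Submodule.smul_mem _ _ hu }
    change u ∈ W
    rw [fil_succ, pow_succ] at hu
    refine (Submodule.mul_le.2 ?_ : _ ≤ W) hu
    intro v hv g hg
    obtain ⟨p, hp, hvp⟩ := ih hv
    obtain ⟨g1, hg1, g2, hg2, rfl⟩ := Submodule.mem_sup.1 hg
    rw [mul_add]
    refine W.add_mem ?_ ?_
    · obtain ⟨c, rfl⟩ := Submodule.mem_one.1 hg1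
      refine ⟨0, isHomogeneous_zero _ _ _, ?_⟩
      rw [map_zero, sub_zero, ← Algebra.commutes, ← Algebra.smul_def]
      exact Submodule.smul_mem _ _ hv
    · clear hg
      induction hg2 using Submodule.span_induction with
      | mem g hg =>
        obtain ⟨s, rfl⟩ := hg
        refine ⟨p * X s, hp.mul (isHomogeneous_X _ s), ?_⟩
        have h1 := ordered_mul hx hp (isHomogeneous_X ℂ s)
        rw [ordered_X] at h1
        have h2 : (v - ordered x p) * x s ∈ fil x (n + 1) := mul_mem_fil' hvp (mem_fil_two s)
        have h3 := sub_mem h2 h1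
        rwa [sub_mul, sub_sub, add_sub_cancel] at h3
      | zero => rw [mul_zero]; exact W.zero_mem
      | add g g' _ _ h h' => rw [mul_add]; exact W.add_mem (h ) (h' )
      | smul c g _ h => rw [mul_smul_comm]; exact W.smul_mem _ (h )

theorem mem_span_mul_X {n : ℕ} {p : R} (hp : p.IsHomogeneous (n + 1)) :
    p ∈ Submodule.span ℂ {r : R | ∃ q : R, q.IsHomogeneous n ∧ ∃ s, q * X s = r} := by
  rw [p.as_sum]
  refine Submodule.sum_mem _ fun m hm => Submodule.subset_span ?_
  have hd : m.degree = n + 1 := by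
    exact (Finsupp.card_toMultiset m).symm.trans (card_toMultiset_of_isHomogeneous hp hm)
  obtain ⟨s, hs⟩ : ∃ s, m s ≠ 0 := by
    by_contra! h
    have : m = 0 := Finsupp.ext h
    simp [this] at hd
  have hle : Finsupp.single s 1 ≤ m := by
    rw [Finsupp.single_le_iff]; omega
  refine ⟨monomial (m - Finsupp.single s 1) (coeff m p), isHomogeneous_monomial _ ?_, s, ?_⟩
  · have h2 : (m - Finsupp.single s 1 + Finsupp.single s 1).degree = n + 1 := by
      rw [tsub_add_cancel_of_le hle, hd]
    rw [map_add, Finsupp.degree_single] at h2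
    omega
  · rw [X, monomial_mul, mul_one, tsub_add_cancel_of_le hle]

theorem act_X_isHomogeneous (m : Matrix I I ℂ) (s : Sym2 I) : (act m (X s)).IsHomogeneous 1 := by
  induction s using Sym2.ind with
  | _ i j =>
    have hg : ∀ (c : ℂ) i j, (algebraMap ℂ R c * gen i j).IsHomogeneous 1 := by
      intro c i j
      have := (isHomogeneous_C (Sym2 I) c).mul (isHomogeneous_X ℂ s(i, j))
      rwa [zero_add] at this
    rw [act_X, Matrix.add_apply, Matrix.mul_apply, Matrix.mul_apply]
    refine IsHomogeneous.add (IsHomogeneous.sum _ _ _ fun k _ => hg _ _ _)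
      (IsHomogeneous.sum _ _ _ fun k _ => ?_)
    rw [mul_comm]; exact hg _ _ _

theorem act_isHomogeneous (m : Matrix I I ℂ) {n : ℕ} {p : R} (hp : p.IsHomogeneous n) :
    (act m p).IsHomogeneous n := by
  induction n generalizing p with
  | zero =>
    obtain ⟨c, rfl⟩ : ∃ c, p = C c := ⟨coeff 0 p, totalDegree_eq_zero_iff_eq_C.1 
      ((totalDegree_zero_iff_isHomogeneous _).2 hp)⟩
    rw [show act m (C c) = 0 from Derivation.map_algebraMap _ c]
    exact isHomogeneous_zero _ _ _
  | succ n ih =>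
    have h := mem_span_mul_X hp
    clear hp
    change act m p ∈ homogeneousSubmodule (Sym2 I) ℂ (n + 1)
    induction h using Submodule.span_induction with
    | mem p hq =>
      obtain ⟨q, hq, s, rfl⟩ := hq
      rw [Derivation.leibniz]
      refine add_mem ?_ ?_
      · exact hq.mul (act_X_isHomogeneous m s)
      · rw [smul_eq_mul, mul_comm]
        exact (ih hq).mul (isHomogeneous_X _ s)
    | zero => rw [map_zero]; exact zero_mem _
    | add p q _ _ h h' => rw [map_add]; exact add_mem (h ) (h' )
    | smul c p _ h => rw [Derivation.map_smul]; exact Submodule.smul_mem _ c (h)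


theorem lie_mem_fil {y : U} (hy : ∀ s, y * x s - x s * y ∈ Submodule.span ℂ (Set.range x))
    {n : ℕ} {u : U} (hu : u ∈ fil x n) : y * u - u * y ∈ fil x n := by
  rcases n with - | n
  · rw [(Submodule.mem_bot ℂ).1 hu, mul_zero, zero_mul, sub_zero]; exact zero_mem _
  induction n generalizing u with
  | zero =>
    rw [fil_succ, pow_zero] at hu
    obtain ⟨c, rfl⟩ := Submodule.mem_one.1 hu
    rw [Algebra.commutes, sub_self]; exact zero_mem _
  | succ n ih =>
    let W : Submodule ℂ U := (fil x (n + 2)).comap (LinearMap.mulLeft ℂ y - LinearMap.mulRight ℂ y)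
    change u ∈ W
    rw [fil_succ, pow_succ] at hu
    refine (Submodule.mul_le.2 ?_ : _ ≤ W) hu
    intro v hv g hg
    have hv' := ih hv
    have hg' : y * g - g * y ∈ fil x 2 := by
      obtain ⟨g1, hg1, g2, hg2, rfl⟩ := Submodule.mem_sup.1 hg
      obtain ⟨c, rfl⟩ := Submodule.mem_one.1 hg1
      rw [mul_add, add_mul, add_sub_add_comm, ← Algebra.commutes, sub_self, zero_add]
      clear hg
      induction hg2 using Submodule.span_induction with
      | mem g hg =>
        obtain ⟨s, rfl⟩ := hg
        exact span_le_fil_two (hy s)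
      | zero => rw [mul_zero, zero_mul, sub_zero]; exact zero_mem _
      | add g g' _ _ h h' => rw [mul_add, add_mul, add_sub_add_comm]; exact add_mem h h'
      | smul c g _ h =>
        rw [mul_smul_comm, smul_mul_assoc, ← smul_sub]; exact Submodule.smul_mem _ c h
    have e : (LinearMap.mulLeft ℂ y - LinearMap.mulRight ℂ y) (v * g)
        = (y * v - v * y) * g + v * (y * g - g * y) := by
      change y * (v * g) - v * g * y = _
      noncomm_ring
    change (LinearMap.mulLeft ℂ y - LinearMap.mulRight ℂ y) (v * g) ∈ fil x (n + 2)
    have hg2 : g ∈ fil x 2 := by rw [fil_succ, pow_one]; exact hg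
    rw [e]
    exact add_mem (mul_mem_fil' (a := n + 1) (b := 1) hv' hg2)
      (mul_mem_fil (a := n) (b := 2) hv hg')

theorem lie_mem_span {m : Matrix I I ℂ} {y : U}
    (hy : ∀ s, y * x s - x s * y = ordered x (act m (X s))) (s : Sym2 I) :
    y * x s - x s * y ∈ Submodule.span ℂ (Set.range x) := by
  rw [hy]
  have h := mem_span_mul_X (act_X_isHomogeneous m s)
  generalize act m (X s) = r at h
  induction h using Submodule.span_induction with
  | mem p hq =>
    obtain ⟨q, hq, t, rfl⟩ := hq
    obtain ⟨c, rfl⟩ : ∃ c, q = C c := ⟨coeff 0 q, totalDegree_eq_zero_iff_eq_C.1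
      ((totalDegree_zero_iff_isHomogeneous _).2 hq)⟩
    rw [← smul_eq_C_mul, map_smul, ordered_X]
    exact Submodule.smul_mem _ _ (Submodule.subset_span ⟨t, rfl⟩)
  | zero => rw [map_zero]; exact zero_mem _
  | add p q _ _ h h' => rw [map_add]; exact add_mem h h'
  | smul c p _ h => rw [map_smul]; exact Submodule.smul_mem _ _ h

/-- `ordered x` is equivariant up to terms of lower order. -/
theorem ordered_act_sub_mem (hx : IsLieClosed x) (m : Matrix I I ℂ) {y : U}
    (hy : ∀ s, y * x s - x s * y = ordered x (act m (X s))) {n : ℕ} {p : R}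
    (hp : p.IsHomogeneous n) :
    ordered x (act m p) - (y * ordered x p - ordered x p * y) ∈ fil x n := by
  have hy' := lie_mem_span hy
  induction n generalizing p with
  | zero =>
    obtain ⟨c, rfl⟩ : ∃ c, p = C c := ⟨coeff 0 p, totalDegree_eq_zero_iff_eq_C.1
      ((totalDegree_zero_iff_isHomogeneous _).2 hp)⟩
    rw [show act m (C c) = 0 from Derivation.map_algebraMap _ c, map_zero, ordered_C,
      Algebra.commutes, sub_self, sub_zero]
    exact zero_mem _
  | succ n ih =>
    have h := mem_span_mul_X hp
    clear hp
    induction h using Submodule.span_induction with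
    | mem p hq =>
      obtain ⟨q, hq, s, rfl⟩ := hq
      have h1 := ordered_mul hx hq (isHomogeneous_X ℂ s)
      have h2 := ordered_mul hx hq (act_X_isHomogeneous m s)
      have h3 := ordered_mul hx (act_isHomogeneous m hq) (isHomogeneous_X ℂ s)
      have h4 : _ ∈ fil x (n + 1) := mul_mem_fil' (ih hq) (mem_fil_two s)
      have h5 := lie_mem_fil hy' h1
      rw [ordered_X] at h1 h3 h5
      rw [Derivation.leibniz, smul_eq_mul, smul_eq_mul, mul_comm (X s), map_add]
      rw [← hy] at h2
      have e : ordered x (q * act m (X s)) + ordered x (act m q * X s)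
          - (y * ordered x (q * X s) - ordered x (q * X s) * y)
          = (ordered x (q * act m (X s)) - ordered x q * (y * x s - x s * y))
            + (ordered x (act m q * X s) - ordered x (act m q) * x s)
            + (ordered x (act m q) - (y * ordered x q - ordered x q * y)) * x s
            - (y * (ordered x (q * X s) - ordered x q * x s)
              - (ordered x (q * X s) - ordered x q * x s) * y) := by noncomm_ring
      rw [e]
      exact sub_mem (add_mem (add_mem h2 h3) h4) h5
    | zero => simp
    | add p q _ _ h h' =>
      have := add_mem h h'
      rw [map_add, map_add, map_add, mul_add, add_mul, add_sub_add_comm (y * _), add_sub_add_comm]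
      exact this
    | smul c p _ h =>
      have := Submodule.smul_mem _ c h
      rw [Derivation.map_smul, map_smul, map_smul, mul_smul_comm, smul_mul_assoc, ← smul_sub,
        ← smul_sub]
      exact this

end Filtration

/-! ### Symbols and invariant symbols -/

section Lifting

/-- A vector killed modulo a stable subspace `Z` by an `𝔰𝔩₂`-triple can be corrected by an element
of `Z` to one killed exactly: first project to weight zero, then apply the extremal projector. -/
theorem exists_killed_sub_mem {V : Type*} [AddCommGroup V] [Module ℂ V] {E F H : Module.End ℂ V}
    (hEF : ∀ v, E (F v) = F (E v) + H v) (hHE : ∀ v, H (E v) = E (H v) + (2 : ℂ) • E v)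
    (hHF : ∀ v, H (F v) = F (H v) - (2 : ℂ) • F v) (hH : ∀ v, v ∈ ⨆ μ : ℂ, H.eigenspace μ)
    (hE : ∀ v, ∃ N, (E ^ N) v = 0) (Z : Submodule ℂ V) (hZE : ∀ z ∈ Z, E z ∈ Z)
    (hZF : ∀ z ∈ Z, F z ∈ Z) (hZH : ∀ z ∈ Z, H z ∈ Z) (v : V) (hvE : E v ∈ Z) (hvH : H v ∈ Z) :
    ∃ w, w - v ∈ Z ∧ E w = 0 ∧ H w = 0 ∧ ∀ C : Module.End ℂ V,
      Commute C E → Commute C F → Commute C H → C v = 0 → C w = 0 := by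
  have hpow : ∀ (T : Module.End ℂ V), (∀ z ∈ Z, T z ∈ Z) → ∀ k, ∀ z ∈ Z, (T ^ k) z ∈ Z := by
    intro T hT k
    induction k with
    | zero => intro z hz; simpa using hz
    | succ k ih => intro z hz; rw [pow_succ, Module.End.mul_apply]; exact ih _ (hT z hz)
  obtain ⟨q, hq, hq0⟩ := exists_polynomial_mul_eq_zero H (hH v)
  obtain ⟨N, hN⟩ := hE (Polynomial.aeval H q v)
  set u := Polynomial.aeval H q v with hu
  have huv : u - v ∈ Z := by
    have h1 : q = Polynomial.C 1 + q.divX * Polynomial.X := by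
      have h2 := q.divX_mul_X_add
      rw [Polynomial.coeff_zero_eq_eval_zero, hq] at h2
      rw [add_comm]; exact h2.symm
    rw [hu, h1, map_add, Polynomial.aeval_C, map_one, LinearMap.add_apply, Module.End.one_apply,
      add_sub_cancel_left, map_mul, Polynomial.aeval_X, Module.End.mul_apply,
      Polynomial.aeval_eq_sum_range, LinearMap.sum_apply]
    exact Submodule.sum_mem _ fun k _ => Submodule.smul_mem _ _ (hpow H hZH k _ hvH)
  have huE : E u ∈ Z := by
    have := add_mem (hZE _ huv) hvE
    rwa [map_sub, sub_add_cancel] at this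
  have hproj : extremalProj E F (N + 1) u - u ∈ Z := by
    have h0 : extremalCoeff 0 = 1 := by simp [extremalCoeff]
    rw [extremalProj, Finset.sum_range_succ', h0, pow_zero, pow_zero, one_smul, mul_one,
      LinearMap.add_apply, Module.End.one_apply, add_sub_cancel_right, LinearMap.sum_apply]
    refine Submodule.sum_mem _ fun k _ => Submodule.smul_mem _ _ ?_
    rw [Module.End.mul_apply, pow_succ E, Module.End.mul_apply]
    exact hpow F hZF _ _ (hpow E hZE _ _ huE)
  refine ⟨extremalProj E F (N + 1) u, ?_, ?_, ?_, ?_⟩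
  · have := add_mem hproj huv
    rwa [sub_add_sub_cancel] at this
  · exact raise_extremalProj hEF hHE hHF hq0 (pow_apply_eq_zero_of_le (Nat.le_succ N) hN)
  · exact weight_extremalProj hHE hHF hq0 _
  · intro C hCE hCF hCH hC
    have h1 : Commute C (Polynomial.aeval H q) := by
      rw [Polynomial.aeval_eq_sum_range]
      exact Commute.sum_right _ _ _ fun k _ => (hCH.pow_right k).smul_right _
    have h2 : Commute C (extremalProj E F (N + 1)) :=
      Commute.sum_right _ _ _ fun k _ => ((hCF.pow_right k).mul_right (hCE.pow_right k)).smul_right _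
    calc C (extremalProj E F (N + 1) u) = extremalProj E F (N + 1) (C u) :=
          LinearMap.congr_fun h2.eq u
      _ = extremalProj E F (N + 1) (Polynomial.aeval H q (C v)) := by
          rw [hu]; exact congrArg _ (LinearMap.congr_fun h1.eq v)
      _ = 0 := by rw [hC, map_zero, map_zero]

variable {U : Type} [Ring U] [Algebra ℂ U] {x : Sym2 I → U}

variable (x) in
/-- `f` is a homogeneous matrix of degree `n` whose ordered products give `M` up to terms of lower
order. -/
def IsSymbol (n : ℕ) (M : Matrix I I U) (f : Matrix I I R) : Prop :=
  ∀ i j, (f i j).IsHomogeneous n ∧ M i j - ordered x (f i j) ∈ fil x n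

/-- The action on matrices over `U` of a pair of `y : U`, acting on the entries by commutators, and
a complex matrix `m`. It lifts the operator `lieOp m`. -/
def lieOpU (y : U) (m : Matrix I I ℂ) (M : Matrix I I U) : Matrix I I U :=
  Matrix.of (fun i j => y * M i j - M i j * y) + m.map (algebraMap ℂ U) * M
    + M * (m.map (algebraMap ℂ U))ᵀ

theorem isSymbol_lieOp (hx : IsLieClosed x) {m : Matrix I I ℂ} {y : U}
    (hy : ∀ s, y * x s - x s * y = ordered x (act m (X s))) {n : ℕ} {M : Matrix I I U}
    {f : Matrix I I R} (h : IsSymbol x n M f) : IsSymbol x n (lieOpU y m M) (lieOp m f) := by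
  have hy' := lie_mem_span hy
  intro i j
  have hL : ∀ k, (algebraMap ℂ R (m i k)) * f k j = m i k • f k j := fun k => (Algebra.smul_def _ _).symm
  have hR : ∀ k, f i k * (algebraMap ℂ R (m j k)) = m j k • f i k := fun k => by
    rw [mul_comm, Algebra.smul_def]
  have hLU : ∀ k, (algebraMap ℂ U (m i k)) * M k j = m i k • M k j := fun k => (Algebra.smul_def _ _).symm
  have hRU : ∀ k, M i k * (algebraMap ℂ U (m j k)) = m j k • M i k := fun k => by
    rw [← Algebra.commutes, Algebra.smul_def]
  have hf : lieOp m f i j = act m (f i j) + ∑ k, m i k • f k j + ∑ k, m j k • f i k := by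
    rw [lieOp_apply, Matrix.add_apply, Matrix.add_apply, Matrix.mul_apply, Matrix.mul_apply]
    simp only [Matrix.map_apply, Matrix.transpose_apply, hL, hR]
  have hM : lieOpU y m M i j = (y * M i j - M i j * y) + ∑ k, m i k • M k j + ∑ k, m j k • M i k := by
    rw [lieOpU, Matrix.add_apply, Matrix.add_apply, Matrix.mul_apply, Matrix.mul_apply]
    simp only [Matrix.map_apply, Matrix.transpose_apply, Matrix.of_apply, hLU, hRU]
  rw [hf, hM]
  constructor
  · refine ((act_isHomogeneous m (h i j).1).add (IsHomogeneous.sum _ _ _ fun k _ => ?_)).add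
      (IsHomogeneous.sum _ _ _ fun k _ => ?_)
    · exact (homogeneousSubmodule (Sym2 I) ℂ n).smul_mem _ (h k j).1
    · exact (homogeneousSubmodule (Sym2 I) ℂ n).smul_mem _ (h i k).1
  · have h1 := ordered_act_sub_mem hx m hy (h i j).1
    have h2 := lie_mem_fil hy' (h i j).2
    have h3 : ∑ k, m i k • (M k j - ordered x (f k j)) ∈ fil x n :=
      Submodule.sum_mem _ fun k _ => Submodule.smul_mem _ _ (h k j).2
    have h4 : ∑ k, m j k • (M i k - ordered x (f i k)) ∈ fil x n :=
      Submodule.sum_mem _ fun k _ => Submodule.smul_mem _ _ (h i k).2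
    have e := add_mem (add_mem (sub_mem h2 h1) h3) h4
    simp only [smul_sub, Finset.sum_sub_distrib] at e
    simp only [map_add, map_sum, map_smul]
    convert e using 1
    noncomm_ring

theorem exists_isSymbol (hx : IsLieClosed x) {n : ℕ} {M : Matrix I I U}
    (hM : ∀ i j, M i j ∈ fil x (n + 1)) : ∃ f, IsSymbol x n M f := by
  choose f hf using fun i j => exists_ordered_sub_mem hx n (hM i j)
  exact ⟨Matrix.of f, hf⟩

/-- The elements of `U` whose commutators with the generators `x s` are the action of the standard
`𝔰𝔩₂`-triples of the two blocks on the entries of the generic matrix. -/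
structure IsSpinorTriple (x : Sym2 I → U) (e f h : Fin 2 → U) : Prop where
  lie_e : ∀ b s, e b * x s - x s * e b = ordered x (act (unit b 0 1) (X s))
  lie_f : ∀ b s, f b * x s - x s * f b = ordered x (act (unit b 1 0) (X s))
  lie_h : ∀ b s, h b * x s - x s * h b = ordered x (act (cartan b) (X s))

theorem lieOp_cartan_mem_iSup_eigenspace (b : Fin 2) (f : Matrix I I R) :
    f ∈ ⨆ μ : ℂ, (lieOp (cartan b)).eigenspace μ := by
  have h : cartan b = Matrix.diagonal (Pi.single (b, 0) 1 - Pi.single (b, 1) 1) := by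
    rw [cartan, unit_eq_diagonal, unit_eq_diagonal, Matrix.diagonal_sub]; rfl
  rw [h]
  have := mem_iSup_eigenspace_lieOp_diagonal (Pi.single (b, 0) 1 - Pi.single (b, 1) 1) ⊤
    (fun _ => trivial) f
  exact SetLike.le_def.1
    (iSup_le fun μ => le_iSup (fun μ : ℂ => Module.End.eigenspace (lieOp _) μ) μ.1) this

theorem lieOp_two_smul (m : Matrix I I ℂ) (f : Matrix I I R) :
    lieOp ((2 : ℂ) • m) f = (2 : ℂ) • lieOp m f := by
  have h := lieOp_sub m (-m) f
  have h' := lieOp_sub 0 m f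
  have h0 := lieOp_sub 0 0 f
  rw [sub_self, sub_self] at h0
  rw [h0, zero_sub, zero_sub] at h'
  rw [h', sub_neg_eq_add, sub_neg_eq_add] at h
  rw [two_smul, two_smul, h]

/-- A matrix over `U` killed by the raising and the semisimple elements has a symbol killed by them.
An arbitrary symbol is killed up to matrices that are symbols of zero; it is corrected first by the
`𝔰𝔩₂` of one block and then by that of the other, which commutes with the first one. -/
theorem exists_isSymbol_killed (hx : IsLieClosed x) {e f h : Fin 2 → U}
    (ht : IsSpinorTriple x e f h) {n : ℕ} {M : Matrix I I U} (hM : ∀ i j, M i j ∈ fil x (n + 1))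
    (he : ∀ b, lieOpU (e b) (unit b 0 1) M = 0)
    (hh : ∀ b, lieOpU (h b) (cartan b) M = 0) :
    ∃ g, IsSymbol x n M g ∧ (∀ b, lieOp (unit b 0 1) g = 0) ∧ ∀ b, lieOp (cartan b) g = 0 := by
  -- the symbols of zero form a subspace stable under the action
  let Z : Submodule ℂ (Matrix I I R) :=
    { carrier := {g | IsSymbol x n 0 g}
      zero_mem' := fun i j => ⟨isHomogeneous_zero _ _ _, by simp⟩
      add_mem' := fun {g g'} hg hg' i j => ⟨(hg i j).1.add (hg' i j).1, by
        have := add_mem (hg i j).2 (hg' i j).2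
        simp only [Matrix.zero_apply, zero_sub] at this ⊢
        rw [Matrix.add_apply, map_add, neg_add]; exact this⟩
      smul_mem' := fun c g hg i j => ⟨(homogeneousSubmodule (Sym2 I) ℂ n).smul_mem c (hg i j).1, by
        have := Submodule.smul_mem _ c (hg i j).2
        simp only [Matrix.zero_apply, zero_sub] at this ⊢
        rw [Matrix.smul_apply, map_smul, ← smul_neg]; exact this⟩ }
  have hU0 : ∀ (y : U) m, lieOpU y m 0 = 0 := by
    intro y m
    ext i j
    simp [lieOpU]
  have hZ : ∀ {y : U} {m}, (∀ s, y * x s - x s * y = ordered x (act m (X s))) →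
      ∀ g ∈ Z, lieOp m g ∈ Z := by
    intro y m hy g hg
    have := isSymbol_lieOp hx hy hg
    rwa [hU0] at this
  have hZM : ∀ {y : U} {m}, (∀ s, y * x s - x s * y = ordered x (act m (X s))) →
      lieOpU y m M = 0 → ∀ g, IsSymbol x n M g → lieOp m g ∈ Z := by
    intro y m hy hyM g hg
    have := isSymbol_lieOp hx hy hg
    rwa [hyM] at this
  have hadd : ∀ g g', IsSymbol x n M g → g' - g ∈ Z → IsSymbol x n M g' := by
    intro g g' hg hgg' i j
    have h1 := (hgg' i j).1.add (hg i j).1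
    have h2 := add_mem (hgg' i j).2 (hg i j).2
    rw [Matrix.sub_apply, sub_add_cancel] at h1
    refine ⟨h1, ?_⟩
    rw [Matrix.sub_apply, map_sub, Matrix.zero_apply] at h2
    convert h2 using 1
    noncomm_ring
  have h1 : ∀ (b : Fin 2) v, lieOp (unit b 0 1) (lieOp (unit b 1 0) v) =
      lieOp (unit b 1 0) (lieOp (unit b 0 1) v) + lieOp (cartan b) v := by
    intro b v
    have := lieOp_lie (unit b 0 1) (unit b 1 0) v
    rw [← sub_eq_iff_eq_add', this, cartan]
    simp
  have h2 : ∀ (b : Fin 2) v, lieOp (cartan b) (lieOp (unit b 0 1) v) =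
      lieOp (unit b 0 1) (lieOp (cartan b) v) + (2 : ℂ) • lieOp (unit b 0 1) v := by
    intro b v
    have := lieOp_lie (cartan b) (unit b 0 1) v
    rw [← sub_eq_iff_eq_add', this, ← lieOp_two_smul, cartan, sub_mul, mul_sub, two_smul]
    simp
  have h3 : ∀ (b : Fin 2) v, lieOp (cartan b) (lieOp (unit b 1 0) v) =
      lieOp (unit b 1 0) (lieOp (cartan b) v) - (2 : ℂ) • lieOp (unit b 1 0) v := by
    intro b v
    have := lieOp_lie (unit b 1 0) (cartan b) v
    have e : unit b 1 0 * cartan b - cartan b * unit b 1 0 = (2 : ℂ) • unit b 1 0 := by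
      rw [cartan, sub_mul, mul_sub, two_smul]
      simp
    rw [e, lieOp_two_smul] at this
    rw [← this, sub_sub_cancel]
  obtain ⟨g0, hg0⟩ := exists_isSymbol hx hM
  obtain ⟨g1, hg1, hg1E, hg1H, -⟩ := exists_killed_sub_mem (h1 0) (h2 0) (h3 0)
    (lieOp_cartan_mem_iSup_eigenspace 0) (exists_lieOp_unit_pow_eq_zero 0) Z (hZ (ht.lie_e 0))
    (hZ (ht.lie_f 0)) (hZ (ht.lie_h 0)) g0 (hZM (ht.lie_e 0) (he 0) g0 hg0)
    (hZM (ht.lie_h 0) (hh 0) g0 hg0)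
  replace hg1 := hadd g0 g1 hg0 hg1
  obtain ⟨g2, hg2, hg2E, hg2H, hg2C⟩ := exists_killed_sub_mem (h1 1) (h2 1) (h3 1)
    (lieOp_cartan_mem_iSup_eigenspace 1) (exists_lieOp_unit_pow_eq_zero 1) Z (hZ (ht.lie_e 1))
    (hZ (ht.lie_f 1)) (hZ (ht.lie_h 1)) g1 (hZM (ht.lie_e 1) (he 1) g1 hg1)
    (hZM (ht.lie_h 1) (hh 1) g1 hg1)
  have hc : ∀ {m m' : Matrix I I ℂ}, m * m' = m' * m → Commute (lieOp m) (lieOp m') :=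
    fun h => LinearMap.ext fun v => lieOp_comm h v
  refine ⟨g2, hadd g1 g2 hg1 hg2, fun b => ?_, fun b => ?_⟩
  · fin_cases b
    · exact hg2C _ (hc (by simp)) (hc (by simp)) (hc (by simp [cartan, sub_mul, mul_sub])) hg1E
    · exact hg2E
  · fin_cases b
    · exact hg2C _ (hc (by simp [cartan, sub_mul, mul_sub]))
        (hc (by simp [cartan, sub_mul, mul_sub])) (hc (by simp [cartan, sub_mul, mul_sub])) hg1H
    · exact hg2H

end Lifting

/-! ### Traces and the algebra of the generic endomorphism -/

section TraceClosure

/-- The generic symmetric matrix, turned by the symplectic form into an endomorphism of the spinor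
space. -/
def genEnd : Matrix I I R := -(gen * symp R)

/-- The determinant of the `b`-th diagonal block of the generic symmetric matrix. -/
def blockDet (b : Fin 2) : R := gen (b, 0) (b, 0) * gen (b, 1) (b, 1) - gen (b, 0) (b, 1) ^ 2

theorem symp_mul_symp {A : Type} [Ring A] : symp A * symp A = -1 := by
  ext1 ⟨a, i⟩ ⟨c, j⟩
  rw [Matrix.mul_apply, Fintype.sum_prod_type]
  fin_cases a <;> fin_cases c <;> fin_cases i <;> fin_cases j <;> simp [symp, eps]

theorem symp_transpose : (symp R)ᵀ = -symp R := by
  ext1 ⟨a, i⟩ ⟨c, j⟩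
  fin_cases a <;> fin_cases c <;> fin_cases i <;> fin_cases j <;> simp [symp, eps]

theorem proj_mul_proj (b c : Fin 2) : proj R b * proj R c = if b = c then proj R b else 0 := by
  rw [proj, proj, Matrix.diagonal_mul_diagonal]
  split_ifs with h
  · subst h; simp
  · rw [← Matrix.diagonal_zero]
    congr 1; ext1 i
    by_cases hb : i.1 = b
    · simp [hb, h]
    · simp [hb]

theorem proj_idem (b : Fin 2) : proj R b * proj R b = proj R b := by simp [proj_mul_proj]

theorem proj_mul_symp (b : Fin 2) : proj R b * symp R = symp R * proj R b := by
  ext1 i j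
  rw [proj, Matrix.diagonal_mul, Matrix.mul_diagonal, symp, Matrix.of_apply]
  by_cases h : i.1 = j.1 <;> simp [h]

theorem proj_add_proj_rev (b : Fin 2) : proj R b + proj R b.rev = 1 := by
  rw [proj, proj, Matrix.diagonal_add, ← Matrix.diagonal_one]
  congr 1; ext1 i
  obtain ⟨i, j⟩ := i
  fin_cases b <;> fin_cases i <;> simp

/-- The adjoint of `M` for the symplectic form on the spinor space. -/
def adj (M : Matrix I I R) : Matrix I I R := -(symp R * Mᵀ * symp R)

theorem adj_mul (M M' : Matrix I I R) : adj (M * M') = adj M' * adj M := by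
  have h : symp R * M'ᵀ * (symp R * symp R) * Mᵀ * symp R = -(symp R * M'ᵀ * Mᵀ * symp R) := by
    rw [symp_mul_symp]; noncomm_ring
  rw [adj, adj, adj, Matrix.transpose_mul, neg_mul_neg, ← mul_assoc (symp R), ← h]
  simp only [mul_assoc]

theorem adj_one : adj 1 = 1 := by
  rw [adj, Matrix.transpose_one, mul_one, symp_mul_symp, neg_neg]

theorem adj_proj (b : Fin 2) : adj (proj R b) = proj R b := by
  rw [adj, proj, Matrix.diagonal_transpose, ← proj, ← proj_mul_symp, mul_assoc, symp_mul_symp,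
    mul_neg, mul_one, neg_neg]

theorem adj_genEnd : adj genEnd = -genEnd := by
  rw [adj, genEnd, Matrix.transpose_neg, Matrix.transpose_mul, gen_transpose, symp_transpose,
    neg_mul, neg_neg, ← mul_assoc, symp_mul_symp]
  noncomm_ring

/-- The algebra of matrices generated by the generic endomorphism and the block projections. -/
def endAlg : Subalgebra ℂ (Matrix I I R) := Algebra.adjoin ℂ ({genEnd} ∪ Set.range (proj R))

theorem genEnd_mem : genEnd ∈ endAlg := Algebra.subset_adjoin (Or.inl rfl)

theorem proj_mem (b : Fin 2) : proj R b ∈ endAlg := Algebra.subset_adjoin (Or.inr ⟨b, rfl⟩)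

theorem adj_mem {M : Matrix I I R} (hM : M ∈ endAlg) : adj M ∈ endAlg := by
  induction hM using Algebra.adjoin_induction with
  | mem M hM =>
    rcases hM with rfl | ⟨b, rfl⟩
    · rw [adj_genEnd]; exact neg_mem genEnd_mem
    · rw [adj_proj]; exact proj_mem b
  | algebraMap c =>
    have : adj (algebraMap ℂ (Matrix I I R) c) = c • adj 1 := by
      simp [adj, Algebra.algebraMap_eq_smul_one]
    rw [this, adj_one]
    exact Subalgebra.smul_mem _ (one_mem _) c
  | add M M' _ _ h h' =>
    have : adj (M + M') = adj M + adj M' := by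
      simp only [adj, Matrix.transpose_add]; noncomm_ring
    rw [this]; exact add_mem h h'
  | mul M M' _ _ h h' => rw [adj_mul]; exact mul_mem h' h

theorem trace_proj_mul (b : Fin 2) (M : Matrix I I R) :
    (proj R b * M).trace = M (b, 0) (b, 0) + M (b, 1) (b, 1) := by
  simp only [Matrix.trace, Matrix.diag_apply, proj, Matrix.diagonal_mul, Fintype.sum_prod_type,
    Fin.sum_univ_two]
  fin_cases b <;> simp

/-- The Cayley-Hamilton identity `m + adj m = tr m` in the `b`-th diagonal block. -/
theorem trace_smul_proj (b : Fin 2) (M : Matrix I I R) :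
    (proj R b * M).trace • proj R b = proj R b * M * proj R b + adj (proj R b * M * proj R b) := by
  rw [trace_proj_mul]
  have h : adj (proj R b * M * proj R b) = proj R b * adj M * proj R b := by
    rw [adj_mul, adj_mul, adj_proj, mul_assoc]
  rw [h]
  ext1 ⟨a, i⟩ ⟨c, j⟩
  have ha : adj M (b, 0) (b, 0) = M (b, 1) (b, 1) ∧ adj M (b, 0) (b, 1) = -M (b, 0) (b, 1) ∧
      adj M (b, 1) (b, 0) = -M (b, 1) (b, 0) ∧ adj M (b, 1) (b, 1) = M (b, 0) (b, 0) := by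
    refine ⟨?_, ?_, ?_, ?_⟩ <;>
    · simp only [adj, Matrix.neg_apply, Matrix.mul_apply, Fintype.sum_prod_type, Fin.sum_univ_two]
      fin_cases b <;> simp [symp, eps]
  obtain ⟨h1, h2, h3, h4⟩ := ha
  rw [Matrix.add_apply, Matrix.smul_apply, proj, Matrix.mul_diagonal, Matrix.diagonal_mul,
    Matrix.mul_diagonal, Matrix.diagonal_mul, Matrix.diagonal_apply]
  by_cases hac : a = b
  · subst hac
    by_cases hc : c = a
    · subst hc
      fin_cases i <;> fin_cases j <;> simp [h1, h2, h3, h4]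
      ring
    · simp [hc, Ne.symm hc]
  · simp [hac]

/-- A block trace of an element of the algebra, acting on the same block, stays in the algebra. -/
theorem trace_smul_proj_mem (b : Fin 2) {M : Matrix I I R} (hM : M ∈ endAlg) :
    (proj R b * M).trace • proj R b ∈ endAlg := by
  rw [trace_smul_proj]
  have : proj R b * M * proj R b ∈ endAlg := mul_mem (mul_mem (proj_mem b) hM) (proj_mem b)
  exact add_mem this (adj_mem this)

/-- The `b`-th diagonal block of the generic endomorphism. -/
def blockEnd (b : Fin 2) : Matrix I I R := proj R b * genEnd * proj R b

theorem blockEnd_apply (b : Fin 2) (i j : I) :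
    blockEnd b i j = (if i.1 = b then 1 else 0) * genEnd i j * (if j.1 = b then 1 else 0) := by
  rw [blockEnd, proj, Matrix.mul_diagonal, Matrix.diagonal_mul]

theorem genEnd_apply_zero (i : I) (b : Fin 2) : genEnd i (b, 0) = gen i (b, 1) := by
  simp only [genEnd, Matrix.neg_apply, Matrix.mul_apply, Fintype.sum_prod_type, Fin.sum_univ_two]
  fin_cases b <;> simp [symp, eps]

theorem genEnd_apply_one (i : I) (b : Fin 2) : genEnd i (b, 1) = -gen i (b, 0) := by
  simp only [genEnd, Matrix.neg_apply, Matrix.mul_apply, Fintype.sum_prod_type, Fin.sum_univ_two]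
  fin_cases b <;> simp [symp, eps]

theorem gen_symm (i j : I) : gen i j = gen j i := by
  rw [gen_apply, gen_apply, Sym2.eq_swap]

theorem blockEnd_sq (b : Fin 2) : blockEnd b * blockEnd b = -(blockDet b • proj R b) := by
  ext1 ⟨a, i⟩ ⟨c, j⟩
  have hs := gen_symm (b, 1) (b, 0)
  rw [Matrix.mul_apply, Fintype.sum_prod_type, Matrix.neg_apply, Matrix.smul_apply, proj,
    Matrix.diagonal_apply]
  simp only [blockEnd_apply, Fin.sum_univ_two]
  by_cases hac : a = b
  · subst hac
    by_cases hc : c = a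
    · subst hc
      fin_cases c <;> fin_cases i <;> fin_cases j <;>
        simp [genEnd_apply_zero, genEnd_apply_one, blockDet] <;> simp at hs <;> (try rw [hs]) <;> ring
    · simp [hc, Ne.symm hc]
  · simp [hac]

theorem trace_blockEnd (b : Fin 2) : (blockEnd b).trace = 0 := by
  have hs := gen_symm (b, 1) (b, 0)
  have : blockEnd b = proj R b * (genEnd * proj R b) := by rw [blockEnd, mul_assoc]
  rw [this, trace_proj_mul, proj, Matrix.mul_diagonal, Matrix.mul_diagonal, genEnd_apply_zero,
    genEnd_apply_one, hs]
  simp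

theorem blockEnd_mem (b : Fin 2) : blockEnd b ∈ endAlg :=
  mul_mem (mul_mem (proj_mem b) genEnd_mem) (proj_mem b)

theorem proj_mul_blockEnd (b : Fin 2) : proj R b * blockEnd b = blockEnd b := by
  rw [blockEnd, ← mul_assoc, ← mul_assoc, proj_idem]

theorem blockEnd_mul_proj (b : Fin 2) : blockEnd b * proj R b = blockEnd b := by
  rw [blockEnd, mul_assoc, proj_idem]

theorem proj_commute_blockEnd_pow (b : Fin 2) (n : ℕ) :
    proj R b * blockEnd b ^ n = blockEnd b ^ n * proj R b :=
  (show Commute (proj R b) (blockEnd b) by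
    rw [commute_iff_eq, proj_mul_blockEnd, blockEnd_mul_proj]).pow_right n

/-- The span of the words in `genEnd` and the projections that stay in the block `b`. -/
def pureWords (b : Fin 2) : Submodule ℂ (Matrix I I R) :=
  Submodule.span ℂ (Set.range fun n : ℕ => blockEnd b ^ n * proj R b)

/-- The span of the words that start and end in the block `b` and visit the other block. -/
def mixedWords (b : Fin 2) : Submodule ℂ (Matrix I I R) :=
  Submodule.span ℂ {z | ∃ u ∈ endAlg, ∃ v ∈ endAlg,
    proj R b * u * proj R b.rev * v * proj R b = z}

theorem pureWords_le (b : Fin 2) {p : Matrix I I R} (hp : p ∈ pureWords b) :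
    p ∈ endAlg ∧ proj R b * p = p ∧ p * proj R b = p := by
  induction hp using Submodule.span_induction with
  | mem p hp =>
    obtain ⟨n, rfl⟩ := hp
    refine ⟨mul_mem (pow_mem (blockEnd_mem b) n) (proj_mem b), ?_, ?_⟩
    · change proj R b * (blockEnd b ^ n * proj R b) = _
      rw [← mul_assoc, proj_commute_blockEnd_pow, mul_assoc, proj_idem]
    · change blockEnd b ^ n * proj R b * proj R b = _
      rw [mul_assoc, proj_idem]
  | zero => exact ⟨zero_mem _, mul_zero _, zero_mul _⟩
  | add p q _ _ h h' =>
    exact ⟨add_mem h.1 h'.1, by rw [mul_add, h.2.1, h'.2.1], by rw [add_mul, h.2.2, h'.2.2]⟩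
  | smul c p _ h =>
    exact ⟨Subalgebra.smul_mem _ h.1 c, by rw [mul_smul_comm, h.2.1],
      by rw [smul_mul_assoc, h.2.2]⟩

theorem mixedWords_mul_mem (b : Fin 2) {z a : Matrix I I R} (hz : z ∈ mixedWords b)
    (ha : a ∈ endAlg) : z * (a * proj R b) ∈ mixedWords b := by
  induction hz using Submodule.span_induction with
  | mem z hz =>
    obtain ⟨u, hu, v, hv, rfl⟩ := hz
    refine Submodule.subset_span ⟨u, hu, v * proj R b * a, mul_mem (mul_mem hv (proj_mem b)) ha, ?_⟩
    simp only [mul_assoc]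
  | zero => rw [zero_mul]; exact zero_mem _
  | add p q _ _ h h' => rw [add_mul]; exact add_mem h h'
  | smul c p _ h => rw [smul_mul_assoc]; exact Submodule.smul_mem _ c h

theorem mul_mixedWords_mem (b : Fin 2) {z a : Matrix I I R} (hz : z ∈ mixedWords b)
    (ha : a ∈ endAlg) : proj R b * a * z ∈ mixedWords b := by
  induction hz using Submodule.span_induction with
  | mem z hz =>
    obtain ⟨u, hu, v, hv, rfl⟩ := hz
    refine Submodule.subset_span ⟨a * proj R b * u, mul_mem (mul_mem ha (proj_mem b)) hu, v, hv, ?_⟩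
    simp only [mul_assoc]
  | zero => rw [mul_zero]; exact zero_mem _
  | add p q _ _ h h' => rw [mul_add]; exact add_mem h h'
  | smul c p _ h => rw [mul_smul_comm]; exact Submodule.smul_mem _ c h

theorem pureWords_mul_mem (b : Fin 2) {p q : Matrix I I R} (hp : p ∈ pureWords b)
    (hq : q ∈ pureWords b) : p * q ∈ pureWords b := by
  have h : p * q ∈ pureWords b * pureWords b := Submodule.mul_mem_mul hp hq
  rw [pureWords, Submodule.span_mul_span] at h
  refine Submodule.span_le.2 ?_ h
  rintro _ ⟨_, ⟨m, rfl⟩, _, ⟨n, rfl⟩, rfl⟩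
  refine Submodule.subset_span ⟨m + n, ?_⟩
  change blockEnd b ^ (m + n) * proj R b = blockEnd b ^ m * proj R b * (blockEnd b ^ n * proj R b)
  rw [mul_assoc, ← mul_assoc (proj R b), proj_commute_blockEnd_pow, mul_assoc _ (proj R b),
    proj_idem, pow_add, mul_assoc]

theorem proj_mul_mul_proj_mem (b : Fin 2) {M : Matrix I I R} (hM : M ∈ endAlg) :
    proj R b * M * proj R b ∈ pureWords b ⊔ mixedWords b := by
  have hp1 : proj R b ∈ pureWords b :=
    Submodule.subset_span ⟨0, by change blockEnd b ^ 0 * _ = _; rw [pow_zero, one_mul]⟩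
  induction hM using Algebra.adjoin_induction with
  | mem M hM =>
    refine Submodule.mem_sup_left ?_
    rcases hM with rfl | ⟨c, rfl⟩
    · refine Submodule.subset_span ⟨1, ?_⟩
      change blockEnd b ^ 1 * _ = _
      rw [pow_one, blockEnd_mul_proj, blockEnd]
    · rw [proj_mul_proj]
      split_ifs with h
      · rw [proj_idem]; exact hp1
      · rw [zero_mul]; exact zero_mem _
  | algebraMap c =>
    rw [Algebra.algebraMap_eq_smul_one, mul_smul_comm, mul_one, smul_mul_assoc, proj_idem]
    exact Submodule.mem_sup_left (Submodule.smul_mem _ c hp1)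
  | add M M' _ _ h h' => rw [mul_add, add_mul]; exact add_mem h h'
  | mul M M' hM hM' h h' =>
    have e : proj R b * (M * M') * proj R b = (proj R b * M * proj R b) * (proj R b * M' * proj R b)
        + proj R b * M * proj R b.rev * M' * proj R b := by
      have h1 : proj R b * M * proj R b * (proj R b * M' * proj R b)
          = proj R b * M * proj R b * M' * proj R b := by
        rw [mul_assoc (proj R b) M' (proj R b), ← mul_assoc (proj R b * M * proj R b),
          mul_assoc (proj R b * M), proj_idem]
        simp only [mul_assoc]
      rw [h1, ← add_mul, ← add_mul, ← mul_add, proj_add_proj_rev, mul_one]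
      simp only [mul_assoc]
    rw [e]
    refine add_mem ?_ (Submodule.mem_sup_right (Submodule.subset_span ⟨M, hM, M', hM', rfl⟩))
    obtain ⟨p, hp, z, hz, hpz⟩ := Submodule.mem_sup.1 h
    obtain ⟨p', hp', z', hz', hpz'⟩ := Submodule.mem_sup.1 h'
    have h2 : (proj R b * M * proj R b) * (proj R b * M' * proj R b)
        = p * p' + (z * (proj R b * M' * proj R b) + p * z') := by
      rw [← hpz, add_mul, ← hpz', mul_add p]; abel
    rw [h2]
    refine add_mem (Submodule.mem_sup_left (pureWords_mul_mem b hp hp'))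
      (Submodule.mem_sup_right (add_mem ?_ ?_))
    · exact mixedWords_mul_mem b hz (mul_mem (proj_mem b) hM')
    · have := mul_mixedWords_mem b hz' (pureWords_le b hp).1
      rwa [(pureWords_le b hp).2.1] at this

variable {𝒮 : Subalgebra ℂ (Matrix I I R)}

theorem blockDet_pow_smul (b : Fin 2) (k : ℕ) :
    blockEnd b ^ (2 * k) * proj R b = (-blockDet b) ^ k • proj R b := by
  induction k with
  | zero => simp
  | succ k ih =>
    have h : blockEnd b ^ 2 * proj R b = (-blockDet b) • proj R b := by
      rw [pow_two, mul_assoc, blockEnd_mul_proj, blockEnd_sq, neg_smul]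
    rw [mul_add, mul_one, pow_add, mul_assoc, h, mul_smul_comm, ih, smul_smul, ← pow_succ']

theorem trace_mixedWord (b : Fin 2) (u v : Matrix I I R) :
    (proj R b * u * proj R b.rev * v * proj R b).trace
      = (proj R b.rev * (v * proj R b * u)).trace := by
  have h : (proj R b * u * proj R b.rev * v * proj R b)
      = (proj R b * u) * (proj R b.rev * v * proj R b) := by simp only [mul_assoc]
  have h' : (proj R b.rev * v * proj R b) * (proj R b * u) = proj R b.rev * (v * proj R b * u) := by
    rw [mul_assoc (proj R b.rev * v), ← mul_assoc (proj R b) (proj R b), proj_idem]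
    simp only [mul_assoc]
  rw [h, Matrix.trace_mul_comm, h']

/-- For `M` in the algebra generated by the generic endomorphism, the trace of a diagonal block of
`M`, as a scalar matrix, lies in any algebra `𝒮` that contains the generic endomorphism, the
projections and the determinants of the two diagonal blocks. On its own block the trace is handled
by the Cayley-Hamilton identity. On the other block, words that stay in one block are powers of a
traceless `2 × 2` matrix, so their traces are polynomials in its determinant; the trace of any other
word is, by cyclicity, a trace in the other block. -/
theorem trace_smul_one_mem (hA : endAlg ≤ 𝒮) (hd : ∀ b, blockDet b • (1 : Matrix I I R) ∈ 𝒮)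
    (b : Fin 2) {M : Matrix I I R} (hM : M ∈ endAlg) :
    (proj R b * M).trace • (1 : Matrix I I R) ∈ 𝒮 := by
  have hother : (proj R b * M).trace • proj R b.rev ∈ 𝒮 := by
    let W : Submodule ℂ (Matrix I I R) := 𝒮.toSubmodule.comap
      ((LinearMap.toSpanSingleton R (Matrix I I R) (proj R b.rev)).restrictScalars ℂ ∘ₗ
        Matrix.traceLinearMap I ℂ R)
    have hW : ∀ z, z ∈ W ↔ z.trace • proj R b.rev ∈ 𝒮 := fun z => Iff.rfl
    have h1 : (proj R b * M).trace = (proj R b * M * proj R b).trace := by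
      rw [Matrix.trace_mul_comm, Matrix.trace_mul_comm (proj R b * M), ← mul_assoc, proj_idem,
        Matrix.trace_mul_comm]
    rw [h1, ← hW]
    refine (sup_le ?_ ?_ : pureWords b ⊔ mixedWords b ≤ W) (proj_mul_mul_proj_mem b hM)
    · -- powers of the block: even ones are scalar, odd ones are traceless
      refine Submodule.span_le.2 ?_
      rintro _ ⟨n, rfl⟩
      change _ ∈ W
      have hk : ∀ k : ℕ, (-blockDet b) ^ k • (1 : Matrix I I R) ∈ 𝒮 := by
        intro k
        have := pow_mem (neg_mem (hd b)) k
        rwa [← neg_smul, smul_pow, one_pow] at this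
      rw [hW]
      obtain ⟨k, rfl | rfl⟩ := Nat.even_or_odd' n
      · have h2 : (blockEnd b ^ (2 * k) * proj R b).trace = (2 : ℂ) • (-blockDet b) ^ k := by
          rw [blockDet_pow_smul, Matrix.trace_smul, ← mul_one (proj R b), trace_proj_mul]
          simp only [Matrix.one_apply_eq, smul_eq_mul]
          rw [one_add_one_eq_two, mul_comm, Algebra.smul_def, map_ofNat]
        rw [h2, smul_assoc]
        refine Subalgebra.smul_mem _ ?_ _
        have := mul_mem (hk k) (hA (proj_mem b.rev))
        rwa [smul_mul_assoc, one_mul] at this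
      · have h2 : (blockEnd b ^ (2 * k + 1) * proj R b).trace = 0 := by
          rw [pow_succ', mul_assoc, blockDet_pow_smul, mul_smul_comm, blockEnd_mul_proj,
            Matrix.trace_smul, trace_blockEnd, smul_zero]
        rw [h2, zero_smul]; exact zero_mem _
    · -- words through the other block: move the trace there
      refine Submodule.span_le.2 ?_
      rintro _ ⟨u, hu, v, hv, rfl⟩
      change _ ∈ W
      rw [hW, trace_mixedWord]
      exact hA (trace_smul_proj_mem b.rev (mul_mem (mul_mem hv (proj_mem b)) hu))
  have := add_mem (hA (trace_smul_proj_mem b hM)) hother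
  rwa [← smul_add, proj_add_proj_rev] at this

theorem symp_mul_symp_mul (M : Matrix I I R) : M * symp R * symp R = -M := by
  rw [mul_assoc, symp_mul_symp, mul_neg, mul_one]

/-- The elements of `endAlg`, turned back into bilinear forms, are closed under the Omega process.
-/
theorem isFormSystem (hA : endAlg ≤ 𝒮) (hd : ∀ b, blockDet b • (1 : Matrix I I R) ∈ 𝒮) :
    IsFormSystem (𝒮.comap (Algebra.ofId R (Matrix I I R) |>.restrictScalars ℂ))
      ((fun M => M * symp R) '' (endAlg : Set (Matrix I I R)))
      (𝒮.toSubmodule.map (LinearMap.mulRight ℂ (symp R))) where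
  transpose_mem := by
    rintro _ ⟨M, hM, rfl⟩
    refine ⟨-adj M, neg_mem (adj_mem hM), ?_⟩
    change -adj M * symp R = (M * symp R)ᵀ
    rw [adj, neg_neg, symp_mul_symp_mul, Matrix.transpose_mul, symp_transpose, neg_mul]
  mul_mem := by
    rintro b _ ⟨M, hM, rfl⟩ _ ⟨M', hM', rfl⟩
    refine ⟨-(M * proj R b * M'), neg_mem (mul_mem (mul_mem hM (proj_mem b)) hM'), ?_⟩
    change -(M * proj R b * M') * symp R = M * symp R * (proj R b * symp R) * (M' * symp R)
    rw [proj_mul_symp, ← mul_assoc (M * symp R), symp_mul_symp_mul, neg_mul, neg_mul, neg_mul,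
      mul_assoc _ M']
  trace_mem := by
    rintro b _ ⟨M, hM, rfl⟩
    have h := trace_smul_one_mem hA hd b hM
    have e : (M * symp R) (b, 0) (b, 1) - (M * symp R) (b, 1) (b, 0) = (proj R b * M).trace := by
      rw [trace_proj_mul, Matrix.mul_apply, Matrix.mul_apply, Fintype.sum_prod_type,
        Fintype.sum_prod_type]
      simp only [Fin.sum_univ_two]
      fin_cases b <;> simp [symp, eps]
    change algebraMap R (Matrix I I R) _ ∈ 𝒮
    rw [Algebra.algebraMap_eq_smul_one, e]
    exact h
  gen_mem := ⟨genEnd, genEnd_mem, by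
    change genEnd * symp R = gen
    rw [genEnd, neg_mul, symp_mul_symp_mul, neg_neg]⟩
  symp_mem := ⟨1, one_mem _, one_mul _⟩
  le := by
    rintro _ ⟨M, hM, rfl⟩
    exact ⟨M, hA hM, rfl⟩
  smul_mem := by
    rintro r hr _ ⟨M, hM, rfl⟩
    refine ⟨r • M, ?_, ?_⟩
    · have : algebraMap R (Matrix I I R) r * M ∈ 𝒮 := mul_mem hr hM
      rwa [← Algebra.smul_def] at this
    · exact smul_mul_assoc r M (symp R)

/-- The first fundamental theorem for endomorphisms of the spinor space: invariant matrices lie in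
any algebra containing the generic endomorphism, the block projections and the determinants of the
diagonal blocks. -/
theorem mem_of_isInvariant_end (hA : endAlg ≤ 𝒮)
    (hd : ∀ b, blockDet b • (1 : Matrix I I R) ∈ 𝒮) (f : Matrix I I R)
    (he : ∀ b, lieOp (unit b 0 1) f = 0) (hH : ∀ b, lieOp (cartan b) f = 0) :
    symp R * f ∈ 𝒮 := by
  obtain ⟨M, hM, h⟩ := mem_of_isInvariant (isFormSystem hA hd) f he hH
  change M * symp R = _ at h
  have h2 := congrArg (· * symp R) h
  simp only [symp_mul_symp_mul, symp_transpose] at h2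
  rw [← neg_inj] at h2
  rw [neg_neg, neg_neg] at h2
  have : symp R * f = -M := by rw [h2, neg_mul, neg_neg]
  rw [this]; exact neg_mem hM

end TraceClosure

/-! ### From symbols to elements -/

section Symbols

variable {U : Type} [Ring U] [Algebra ℂ U] {x : Sym2 I → U}

theorem IsSymbol.mem_fil {n : ℕ} {M : Matrix I I U} {f : Matrix I I R} (h : IsSymbol x n M f)
    (i j : I) : M i j ∈ fil x (n + 1) := by
  have := add_mem (fil_le_succ x n (h i j).2) (ordered_mem_fil (h i j).1)
  rwa [sub_add_cancel] at this

theorem IsSymbol.add {n : ℕ} {M M' : Matrix I I U} {f f' : Matrix I I R} (h : IsSymbol x n M f)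
    (h' : IsSymbol x n M' f') : IsSymbol x n (M + M') (f + f') := fun i j =>
  ⟨(h i j).1.add (h' i j).1, by
    have := add_mem (h i j).2 (h' i j).2
    rwa [← add_sub_add_comm, ← map_add] at this⟩

theorem IsSymbol.smul {n : ℕ} {M : Matrix I I U} {f : Matrix I I R} (c : ℂ)
    (h : IsSymbol x n M f) : IsSymbol x n (c • M) (c • f) := fun i j =>
  ⟨(homogeneousSubmodule (Sym2 I) ℂ n).smul_mem c (h i j).1, by
    have := Submodule.smul_mem _ c (h i j).2
    rwa [smul_sub, ← map_smul] at this⟩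

theorem isSymbol_zero (n : ℕ) : IsSymbol x n 0 0 := fun _ _ =>
  ⟨isHomogeneous_zero _ _ _, by simp⟩

theorem IsSymbol.mul (hx : IsLieClosed x) {a b : ℕ} {M M' : Matrix I I U} {f f' : Matrix I I R}
    (h : IsSymbol x a M f) (h' : IsSymbol x b M' f') : IsSymbol x (a + b) (M * M') (f * f') := by
  intro i j
  rw [Matrix.mul_apply, Matrix.mul_apply, map_sum, ← Finset.sum_sub_distrib]
  refine ⟨IsHomogeneous.sum _ _ _ fun k _ => (h i k).1.mul (h' k j).1,
    Submodule.sum_mem _ fun k _ => ?_⟩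
  have h1 : (M i k - ordered x (f i k)) * M' k j ∈ fil x (a + b) :=
    mul_mem_fil' (h i k).2 (h'.mem_fil k j)
  have h2 : ordered x (f i k) * (M' k j - ordered x (f' k j)) ∈ fil x (a + b) :=
    mul_mem_fil (ordered_mem_fil (h i k).1) (h' k j).2
  have h3 := ordered_mul hx (h i k).1 (h' k j).1
  have e := sub_mem (add_mem h1 h2) h3
  convert e using 1
  noncomm_ring

theorem isSymbol_const (m : Matrix I I ℂ) : IsSymbol x 0 (m.map (algebraMap ℂ U)) (const m) :=
  fun i j => ⟨isHomogeneous_C _ _, by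
    rw [Matrix.map_apply, const, Matrix.map_apply, algebraMap_eq, ordered_C, sub_self]
    exact zero_mem _⟩

theorem proj_map {B : Type} [Ring B] [Algebra ℂ B] (b : Fin 2) :
    (proj ℂ b).map (algebraMap ℂ B) = proj B b := by
  rw [proj, Matrix.diagonal_map (map_zero _), proj]
  congr 1; ext1 i
  by_cases h : i.1 = b <;> simp [h]

theorem symp_map {B : Type} [Ring B] [Algebra ℂ B] :
    (symp ℂ).map (algebraMap ℂ B) = symp B := by
  ext1 ⟨a, i⟩ ⟨c, j⟩
  fin_cases a <;> fin_cases c <;> fin_cases i <;> fin_cases j <;> simp [symp, eps]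

theorem isSymbol_proj (b : Fin 2) : IsSymbol x 0 (proj U b) (proj R b) := by
  rw [← proj_map, ← proj_map (B := R)]; exact isSymbol_const _

theorem isSymbol_symp : IsSymbol x 0 (symp U) (symp R) := by
  rw [← symp_map, ← symp_map (B := R)]; exact isSymbol_const _

/-- The algebra spanned by the symbols of the elements of `A`. -/
def symbolAlg (hx : IsLieClosed x) (A : Subalgebra ℂ (Matrix I I U)) :
    Subalgebra ℂ (Matrix I I R) :=
  (Submodule.span ℂ {f | ∃ n, ∃ M ∈ A, IsSymbol x n M f}).toSubalgebra
    (Submodule.subset_span ⟨0, 1, one_mem A, by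
      have := isSymbol_const (x := x) 1
      rwa [Matrix.map_one _ (map_zero _) (map_one _), const,
        Matrix.map_one _ (map_zero _) (map_one _)] at this⟩)
    (by
      intro f g hf hg
      have h := Submodule.mul_mem_mul hf hg
      rw [Submodule.span_mul_span] at h
      refine Submodule.span_mono ?_ h
      rintro _ ⟨f, ⟨a, M, hM, hf⟩, g, ⟨b, N, hN, hg⟩, rfl⟩
      exact ⟨a + b, M * N, mul_mem hM hN, hf.mul hx hg⟩)

theorem mem_symbolAlg (hx : IsLieClosed x) {A : Subalgebra ℂ (Matrix I I U)} {n : ℕ}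
    {M : Matrix I I U} (hM : M ∈ A) {f : Matrix I I R} (h : IsSymbol x n M f) :
    f ∈ symbolAlg hx A :=
  Submodule.subset_span ⟨n, M, hM, h⟩

/-- A homogeneous element of the symbol algebra is the symbol of an element of `A`. -/
theorem exists_of_mem_symbolAlg (hx : IsLieClosed x) {A : Subalgebra ℂ (Matrix I I U)} {n : ℕ}
    {f : Matrix I I R} (hf : f ∈ symbolAlg hx A) (hn : ∀ i j, (f i j).IsHomogeneous n) :
    ∃ M ∈ A, IsSymbol x n M f := by
  have key : ∃ M ∈ A, IsSymbol x n M (f.map (homogeneousComponent n)) := by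
    clear hn
    replace hf : f ∈ Submodule.span ℂ {f | ∃ n, ∃ M ∈ A, IsSymbol x n M f} := hf
    induction hf using Submodule.span_induction with
    | mem f hf =>
      obtain ⟨k, M, hM, h⟩ := hf
      by_cases hk : k = n
      · subst hk
        refine ⟨M, hM, ?_⟩
        have : f.map (homogeneousComponent k) = f := by
          ext1 i j
          rw [Matrix.map_apply, homogeneousComponent_of_mem (h i j).1, if_pos rfl]
        rwa [this]
      · refine ⟨0, zero_mem A, ?_⟩
        have : f.map (homogeneousComponent n) = 0 := by
          ext1 i j
          rw [Matrix.map_apply, homogeneousComponent_of_mem (h i j).1, if_neg (Ne.symm hk)]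
          rfl
        rw [this]; exact isSymbol_zero n
    | zero =>
      refine ⟨0, zero_mem A, ?_⟩
      rw [Matrix.map_zero _ (map_zero _)]; exact isSymbol_zero n
    | add f g _ _ h h' =>
      obtain ⟨M, hM, h⟩ := h
      obtain ⟨N, hN, h'⟩ := h'
      refine ⟨M + N, add_mem hM hN, ?_⟩
      rw [Matrix.map_add _ (map_add _)]; exact h.add h'
    | smul c f _ h =>
      obtain ⟨M, hM, h⟩ := h
      refine ⟨c • M, A.smul_mem hM c, ?_⟩
      rw [Matrix.map_smul _ _ (map_smul _ c)]; exact h.smul c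
  have : f.map (homogeneousComponent n) = f := by
    ext1 i j
    rw [Matrix.map_apply, homogeneousComponent_of_mem (hn i j), if_pos rfl]
  rwa [this] at key

theorem lieOpU_sub (y : U) (m : Matrix I I ℂ) (M M' : Matrix I I U) :
    lieOpU y m (M - M') = lieOpU y m M - lieOpU y m M' := by
  ext1 i j
  simp only [lieOpU, Matrix.sub_apply, Matrix.add_apply, Matrix.of_apply, Matrix.mul_sub,
    Matrix.sub_mul]
  noncomm_ring

/-- The invariant matrices over `U` lie in any algebra `A` of invariant matrices that contains the
block projections, the generic endomorphism in `U`, and lifts of the determinants of the diagonal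
blocks. By induction on the filtration: an invariant matrix has an invariant symbol, which is the
symbol of an element of `A`, and the difference is invariant of lower order. -/
theorem mem_of_lieOpU_eq_zero (hx : IsLieClosed x) {e f h : Fin 2 → U}
    (ht : IsSpinorTriple x e f h) (hfil : ∀ u, ∃ n, u ∈ fil x n) (A : Subalgebra ℂ (Matrix I I U))
    (hA : ∀ M ∈ A, ∀ b, lieOpU (e b) (unit b 0 1) (symp U * M) = 0 ∧
      lieOpU (h b) (cartan b) (symp U * M) = 0)
    (hproj : ∀ b, proj U b ∈ A) (hgen : genEnd.map (ordered x) ∈ A)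
    (hdet : ∀ b, ∃ M ∈ A, IsSymbol x 2 M (blockDet b • 1)) {M : Matrix I I U}
    (hM : ∀ b, lieOpU (e b) (unit b 0 1) (symp U * M) = 0 ∧
      lieOpU (h b) (cartan b) (symp U * M) = 0) : M ∈ A := by
  have hgenEnd : ∀ i j, (genEnd i j).IsHomogeneous 1 := by
    rintro i ⟨c, j⟩
    fin_cases j
    · change (genEnd i (c, 0)).IsHomogeneous 1
      rw [genEnd_apply_zero]; exact isHomogeneous_X _ _
    · change (genEnd i (c, 1)).IsHomogeneous 1
      rw [genEnd_apply_one]; exact (isHomogeneous_X _ _).neg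
  have hend : endAlg ≤ symbolAlg hx A := by
    refine Algebra.adjoin_le ?_
    rintro _ (rfl | ⟨b, rfl⟩)
    · exact mem_symbolAlg hx hgen fun i j => ⟨hgenEnd i j, by
        rw [Matrix.map_apply, sub_self]; exact zero_mem _⟩
    · exact mem_symbolAlg hx (hproj b) (isSymbol_proj b)
  have hd : ∀ b, blockDet b • (1 : Matrix I I R) ∈ symbolAlg hx A := by
    intro b
    obtain ⟨N, hN, h⟩ := hdet b
    exact mem_symbolAlg hx hN h
  obtain ⟨n, hn⟩ : ∃ n, ∀ i j, M i j ∈ fil x n := by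
    choose k hk using fun i j => hfil (M i j)
    refine ⟨Finset.univ.sup fun i => Finset.univ.sup fun j => k i j, fun i j => ?_⟩
    exact fil_mono x ((Finset.le_sup (f := fun j => k i j) (Finset.mem_univ j)).trans
      (Finset.le_sup (f := fun i => Finset.univ.sup fun j => k i j) (Finset.mem_univ i))) (hk i j)
  induction n generalizing M with
  | zero =>
    have : M = 0 := Matrix.ext fun i j => (Submodule.mem_bot ℂ).1 (hn i j)
    rw [this]; exact zero_mem A
  | succ n ih =>
    have hsM : ∀ i j, (symp U * M) i j ∈ fil x (n + 1) := by
      intro i j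
      rw [Matrix.mul_apply]
      refine Submodule.sum_mem _ fun k _ => ?_
      rw [← symp_map, Matrix.map_apply, ← Algebra.smul_def]
      exact Submodule.smul_mem _ _ (hn k j)
    obtain ⟨g, hg, hgE, hgH⟩ := exists_isSymbol_killed hx ht hsM (fun b => (hM b).1)
      fun b => (hM b).2
    have h1 : IsSymbol x n (-M) (symp R * g) := by
      have h2 := isSymbol_symp.mul hx hg
      rwa [zero_add, ← mul_assoc, symp_mul_symp, neg_one_mul] at h2
    obtain ⟨N, hN, h2⟩ := exists_of_mem_symbolAlg hx (mem_of_isInvariant_end hend hd g hgE hgH)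
      fun i j => (h1 i j).1
    have h3 : -M - N ∈ A := by
      refine ih (fun b => ?_) fun i j => ?_
      · have h4 := hA N hN b
        have h5 := hM b
        have h0 : ∀ m y, lieOpU (U := U) y m 0 = 0 := by
          intro m y; ext i j; simp [lieOpU]
        have e : symp U * (-M - N) = 0 - symp U * M - symp U * N := by noncomm_ring
        rw [e, lieOpU_sub, lieOpU_sub, lieOpU_sub, lieOpU_sub, h0, h0, h4.1, h4.2, h5.1, h5.2]
        simp
      · have := sub_mem (h1 i j).2 (h2 i j).2
        rwa [sub_sub_sub_cancel_right] at this
    have h4 := neg_mem (add_mem h3 hN)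
    rwa [sub_add_cancel, neg_neg] at h4

end Symbols

end SpinorInvariants

namespace SpinorInvariants
open SOe41

/-! ### Coordinates on the Lie algebra -/

section Coordinates

theorem mem_LieG_iff (X : LieG) (i j : Idx) :
    (X : Matrix Idx Idx ℂ) j i * gam ℂ j j = -(gam ℂ i i * (X : Matrix Idx Idx ℂ) i j) := by
  have h := congrFun (congrFun ((mem_LieG _).1 X.2) i) j
  rw [gam, LieAlgebra.Orthogonal.indefiniteDiagonal, Matrix.mul_diagonal, Matrix.diagonal_mul] at h
  rw [gam, LieAlgebra.Orthogonal.indefiniteDiagonal, Matrix.diagonal_apply_eq,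
    Matrix.diagonal_apply_eq]
  simpa using h

theorem gam_inl (i : Fin 4) : gam ℂ (Sum.inl i) (Sum.inl i) = 1 := by
  simp [gam, LieAlgebra.Orthogonal.indefiniteDiagonal]

theorem gam_inr (i : Fin 1) : gam ℂ (Sum.inr i) (Sum.inr i) = -1 := by
  simp [gam, LieAlgebra.Orthogonal.indefiniteDiagonal]

/-- The coordinates on `𝔭`: `pElt` as a linear isomorphism. -/
def pEquiv : (Fin 4 → ℂ) ≃ₗ[ℂ] LieP where
  toFun := pElt
  map_add' v w := by
    apply Subtype.ext; apply Subtype.ext; ext i j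
    rcases i with i | i <;> rcases j with j | j <;> simp [pElt]
  map_smul' c v := by
    apply Subtype.ext; apply Subtype.ext; ext i j
    rcases i with i | i <;> rcases j with j | j <;> simp [pElt]
  invFun X i := ((X : LieG) : Matrix Idx Idx ℂ) (Sum.inl i) (Sum.inr 0)
  left_inv v := by ext i; simp [pElt]
  right_inv X := by
    have hs : ∀ i j, ((X : LieG) : Matrix Idx Idx ℂ) j i = ((X : LieG) : Matrix Idx Idx ℂ) i j :=
      fun i j => congrFun (congrFun (mem_LieP.1 X.2) i) j
    have ha := mem_LieG_iff (X : LieG)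
    apply Subtype.ext; apply Subtype.ext; ext i j
    have h1 := ha i j
    have h2 := hs i j
    rcases i with i | i <;> rcases j with j | j
    · rw [gam_inl, gam_inl, mul_one, one_mul, h2, self_eq_neg] at h1
      simp [pElt, h1]
    · obtain rfl : j = 0 := Subsingleton.elim _ _
      simp [pElt]
    · obtain rfl : i = 0 := Subsingleton.elim _ _
      simp only [pElt, Matrix.fromBlocks_apply₂₁, Matrix.of_apply]; exact h2
    · rw [gam_inr, gam_inr, h2, mul_neg, mul_one, neg_one_mul, neg_neg, eq_comm, self_eq_neg] at h1
      simp [pElt, h1]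

theorem pEquiv_apply (v : Fin 4 → ℂ) : pEquiv v = pElt v := rfl

/-- `kElt` as a linear map. -/
def kLin : Matrix (Fin 4) (Fin 4) ℂ →ₗ[ℂ] LieK where
  toFun := kElt
  map_add' A A' := by
    apply Subtype.ext; apply Subtype.ext; ext i j
    rcases i with i | i <;> rcases j with j | j <;> simp [kElt]
    ring
  map_smul' c A := by
    apply Subtype.ext; apply Subtype.ext; ext i j
    rcases i with i | i <;> rcases j with j | j <;> simp [kElt]
    ring

theorem kLin_apply (A : Matrix (Fin 4) (Fin 4) ℂ) : kLin A = kElt A := rfl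

theorem exists_kElt_add_pElt (X : LieG) : ∃ A v, X = (kElt A : LieG) + (pElt v : LieG) := by
  refine ⟨(1 / 2 : ℂ) • Matrix.of fun i j => (X : Matrix Idx Idx ℂ) (Sum.inl i) (Sum.inl j),
    fun i => (X : Matrix Idx Idx ℂ) (Sum.inl i) (Sum.inr 0), ?_⟩
  have ha := mem_LieG_iff X
  apply Subtype.ext; ext i j
  have h1 := ha i j
  rcases i with i | i <;> rcases j with j | j
  · rw [gam_inl, gam_inl, mul_one, one_mul] at h1
    simp [kElt, pElt, h1]
    ring
  · obtain rfl : j = 0 := Subsingleton.elim _ _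
    simp [kElt, pElt]
  · obtain rfl : i = 0 := Subsingleton.elim _ _
    rw [gam_inl, gam_inr] at h1
    simp [kElt, pElt]
    rw [mul_one, neg_one_mul, neg_neg] at h1; exact h1.symm
  · obtain rfl : i = 0 := Subsingleton.elim _ _
    obtain rfl : j = 0 := Subsingleton.elim _ _
    rw [gam_inr, mul_neg, mul_one, neg_one_mul, neg_neg, eq_comm, self_eq_neg] at h1
    simp [kElt, pElt, h1]

/-- The action of `𝔨` on `𝔭` in coordinates. -/
theorem lie_kElt_pElt (A : Matrix (Fin 4) (Fin 4) ℂ) (v : Fin 4 → ℂ) :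
    ⁅(kElt A : LieG), (pElt v : LieG)⁆ = (pElt ((A - Aᵀ).mulVec v) : LieG) := by
  apply Subtype.ext
  rw [LieSubalgebra.coe_bracket, LieRing.of_associative_ring_bracket]
  simp only [kElt, pElt, Matrix.fromBlocks_multiply]
  ext i j
  rcases i with i | i <;> rcases j with j | j
  · simp
  · simp [Matrix.mul_apply, Matrix.mulVec, dotProduct]
  · simp [Matrix.mul_apply, Matrix.mulVec, dotProduct, ← Finset.sum_neg_distrib]
    refine Finset.sum_congr rfl fun k _ => by ring
  · simp

/-- The bracket `[𝔭, 𝔭] ⊆ 𝔨` in coordinates. -/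
theorem lie_pElt_pElt (v w : Fin 4 → ℂ) :
    ⁅(pElt v : LieG), (pElt w : LieG)⁆ = (kElt (Matrix.vecMulVec v w) : LieG) := by
  apply Subtype.ext
  rw [LieSubalgebra.coe_bracket, LieRing.of_associative_ring_bracket]
  simp only [kElt, pElt, Matrix.fromBlocks_multiply]
  ext i j
  rcases i with i | i <;> rcases j with j | j
  · simp [Matrix.mul_apply, Matrix.vecMulVec_apply, mul_comm]
  · simp
  · simp
  · simp [Matrix.mul_apply, mul_comm]

end Coordinates

/-! ### The spin representation -/

section CliffordAction

theorem Q_pElt (v : Fin 4 → ℂ) : Q (pElt v) = -(2 * ∑ i, v i * v i) := by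
  change -(B (pElt v) (pElt v)) = _
  rw [B_pElt]

/-- The matrix of Clifford multiplication by `pElt v` on spinors. It exchanges the two blocks. The
basis of spinors is one in which `α` takes the standard `𝔰𝔩₂`-triples of `𝔨` to the matrix units of
the blocks. -/
def spinMat : (Fin 4 → ℂ) →ₗ[ℂ] Matrix I I ℂ where
  toFun v :=
    Matrix.single (0, 0) (1, 0) (v 2 + Complex.I * v 3)
    - Matrix.single (0, 0) (1, 1) (v 0 + Complex.I * v 1)
    - Matrix.single (0, 1) (1, 0) (v 0 - Complex.I * v 1)
    - Matrix.single (0, 1) (1, 1) (v 2 - Complex.I * v 3)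
    - Matrix.single (1, 0) (0, 0) (2 * (v 2 - Complex.I * v 3))
    + Matrix.single (1, 0) (0, 1) (2 * (v 0 + Complex.I * v 1))
    + Matrix.single (1, 1) (0, 0) (2 * (v 0 - Complex.I * v 1))
    + Matrix.single (1, 1) (0, 1) (2 * (v 2 + Complex.I * v 3))
  map_add' v w := by
    ext ⟨a, i⟩ ⟨b, j⟩
    fin_cases a <;> fin_cases b <;> fin_cases i <;> fin_cases j <;> simp <;> ring
  map_smul' c v := by
    ext ⟨a, i⟩ ⟨b, j⟩
    fin_cases a <;> fin_cases b <;> fin_cases i <;> fin_cases j <;> simp <;> ring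

theorem single_mul_single {B : Type} [Ring B] (i j k l : I) (a b : B) :
    Matrix.single i j a * Matrix.single k l b = if j = k then Matrix.single i l (a * b) else 0 := by
  split_ifs with h
  · subst h; exact Matrix.single_mul_single_same _ _ _ _ _
  · exact Matrix.single_mul_single_of_ne _ _ _ _ h _

theorem spinMat_sq (v : Fin 4 → ℂ) :
    spinMat v * spinMat v = algebraMap ℂ _ (-(2 * ∑ i, v i * v i)) := by
  ext1 ⟨a, i⟩ ⟨b, j⟩
  rw [Matrix.mul_apply, Fintype.sum_prod_type, Matrix.algebraMap_matrix_apply, Fin.sum_univ_four]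
  have hI := Complex.I_sq
  fin_cases a <;> fin_cases b <;> fin_cases i <;> fin_cases j <;> simp [spinMat] <;>
    first
    | ring1
    | linear_combination -2 * (v 1 ^ 2 + v 3 ^ 2) * hI
    | linear_combination 2 * (v 1 ^ 2 + v 3 ^ 2) * hI

/-- The spin representation of the Clifford algebra. -/
def spin : Cl →ₐ[ℂ] Matrix I I ℂ :=
  CliffordAlgebra.lift Q ⟨spinMat ∘ₗ pEquiv.symm.toLinearMap, fun X => by
    obtain ⟨v, rfl⟩ := pEquiv.surjective X
    simp only [LinearMap.comp_apply, LinearEquiv.coe_coe, LinearEquiv.symm_apply_apply]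
    rw [spinMat_sq, pEquiv_apply, Q_pElt]⟩

theorem spin_iC (v : Fin 4 → ℂ) : spin (iC (pElt v)) = spinMat v := by
  rw [spin, CliffordAlgebra.lift_ι_apply, LinearMap.comp_apply, ← pEquiv_apply]
  simp

theorem finrank_Cl : Module.finrank ℂ Cl = 16 := by
  have : Invertible (2 : ℂ) := invertibleOfNonzero two_ne_zero
  rw [(CliffordAlgebra.equivExterior Q).finrank_eq,
    Module.finrank_eq_card_basis (Module.Basis.ofEquivFun pEquiv.symm).ExteriorAlgebra]
  simp

instance : FiniteDimensional ℂ Cl := Module.finite_of_finrank_pos (by rw [finrank_Cl]; norm_num)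

end CliffordAction

/-! ### The Clifford algebra as a matrix algebra -/

section SpinEquiv

theorem spin_E3 : spin (iC E3) = Matrix.single (0, 0) (1, 1) (-2) + Matrix.single (1, 0) (0, 1) 4 := by
  rw [E3, spin_iC]
  ext1 ⟨a, i⟩ ⟨b, j⟩
  fin_cases a <;> fin_cases b <;> fin_cases i <;> fin_cases j <;> simp [spinMat] <;> norm_num

theorem spin_F3 : spin (iC F3) = Matrix.single (0, 1) (1, 0) (-2) + Matrix.single (1, 1) (0, 0) 4 := by
  rw [F3, spin_iC]
  ext1 ⟨a, i⟩ ⟨b, j⟩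
  fin_cases a <;> fin_cases b <;> fin_cases i <;> fin_cases j <;> simp [spinMat] <;> norm_num

theorem spin_E4 : spin (iC E4) = Matrix.single (0, 0) (1, 0) 2 + Matrix.single (1, 1) (0, 1) 4 := by
  rw [E4, spin_iC]
  ext1 ⟨a, i⟩ ⟨b, j⟩
  fin_cases a <;> fin_cases b <;> fin_cases i <;> fin_cases j <;> simp [spinMat] <;> norm_num

theorem spin_F4 : spin (iC F4) =
    Matrix.single (0, 1) (1, 1) (-2) + Matrix.single (1, 0) (0, 0) (-4) := by
  rw [F4, spin_iC]
  ext1 ⟨a, i⟩ ⟨b, j⟩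
  fin_cases a <;> fin_cases b <;> fin_cases i <;> fin_cases j <;> simp [spinMat] <;> norm_num

theorem smul_single' (i j : I) (a c : ℂ) : c • Matrix.single i j a = Matrix.single i j (c * a) :=
  Matrix.smul_single c i j a

/-- The spin representation is surjective: a product of four vectors is a multiple of a matrix unit,
from which the others are obtained by multiplication with vectors. -/
theorem spin_surjective : Function.Surjective spin := by
  have h3 : ∀ c : LieP, spin (iC c) ∈ spin.range := fun c => ⟨_, rfl⟩
  have key : ∀ (i j : I) (a : ℂ), a ≠ 0 → Matrix.single i j a ∈ spin.range →
      ∀ c, Matrix.single i j c ∈ spin.range := by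
    intro i j a ha h c
    have := Subalgebra.smul_mem _ h (c / a)
    rwa [smul_single', div_mul_cancel₀ _ ha] at this
  have h00 : ∀ c, Matrix.single (0, 0) (0, 0) c ∈ spin.range := by
    refine key _ _ 64 (by norm_num) ?_
    have h := mul_mem (mul_mem (h3 E3) (h3 F3)) (mul_mem (h3 E4) (h3 F4))
    rw [spin_E3, spin_F3, spin_E4, spin_F4] at h
    simp only [add_mul, mul_add, single_mul_single] at h
    simp at h
    norm_num at h
    exact h
  have hcol : ∀ i c, Matrix.single i (0, 0) c ∈ spin.range := by
    have h1 : ∀ c, Matrix.single (1, 1) (0, 0) c ∈ spin.range := by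
      refine key _ _ 4 (by norm_num) ?_
      have h := mul_mem (h3 F3) (h00 1)
      rw [spin_F3] at h
      simpa [add_mul, single_mul_single] using h
    have h2 : ∀ c, Matrix.single (1, 0) (0, 0) c ∈ spin.range := by
      refine key _ _ (-4) (by norm_num) ?_
      have h := mul_mem (h3 F4) (h00 1)
      rw [spin_F4] at h
      simpa [add_mul, single_mul_single] using h
    have h4 : ∀ c, Matrix.single (0, 1) (0, 0) c ∈ spin.range := by
      refine key _ _ (-2) (by norm_num) ?_
      have h := mul_mem (h3 F3) (h2 1)
      rw [spin_F3] at h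
      simpa [add_mul, single_mul_single] using h
    rintro ⟨a, i⟩
    fin_cases a <;> fin_cases i
    exacts [h00, h4, h2, h1]
  have hrow : ∀ i c, Matrix.single (0, 0) i c ∈ spin.range := by
    have h1 : ∀ c, Matrix.single (0, 0) (1, 1) c ∈ spin.range := by
      refine key _ _ (-2) (by norm_num) ?_
      have h := mul_mem (h00 1) (h3 E3)
      rw [spin_E3] at h
      simpa [mul_add, single_mul_single] using h
    have h2 : ∀ c, Matrix.single (0, 0) (1, 0) c ∈ spin.range := by
      refine key _ _ 2 (by norm_num) ?_
      have h := mul_mem (h00 1) (h3 E4)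
      rw [spin_E4] at h
      simpa [mul_add, single_mul_single] using h
    have h4 : ∀ c, Matrix.single (0, 0) (0, 1) c ∈ spin.range := by
      refine key _ _ 4 (by norm_num) ?_
      have h := mul_mem (h1 1) (h3 E4)
      rw [spin_E4] at h
      simpa [mul_add, single_mul_single] using h
    rintro ⟨a, i⟩
    fin_cases a <;> fin_cases i
    exacts [h00, h4, h2, h1]
  intro M
  rw [Matrix.matrix_eq_sum_single M]
  have : ∑ i, ∑ j, Matrix.single i j (M i j) ∈ spin.range := by
    refine sum_mem fun i _ => sum_mem fun j _ => ?_
    have := mul_mem (hcol i (M i j)) (hrow j 1)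
    rwa [Matrix.single_mul_single_same, mul_one] at this
  exact this

/-- The Clifford algebra is the algebra of endomorphisms of the spinor space: the spin
representation is surjective between spaces of dimension 16. -/
def spinEquiv : Cl ≃ₐ[ℂ] Matrix I I ℂ :=
  AlgEquiv.ofBijective spin ⟨by
    have h : Module.finrank ℂ Cl = Module.finrank ℂ (Matrix I I ℂ) := by
      rw [finrank_Cl, Module.finrank_matrix]; simp
    exact (LinearMap.injective_iff_surjective_of_finrank_eq_finrank (f := spin.toLinearMap) h).2
      spin_surjective, spin_surjective⟩

/-- `U(𝔤) ⊗ C(𝔭)` as an algebra of matrices over `U(𝔤)`. -/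
def toMat : UC ≃ₐ[ℂ] Matrix I I U :=
  (Algebra.TensorProduct.congr AlgEquiv.refl spinEquiv).trans (matrixEquivTensor I ℂ U).symm

theorem toMat_tmul (u : U) (c : Cl) : toMat (u ⊗ₜ c) = u • (spin c).map (algebraMap ℂ U) := rfl

theorem toMat_tmul_apply (u : U) (c : Cl) (i j : I) : toMat (u ⊗ₜ c) i j = spin c i j • u := by
  rw [toMat_tmul, Matrix.smul_apply, Matrix.map_apply, smul_eq_mul, ← Algebra.commutes,
    ← Algebra.smul_def]

/-- The map `α`, written out in the given basis of `𝔭`. -/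
theorem alpha_eq (X : LieK) : alpha X = (-1 / 16 : ℂ) •
    (iC ⟨⁅(X : LieG), (E3 : LieG)⁆, lie_mem_LieP X E3⟩ * iC F3
    + iC ⟨⁅(X : LieG), (E4 : LieG)⁆, lie_mem_LieP X E4⟩ * iC F4
    + iC ⟨⁅(X : LieG), (F3 : LieG)⁆, lie_mem_LieP X F3⟩ * iC E3
    + iC ⟨⁅(X : LieG), (F4 : LieG)⁆, lie_mem_LieP X F4⟩ * iC E4) := by
  rw [alpha, Fin.sum_univ_four]
  simp only [bas, dual, Matrix.cons_val, map_smul, mul_smul_comm, ← smul_add, smul_smul]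
  congr 1
  norm_num

theorem alpha_kElt (A : Matrix (Fin 4) (Fin 4) ℂ) : alpha (kElt A) = (-1 / 16 : ℂ) •
    (iC (pElt ((A - Aᵀ).mulVec ![1, -Complex.I, 0, 0])) * iC F3
    + iC (pElt ((A - Aᵀ).mulVec ![0, 0, 1, -Complex.I])) * iC F4
    + iC (pElt ((A - Aᵀ).mulVec ![1, Complex.I, 0, 0])) * iC E3
    + iC (pElt ((A - Aᵀ).mulVec ![0, 0, 1, Complex.I])) * iC E4) := by
  have h : ∀ (v : Fin 4 → ℂ) (hv), (⟨⁅(kElt A : LieG), (pElt v : LieG)⁆, hv⟩ : LieP)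
      = pElt ((A - Aᵀ).mulVec v) := fun v hv => Subtype.ext (lie_kElt_pElt A v)
  rw [alpha_eq]
  simp only [E3, E4, F3, F4, h]

end SpinEquiv

/-! ### The image of `𝔨` in the spin representation -/

section Images

theorem spin_alpha (A : Matrix (Fin 4) (Fin 4) ℂ) (w1 w2 w3 w4 : Fin 4 → ℂ)
    (h1 : (A - Aᵀ).mulVec ![1, -Complex.I, 0, 0] = w1)
    (h2 : (A - Aᵀ).mulVec ![0, 0, 1, -Complex.I] = w2)
    (h3 : (A - Aᵀ).mulVec ![1, Complex.I, 0, 0] = w3)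
    (h4 : (A - Aᵀ).mulVec ![0, 0, 1, Complex.I] = w4) : spin (alpha (kElt A)) = (-1 / 16 : ℂ) •
    (spinMat w1 * spin (iC F3) + spinMat w2 * spin (iC F4) + spinMat w3 * spin (iC E3)
      + spinMat w4 * spin (iC E4)) := by
  rw [alpha_kElt, map_smul, map_add, map_add, map_add, map_mul, map_mul, map_mul, map_mul,
    spin_iC, spin_iC, spin_iC, spin_iC, h1, h2, h3, h4]

theorem spin_alpha_E1 : spin (alpha E1) = unit 0 0 1 := by
  rw [E1, ← kLin_apply, ← map_smul, kLin_apply,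
    spin_alpha _ 0 0 (-![0, 0, 1, -Complex.I]) ![1, -Complex.I, 0, 0]]
  · rw [spin_E3, spin_E4, spin_F3, spin_F4]
    ext1 ⟨a, i⟩ ⟨b, j⟩
    fin_cases a <;> fin_cases b <;> fin_cases i <;> fin_cases j <;>
      simp [spinMat, add_mul, mul_add] <;> norm_num
  all_goals
    ext i
    fin_cases i <;> simp [Matrix.mulVec, dotProduct, Fin.sum_univ_four, mul_assoc] <;> ring

theorem spin_alpha_F1 : spin (alpha F1) = unit 0 1 0 := by
  rw [F1, ← kLin_apply, ← map_smul, kLin_apply,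
    spin_alpha _ ![0, 0, 1, Complex.I] (-![1, Complex.I, 0, 0]) 0 0]
  · rw [spin_E3, spin_E4, spin_F3, spin_F4]
    ext1 ⟨a, i⟩ ⟨b, j⟩
    fin_cases a <;> fin_cases b <;> fin_cases i <;> fin_cases j <;>
      simp [spinMat, add_mul, mul_add] <;> norm_num
  all_goals
    ext i
    fin_cases i <;> simp [Matrix.mulVec, dotProduct, Fin.sum_univ_four, mul_assoc] <;> ring

theorem spin_alpha_E2 : spin (alpha E2) = unit 1 0 1 := by
  rw [E2, ← kLin_apply, ← map_smul, kLin_apply,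
    spin_alpha _ 0 ![1, -Complex.I, 0, 0] (-![0, 0, 1, Complex.I]) 0]
  · rw [spin_E3, spin_E4, spin_F3, spin_F4]
    ext1 ⟨a, i⟩ ⟨b, j⟩
    fin_cases a <;> fin_cases b <;> fin_cases i <;> fin_cases j <;>
      simp [spinMat, add_mul, mul_add] <;> norm_num
  all_goals
    ext i
    fin_cases i <;> simp [Matrix.mulVec, dotProduct, Fin.sum_univ_four, mul_assoc] <;> ring

theorem spin_alpha_F2 : spin (alpha F2) = unit 1 1 0 := by
  rw [F2, ← kLin_apply, ← map_smul, kLin_apply,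
    spin_alpha _ ![0, 0, 1, -Complex.I] 0 0 (-![1, Complex.I, 0, 0])]
  · rw [spin_E3, spin_E4, spin_F3, spin_F4]
    ext1 ⟨a, i⟩ ⟨b, j⟩
    fin_cases a <;> fin_cases b <;> fin_cases i <;> fin_cases j <;>
      simp [spinMat, add_mul, mul_add] <;> norm_num
  all_goals
    ext i
    fin_cases i <;> simp [Matrix.mulVec, dotProduct, Fin.sum_univ_four, mul_assoc] <;> ring

theorem spin_alpha_H1_add_H2 : spin (alpha (H1 + H2)) = cartan 0 := by
  rw [H1, H2, ← kLin_apply, ← kLin_apply, ← map_add, kLin_apply,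
    spin_alpha _ ![1, -Complex.I, 0, 0] ![0, 0, 1, -Complex.I] (-![1, Complex.I, 0, 0]) (-![0, 0, 1, Complex.I])]
  · rw [spin_E3, spin_E4, spin_F3, spin_F4]
    ext1 ⟨a, i⟩ ⟨b, j⟩
    fin_cases a <;> fin_cases b <;> fin_cases i <;> fin_cases j <;>
      simp [spinMat, cartan, add_mul, mul_add] <;> norm_num
  all_goals
    ext i
    fin_cases i <;> simp [Matrix.mulVec, dotProduct, Fin.sum_univ_four]

theorem spin_alpha_H1_sub_H2 : spin (alpha (H1 - H2)) = cartan 1 := by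
  rw [H1, H2, ← kLin_apply, ← kLin_apply, ← map_sub, kLin_apply,
    spin_alpha _ ![1, -Complex.I, 0, 0] (-![0, 0, 1, -Complex.I]) (-![1, Complex.I, 0, 0]) ![0, 0, 1, Complex.I]]
  · rw [spin_E3, spin_E4, spin_F3, spin_F4]
    ext1 ⟨a, i⟩ ⟨b, j⟩
    fin_cases a <;> fin_cases b <;> fin_cases i <;> fin_cases j <;>
      simp [spinMat, cartan, add_mul, mul_add] <;> norm_num
  all_goals
    ext i
    fin_cases i <;> simp [Matrix.mulVec, dotProduct, Fin.sum_univ_four]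

end Images

/-! ### The volume element -/

section Operators

/-- Antisymmetrization over four letters, written out. -/
theorem sum_perm_four {V : Type*} [AddCommGroup V] [Module ℂ V] (f : (Fin 4 → Fin 4) → V) :
    ∑ s : Equiv.Perm (Fin 4), ((Equiv.Perm.sign s : ℤ) : ℂ) • f s =
    f ![0,1,2,3] - f ![0,1,3,2] - f ![0,2,1,3] + f ![0,2,3,1] + f ![0,3,1,2] - f ![0,3,2,1]
    - (f ![1,0,2,3] - f ![1,0,3,2] - f ![1,2,0,3] + f ![1,2,3,0] + f ![1,3,0,2] - f ![1,3,2,0])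
    + (f ![2,0,1,3] - f ![2,0,3,1] - f ![2,1,0,3] + f ![2,1,3,0] + f ![2,3,0,1] - f ![2,3,1,0])
    - (f ![3,0,1,2] - f ![3,0,2,1] - f ![3,1,0,2] + f ![3,1,2,0] + f ![3,2,0,1] - f ![3,2,1,0]) := by
  have : (Finset.univ.val.map fun s : Equiv.Perm (Fin 4) => ((Equiv.Perm.sign s : ℤ), (s : Fin 4 → Fin 4)))
    = {(1,![0,1,2,3]), (-1,![0,1,3,2]), (-1, ![0,2,1,3]), (1, ![0,2,3,1]), (1, ![0,3,1,2]), (-1, ![0,3,2,1]),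
      (-1, ![1,0,2,3]), (1, ![1,0,3,2]), (1, ![1,2,0,3]), (-1, ![1,2,3,0]), (-1, ![1,3,0,2]), (1, ![1,3,2,0]),
      (1, ![2,0,1,3]), (-1, ![2,0,3,1]), (-1, ![2,1,0,3]), (1, ![2,1,3,0]), (1, ![2,3,0,1]), (-1, ![2,3,1,0]),
      (-1, ![3,0,1,2]), (1, ![3,0,2,1]), (1, ![3,1,0,2]), (-1, ![3,1,2,0]), (-1, ![3,2,0,1]), (1, ![3,2,1,0])} := by
    decide
  have h2 := congrArg (fun m => (m.map fun p : ℤ × (Fin 4 → Fin 4) => (p.1 : ℂ) • f p.2).sum) this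
  simp only [Multiset.map_map, Function.comp_def] at h2
  rw [Finset.sum_eq_multiset_sum, h2]
  simp
  abel

/-- The volume element acts by opposite scalars on the two half spinor spaces. -/
theorem spin_tau : spin (tau ![E3, E4, F3, F4]) = (16 : ℂ) • (proj ℂ 1 - proj ℂ 0) := by
  rw [tau, sum_perm_four fun g : Fin 4 → Fin 4 =>
    (List.ofFn fun i => iC (![E3, E4, F3, F4] (g i))).prod]
  simp only [List.ofFn_succ, List.ofFn_zero, List.prod_cons, List.prod_nil, mul_one,
    Matrix.cons_val_zero, Matrix.cons_val_succ, Matrix.cons_val]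
  simp only [map_smul, map_add, map_sub, map_mul, spin_E3, spin_E4, spin_F3, spin_F4]
  simp only [add_mul, mul_add, single_mul_single]
  simp
  ext1 ⟨a, i⟩ ⟨b, j⟩
  fin_cases a <;> fin_cases b <;> fin_cases i <;> fin_cases j <;> simp [proj] <;> norm_num

end Operators

/-! ### Contractions and basis-free formulas -/

section Contraction

/-- The standard basis vectors. -/
abbrev std (i : Fin 4) : Fin 4 → ℂ := Pi.single i 1

theorem sum_std (v : Fin 4 → ℂ) : ∑ i, v i • std i = v := by
  ext j; simp [Finset.sum_apply, Pi.single_apply]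

/-- The contraction of a bilinear map along the standard form is invariant under orthogonal
matrices. -/
theorem sum_mulVec_std {V : Type*} [AddCommGroup V] [Module ℂ V]
    (g : (Fin 4 → ℂ) →ₗ[ℂ] (Fin 4 → ℂ) →ₗ[ℂ] V) {m : Matrix (Fin 4) (Fin 4) ℂ}
    (hm : m * mᵀ = 1) :
    ∑ i, g (m.mulVec (std i)) (m.mulVec (std i)) = ∑ i, g (std i) (std i) := by
  have h : ∀ i, m.mulVec (std i) = ∑ a, m a i • std a := by
    intro i
    rw [sum_std (fun a => m a i)]
    ext a; simp
  have h2 : ∀ a b, ∑ i, m a i * m b i = if a = b then 1 else 0 := by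
    intro a b
    have := congrFun (congrFun hm a) b
    rwa [Matrix.mul_apply, Matrix.one_apply] at this
  simp only [h, map_sum, map_smul, LinearMap.sum_apply, LinearMap.smul_apply]
  rw [Finset.sum_comm]
  calc ∑ b, ∑ i, m b i • ∑ a, m a i • g (std a) (std b)
      = ∑ b, ∑ a, (∑ i, m b i * m a i) • g (std a) (std b) := by
        refine Finset.sum_congr rfl fun b _ => ?_
        simp only [Finset.smul_sum, smul_smul, Finset.sum_smul]
        rw [Finset.sum_comm]
    _ = _ := by simp [h2, ite_smul]

/-- Contraction along the given dual bases of `𝔭` is contraction along the orthogonal basis `pElt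
eᵢ`, on which the trace form takes the value two. -/
theorem sum_bas_dual {V : Type*} [AddCommGroup V] [Module ℂ V]
    (g : (Fin 4 → ℂ) →ₗ[ℂ] (Fin 4 → ℂ) →ₗ[ℂ] V) :
    ∑ i, g (pEquiv.symm (bas i)) (pEquiv.symm (dual i)) = (1 / 2 : ℂ) • ∑ i, g (std i) (std i) := by
  have h : ∀ v : Fin 4 → ℂ, v = v 0 • std 0 + v 1 • std 1 + v 2 • std 2 + v 3 • std 3 := by
    intro v; rw [← Fin.sum_univ_four (fun i => v i • std i), sum_std]
  have e3 : pEquiv.symm E3 = std 0 - Complex.I • std 1 := by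
    rw [LinearEquiv.symm_apply_eq, pEquiv_apply, E3]
    congr 1; ext i; fin_cases i <;> simp
  have f3 : pEquiv.symm F3 = std 0 + Complex.I • std 1 := by
    rw [LinearEquiv.symm_apply_eq, pEquiv_apply, F3]
    congr 1; ext i; fin_cases i <;> simp
  have e4 : pEquiv.symm E4 = std 2 - Complex.I • std 3 := by
    rw [LinearEquiv.symm_apply_eq, pEquiv_apply, E4]
    congr 1; ext i; fin_cases i <;> simp
  have f4 : pEquiv.symm F4 = std 2 + Complex.I • std 3 := by
    rw [LinearEquiv.symm_apply_eq, pEquiv_apply, F4]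
    congr 1; ext i; fin_cases i <;> simp
  rw [Fin.sum_univ_four, Fin.sum_univ_four]
  simp only [bas, dual, Matrix.cons_val, map_smul, e3, e4, f3, f4, map_add, map_sub,
    LinearMap.add_apply, LinearMap.sub_apply, LinearMap.smul_apply]
  match_scalars <;> (try ring_nf) <;> simp only [Complex.I_sq] <;> norm_num

/-- Clifford multiplication in coordinates. -/
def cLin : (Fin 4 → ℂ) →ₗ[ℂ] Cl := iC ∘ₗ pEquiv.toLinearMap

theorem cLin_apply (v : Fin 4 → ℂ) : cLin v = iC (pElt v) := rfl

/-- The inclusion of `𝔭` in `U(𝔤)`, in coordinates. -/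
def pU : (Fin 4 → ℂ) →ₗ[ℂ] U := (iU : LieG →ₗ[ℂ] U) ∘ₗ LieP.subtype ∘ₗ pEquiv.toLinearMap

theorem pU_apply (v : Fin 4 → ℂ) : pU v = iU (pElt v : LieG) := rfl

theorem cLin_mul_add (v w : Fin 4 → ℂ) :
    cLin v * cLin w + cLin w * cLin v = algebraMap ℂ Cl (-4 * ∑ i, v i * w i) := by
  have h : ∀ v : Fin 4 → ℂ, cLin v * cLin v = algebraMap ℂ Cl (-(2 * ∑ i, v i * v i)) := by
    intro v
    rw [cLin_apply, iC, CliffordAlgebra.ι_sq_scalar, Q_pElt]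
  have h1 := h (v + w)
  rw [map_add, mul_add, add_mul, add_mul, h v, h w] at h1
  have h2 : algebraMap ℂ Cl (-4 * ∑ i, v i * w i)
      = algebraMap ℂ Cl (-(2 * ∑ i, (v + w) i * (v + w) i))
        - algebraMap ℂ Cl (-(2 * ∑ i, v i * v i)) - algebraMap ℂ Cl (-(2 * ∑ i, w i * w i)) := by
    rw [← map_sub, ← map_sub]
    congr 1
    simp only [Fin.sum_univ_four, Pi.add_apply]
    ring
  rw [h2, ← h1]
  abel

/-- The Dirac operator in an orthogonal basis. -/
theorem D_eq : D = (1 / 2 : ℂ) • ∑ i, pU (std i) ⊗ₜ[ℂ] cLin (std i) := by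
  have h := sum_bas_dual ((TensorProduct.mk ℂ U Cl).compl₁₂ pU cLin)
  simp only [LinearMap.compl₁₂_apply, TensorProduct.mk_apply] at h
  rw [← h, D]
  refine Finset.sum_congr rfl fun i _ => ?_
  rw [pU_apply, cLin_apply, ← pEquiv_apply, ← pEquiv_apply, LinearEquiv.apply_symm_apply,
    LinearEquiv.apply_symm_apply]

theorem alpha_kElt_eq (A : Matrix (Fin 4) (Fin 4) ℂ) : alpha (kElt A) =
    (-1 / 8 : ℂ) • ∑ i, cLin ((A - Aᵀ).mulVec (std i)) * cLin (std i) := by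
  have h := sum_bas_dual ((LinearMap.mul ℂ Cl).compl₁₂ (cLin ∘ₗ (A - Aᵀ).mulVecLin) cLin)
  simp only [LinearMap.compl₁₂_apply, LinearMap.mul_apply', LinearMap.comp_apply,
    Matrix.mulVecLin_apply] at h
  have h2 : (-1 / 8 : ℂ) = (-1 / 4) * (1 / 2) := by norm_num
  rw [h2, ← smul_smul, ← h, alpha]
  congr 1
  refine Finset.sum_congr rfl fun i _ => ?_
  obtain ⟨v, hv⟩ := pEquiv.surjective (bas i)
  have h3 : (⟨⁅(kElt A : LieG), (bas i : LieG)⁆, lie_mem_LieP (kElt A) (bas i)⟩ : LieP)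
      = pElt ((A - Aᵀ).mulVec (pEquiv.symm (bas i))) := by
    apply Subtype.ext
    rw [← lie_kElt_pElt, ← pEquiv_apply, LinearEquiv.apply_symm_apply]
  rw [h3, cLin_apply, cLin_apply, ← pEquiv_apply (pEquiv.symm (dual i)),
    LinearEquiv.apply_symm_apply]

/-- The defining property of `α`: the commutator with `α(X)` is the action of `X` on `𝔭`. -/
theorem alpha_lie (A : Matrix (Fin 4) (Fin 4) ℂ) (v : Fin 4 → ℂ) :
    alpha (kElt A) * cLin v - cLin v * alpha (kElt A) = cLin ((A - Aᵀ).mulVec v) := by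
  have key : ∀ a b : Fin 4 → ℂ, cLin a * cLin b * cLin v - cLin v * (cLin a * cLin b)
      = (-4 * ∑ i, b i * v i) • cLin a + (4 * ∑ i, a i * v i) • cLin b := by
    intro a b
    have h1 := cLin_mul_add b v
    have h2 := cLin_mul_add a v
    have e : cLin a * cLin b * cLin v - cLin v * (cLin a * cLin b)
        = cLin a * (cLin b * cLin v + cLin v * cLin b)
          - (cLin a * cLin v + cLin v * cLin a) * cLin b := by noncomm_ring
    rw [e, h1, h2, ← Algebra.commutes, ← Algebra.smul_def, ← Algebra.smul_def, sub_eq_add_neg,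
      ← neg_smul]
    congr 2
    ring
  rw [alpha_kElt_eq, smul_mul_assoc, mul_smul_comm, ← smul_sub, Finset.sum_mul, Finset.mul_sum,
    ← Finset.sum_sub_distrib]
  simp only [key]
  simp only [← map_smul, ← map_add, ← map_sum]
  congr 1
  ext j
  simp [Matrix.mulVec, dotProduct, Fin.sum_univ_four, Pi.single_apply]
  fin_cases j <;> simp <;> ring

/-- `alpha` as a linear map. -/
def alphaLin : LieK →ₗ[ℂ] Cl where
  toFun := alpha
  map_add' := fun X Y => by
    have h : ∀ b : LieP, iC ⟨⁅((X + Y : LieK) : LieG), (b : LieG)⁆, lie_mem_LieP (X + Y) b⟩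
        = iC ⟨⁅(X : LieG), (b : LieG)⁆, lie_mem_LieP X b⟩
          + iC ⟨⁅(Y : LieG), (b : LieG)⁆, lie_mem_LieP Y b⟩ := by
      intro b
      rw [← map_add]
      congr 1
      exact Subtype.ext (add_lie (X : LieG) (Y : LieG) (b : LieG))
    simp only [alpha, h, add_mul, Finset.sum_add_distrib, smul_add]
  map_smul' := fun c X => by
    have h : ∀ b : LieP, iC ⟨⁅((c • X : LieK) : LieG), (b : LieG)⁆, lie_mem_LieP (c • X) b⟩
        = c • iC ⟨⁅(X : LieG), (b : LieG)⁆, lie_mem_LieP X b⟩ := by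
      intro b
      rw [← map_smul]
      congr 1
      exact Subtype.ext (smul_lie c (X : LieG) (b : LieG))
    simp only [alpha, h, smul_mul_assoc, ← Finset.smul_sum, RingHom.id_apply]
    rw [smul_comm]

/-- `kTerm` as a bilinear map. -/
def kT : LieK →ₗ[ℂ] LieK →ₗ[ℂ] UC :=
  (TensorProduct.mk ℂ U Cl).compl₁₂ ((iU : LieG →ₗ[ℂ] U) ∘ₗ LieK.subtype) alphaLin

theorem kT_apply (X Y : LieK) : kT X Y = kTerm X Y := rfl

/-- The elements `kElt (v wᵀ)` of `𝔨`, bilinear in `v` and `w`. -/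
def kVec : (Fin 4 → ℂ) →ₗ[ℂ] (Fin 4 → ℂ) →ₗ[ℂ] LieK :=
  LinearMap.mk₂ ℂ (fun v w => kLin (Matrix.vecMulVec v w))
    (by intro v v' w; rw [Matrix.add_vecMulVec, map_add])
    (by intro c v w; rw [Matrix.smul_vecMulVec, map_smul])
    (by intro v w w'; rw [Matrix.vecMulVec_add, map_add])
    (by intro c v w; rw [Matrix.vecMulVec_smul, map_smul])

theorem kVec_apply (v w : Fin 4 → ℂ) : kVec v w = kElt (Matrix.vecMulVec v w) := rfl

theorem kVec_std (i j : Fin 4) : kVec (std i) (std j) = kLin (e i j 1) := by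
  rw [kVec_apply, ← kLin_apply]
  congr 1
  ext a b
  simp [Matrix.vecMulVec_apply, Pi.single_apply, Matrix.single_apply, ← ite_and, eq_comm, and_comm]

theorem kLin_single_swap (i j : Fin 4) : kLin (e i j 1) = -kLin (e j i 1) := by
  rw [kLin_apply, kLin_apply]
  apply Subtype.ext; apply Subtype.ext
  ext a b
  rcases a with a | a <;> rcases b with b | b <;> simp [kElt]

theorem kLin_e (i j : Fin 4) (c : ℂ) : kLin (e i j c) = c • kLin (e i j 1) := by
  rw [← map_smul, Matrix.smul_single, smul_eq_mul, mul_one]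

theorem kLin_single_diag (i : Fin 4) : kLin (e i i 1) = 0 := by
  rw [kLin_apply]
  apply Subtype.ext; apply Subtype.ext
  ext a b
  rcases a with a | a <;> rcases b with b | b <;> simp [kElt]

/-- The `𝔨`-Dirac operator as a double contraction over the standard basis of `ℂ⁴`. -/
theorem Dk_eq : Dk = -∑ i, ∑ j, kT (kVec (std i) (std j)) (kVec (std i) (std j)) := by
  simp only [kVec_std, Fin.sum_univ_four, kLin_single_diag, kLin_single_swap 1 0, kLin_single_swap 2 0,
    kLin_single_swap 3 0, kLin_single_swap 2 1, kLin_single_swap 3 1, kLin_single_swap 3 2]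
  simp only [Dk, ← kT_apply, E1, E2, F1, F2, H1, H2, ← kLin_apply, map_add, map_sub, kLin_e _ _ Complex.I,
    map_smul, map_neg, LinearMap.add_apply, LinearMap.sub_apply, LinearMap.smul_apply,
    LinearMap.neg_apply, map_zero]
  match_scalars <;> (try ring_nf) <;> (try simp only [Complex.I_sq]) <;> norm_num

end Contraction

/-! ### Invariance of the Dirac operators and of the volume element -/

section Invariance

theorem toC_gam (k : K) : gam ℂ * toC k = toC k * gam ℂ := by
  calc gam ℂ * toC k = (toC k * (toC k)ᵀ) * gam ℂ * toC k := by rw [toC_mul_transpose, one_mul]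
    _ = toC k * ((toC k)ᵀ * gam ℂ * toC k) := by noncomm_ring
    _ = _ := by rw [toC_preserves]

theorem toC_gam_apply (k : K) (i j : Idx) :
    gam ℂ i i * toC k i j = toC k i j * gam ℂ j j := by
  have h := congrFun (congrFun (toC_gam k) i) j
  rw [gam, LieAlgebra.Orthogonal.indefiniteDiagonal, Matrix.mul_diagonal, Matrix.diagonal_mul] at h
  rw [gam, LieAlgebra.Orthogonal.indefiniteDiagonal, Matrix.diagonal_apply_eq,
    Matrix.diagonal_apply_eq]
  exact h

/-- The component of `k ∈ K` in `SO(4)`. -/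
def k4 (k : K) : Matrix (Fin 4) (Fin 4) ℂ := (toC k).toBlocks₁₁

theorem toC_eq (k : K) : toC k = Matrix.fromBlocks (k4 k) 0 0 1 := by
  have h12 : ∀ i j, toC k (Sum.inl i) (Sum.inr j) = 0 := by
    intro i j
    have := toC_gam_apply k (Sum.inl i) (Sum.inr j)
    rw [gam_inl, gam_inr, one_mul, mul_neg, mul_one, self_eq_neg] at this
    exact this
  have h21 : ∀ i j, toC k (Sum.inr i) (Sum.inl j) = 0 := by
    intro i j
    have := toC_gam_apply k (Sum.inr i) (Sum.inl j)
    rw [gam_inl, gam_inr, mul_one, neg_one_mul, eq_comm, self_eq_neg] at this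
    exact this
  have h22 : toC k (Sum.inr 0) (Sum.inr 0) = 1 := by
    have h := congrFun (congrFun k.2.2 (Sum.inr 0)) (Sum.inr 0)
    have h0 : ∀ i : Fin 4, (k : Matrix Idx Idx ℝ) (Sum.inl i) (Sum.inr 0) = 0 := fun i =>
      Complex.ofReal_eq_zero.1 (h12 i 0)
    have hpos := k.2.1.2.2
    rw [Matrix.mul_apply, Fintype.sum_sum_type] at h
    simp only [Matrix.transpose_apply, h0, mul_zero, Finset.sum_const_zero, zero_add,
      Fin.sum_univ_one, Matrix.one_apply_eq] at h
    have h1 : (k : Matrix Idx Idx ℝ) (Sum.inr 0) (Sum.inr 0) = 1 := by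
      rcases mul_self_eq_one_iff.1 h with h | h
      · exact h
      · rw [h] at hpos; norm_num at hpos
    simp [h1]
  ext i j
  rcases i with i | i <;> rcases j with j | j
  · simp [k4, Matrix.toBlocks₁₁]
  · rw [h12]; simp
  · rw [h21]; simp
  · obtain rfl : i = 0 := Subsingleton.elim _ _
    obtain rfl : j = 0 := Subsingleton.elim _ _
    rw [h22]; simp

theorem k4_mul_transpose (k : K) : k4 k * (k4 k)ᵀ = 1 := by
  have h := toC_mul_transpose k
  rw [toC_eq, Matrix.fromBlocks_transpose, Matrix.fromBlocks_multiply, ← Matrix.fromBlocks_one] at h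
  have := (Matrix.fromBlocks_inj.1 h).1
  simpa using this

theorem det_k4 (k : K) : (k4 k).det = 1 := by
  have h : (toC k).det = 1 := by
    have h1 : (toC k).det = Complex.ofRealHom (k : Matrix Idx Idx ℝ).det :=
      (RingHom.map_det Complex.ofRealHom _).symm
    rw [h1, k.2.1.2.1, map_one]
  rwa [toC_eq, Matrix.det_fromBlocks_zero₂₁, Matrix.det_one, mul_one] at h

theorem Ad_pElt (k : K) (v : Fin 4 → ℂ) : Ad k (pElt v) = (pElt ((k4 k).mulVec v) : LieG) := by
  apply Subtype.ext
  rw [Ad_coe, toC_eq, Matrix.fromBlocks_transpose]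
  simp only [pElt, Matrix.fromBlocks_multiply]
  ext i j
  rcases i with i | i <;> rcases j with j | j <;>
    simp [Matrix.mul_apply, Matrix.mulVec, dotProduct, mul_comm]

theorem Ad_kElt (k : K) (A : Matrix (Fin 4) (Fin 4) ℂ) :
    Ad k (kElt A) = (kElt (k4 k * A * (k4 k)ᵀ) : LieG) := by
  apply Subtype.ext
  rw [Ad_coe, toC_eq, Matrix.fromBlocks_transpose]
  simp only [kElt, Matrix.fromBlocks_multiply]
  simp [mul_sub, sub_mul, mul_assoc]

theorem actU_iU (k : K) (X : LieG) : actU k (iU X) = iU (Ad k X) :=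
  UniversalEnvelopingAlgebra.lift_ι_apply ℂ _ X

theorem actU_pU (k : K) (v : Fin 4 → ℂ) : actU k (pU v) = pU ((k4 k).mulVec v) := by
  rw [pU_apply, actU_iU, Ad_pElt, pU_apply]

theorem actCl_cLin (k : K) (v : Fin 4 → ℂ) : actCl k (cLin v) = cLin ((k4 k).mulVec v) := by
  rw [cLin_apply, actCl, CliffordAlgebra.map_apply_ι, cLin_apply]
  congr 1
  exact Subtype.ext (Ad_pElt k v)

theorem act_tmul (k : K) (u : U) (c : Cl) : SOe41.act k (u ⊗ₜ c) = actU k u ⊗ₜ actCl k c :=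
  Algebra.TensorProduct.map_tmul _ _ _ _

/-- The Dirac operator is a contraction along an invariant form. -/
theorem act_D (k : K) : SOe41.act k D = D := by
  have h := sum_mulVec_std ((TensorProduct.mk ℂ U Cl).compl₁₂ pU cLin) (k4_mul_transpose k)
  simp only [LinearMap.compl₁₂_apply, TensorProduct.mk_apply] at h
  rw [D_eq, map_smul, map_sum, ← h]
  simp only [act_tmul, actU_pU, actCl_cLin]

theorem actCl_alpha (k : K) (A : Matrix (Fin 4) (Fin 4) ℂ) :
    actCl k (alpha (kElt A)) = alpha (kElt (k4 k * A * (k4 k)ᵀ)) := by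
  rw [alpha_kElt_eq, alpha_kElt_eq, map_smul, map_sum]
  have h := sum_mulVec_std ((LinearMap.mul ℂ Cl).compl₁₂ (cLin ∘ₗ
    (k4 k * A * (k4 k)ᵀ - (k4 k * A * (k4 k)ᵀ)ᵀ).mulVecLin) cLin) (k4_mul_transpose k)
  simp only [LinearMap.compl₁₂_apply, LinearMap.mul_apply', LinearMap.comp_apply,
    Matrix.mulVecLin_apply] at h
  rw [← h]
  congr 1
  refine Finset.sum_congr rfl fun i _ => ?_
  rw [map_mul, actCl_cLin, actCl_cLin, Matrix.mulVec_mulVec, Matrix.mulVec_mulVec]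
  have h1 := mul_eq_one_comm.1 (k4_mul_transpose k)
  have h2 : (k4 k * A * (k4 k)ᵀ - (k4 k * A * (k4 k)ᵀ)ᵀ) * k4 k = k4 k * (A - Aᵀ) := by
    rw [Matrix.transpose_mul, Matrix.transpose_mul, Matrix.transpose_transpose, ← mul_assoc,
      sub_mul, mul_assoc _ _ (k4 k), h1, mul_assoc _ _ (k4 k), h1, mul_one, mul_one, mul_sub]
  rw [h2]

theorem act_kT (k : K) (v w v' w' : Fin 4 → ℂ) : SOe41.act k (kT (kVec v w) (kVec v' w')) =
    kT (kVec ((k4 k).mulVec v) ((k4 k).mulVec w)) (kVec ((k4 k).mulVec v') ((k4 k).mulVec w')) := by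
  have h : ∀ v w, k4 k * Matrix.vecMulVec v w * (k4 k)ᵀ
      = Matrix.vecMulVec ((k4 k).mulVec v) ((k4 k).mulVec w) := by
    intro v w
    rw [Matrix.mul_vecMulVec, Matrix.vecMulVec_mul, Matrix.vecMul_transpose]
  simp only [kT_apply, kTerm, act_tmul, kVec_apply, actU_iU, Ad_kElt, actCl_alpha, h]

theorem act_Dk (k : K) : SOe41.act k Dk = Dk := by
  have hk := k4_mul_transpose k
  rw [Dk_eq, map_neg, map_sum]
  simp only [map_sum, act_kT]
  have h1 : ∀ v, ∑ j, kT (kVec v ((k4 k).mulVec (std j))) (kVec v ((k4 k).mulVec (std j)))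
      = ∑ j, kT (kVec v (std j)) (kVec v (std j)) := fun v =>
    sum_mulVec_std (kT.compl₁₂ (kVec v) (kVec v)) hk
  simp only [h1]
  rw [Finset.sum_comm, Finset.sum_comm (f := fun i j => kT (kVec (std i) (std j)) (kVec (std i) (std j)))]
  congr 1
  refine Finset.sum_congr rfl fun j _ => ?_
  exact sum_mulVec_std (kT.compl₁₂ (kVec.flip (std j)) (kVec.flip (std j))) hk

/-- An alternating map on `ℂ⁴` transforms by the determinant. -/
theorem alternating_mulVec {V : Type*} [AddCommGroup V] [Module ℂ V]
    (f : (Fin 4 → ℂ) [⋀^Fin 4]→ₗ[ℂ] V) (m : Matrix (Fin 4) (Fin 4) ℂ) (v : Fin 4 → Fin 4 → ℂ) :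
    f (fun i => m.mulVec (v i)) = m.det • f v := by
  let b := Pi.basisFun ℂ (Fin 4)
  have hf : f = b.det.smulRight (f b) := by
    refine b.ext_alternating fun c hc => ?_
    let s : Equiv.Perm (Fin 4) := Equiv.ofBijective c (Finite.injective_iff_bijective.1 hc)
    have h1 := f.map_perm b s
    have h2 := b.det.map_perm b s
    change f (b ∘ s) = b.det (b ∘ s) • f b
    rw [h1, h2, b.det_self]
    simp
  have hd := b.det_comp m.mulVecLin v
  rw [hf, AlternatingMap.smulRight_apply, AlternatingMap.smulRight_apply, smul_smul,
    ← LinearMap.det_toLin', Matrix.toLin'_apply']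
  exact congrArg (· • f b) hd

theorem actCl_tau (k : K) (v : Fin 4 → Fin 4 → ℂ) :
    actCl k (tau fun i => pElt (v i)) = tau fun i => pElt (v i) := by
  let f : (Fin 4 → ℂ) [⋀^Fin 4]→ₗ[ℂ] Cl := MultilinearMap.alternatization
    ((MultilinearMap.mkPiAlgebraFin ℂ 4 Cl).compLinearMap fun _ => cLin)
  have hf : ∀ v : Fin 4 → Fin 4 → ℂ, tau (fun i => pElt (v i)) = (1 / 24 : ℂ) • f v := by
    intro v
    simp only [f, tau, MultilinearMap.alternatization_apply, Int.cast_smul_eq_zsmul]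
    rfl
  have hm : actCl k (tau fun i => pElt (v i)) = tau fun i => pElt ((k4 k).mulVec (v i)) := by
    simp only [tau, map_smul, map_sum, map_list_prod, List.map_ofFn, Function.comp_def,
      ← cLin_apply, actCl_cLin]
  rw [hm, hf, hf, alternating_mulVec, det_k4, one_smul]

/-- The volume element is alternating in its four arguments, and `K` acts on `𝔭` with determinant
one. -/
theorem act_rhoI (k : K) : SOe41.act k rhoI = rhoI := by
  let v : Fin 4 → Fin 4 → ℂ := ![![1, -Complex.I, 0, 0], ![0, 0, 1, -Complex.I],
    ![1, Complex.I, 0, 0], ![0, 0, 1, Complex.I]]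
  have h := actCl_tau k v
  have e : (fun i => pElt (v i)) = ![E3, E4, F3, F4] := by
    ext1 i; fin_cases i <;> rfl
  rw [e] at h
  rw [rhoI, act_tmul, map_one, h]

end Invariance

/-! ### Plane rotations -/

section Rotations

/-- The rotation by `t` in the plane spanned by the coordinates `p` and `q`. -/
def rotMat (p q : Fin 4) (t : ℝ) : Matrix (Fin 4) (Fin 4) ℝ :=
  1 + (Real.cos t - 1) • (Matrix.single p p 1 + Matrix.single q q 1)
    + Real.sin t • (Matrix.single p q 1 - Matrix.single q p 1)

theorem rotMat_mul {p q : Fin 4} (h : p ≠ q) (s t : ℝ) :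
    rotMat p q s * rotMat p q t = rotMat p q (s + t) := by
  set P : Matrix (Fin 4) (Fin 4) ℝ := Matrix.single p p 1 + Matrix.single q q 1 with hP
  set L : Matrix (Fin 4) (Fin 4) ℝ := Matrix.single p q 1 - Matrix.single q p 1 with hL
  have h1 : P * P = P := by
    simp [hP, mul_add, add_mul, h, h.symm]
  have h2 : P * L = L := by
    simp [hP, hL, mul_sub, add_mul, h, h.symm]
  have h3 : L * P = L := by
    simp [hP, hL, mul_add, sub_mul, h, h.symm]
    abel
  have h4 : L * L = -P := by
    simp [hP, hL, mul_sub, sub_mul, h, h.symm]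
    abel
  simp only [rotMat, ← hP, ← hL, mul_add, add_mul, one_mul, mul_one, smul_mul_assoc, mul_smul_comm,
    h1, h2, h3, h4, smul_neg, Real.cos_add, Real.sin_add]
  match_scalars <;> ring

theorem rotMat_transpose (p q : Fin 4) (t : ℝ) : (rotMat p q t)ᵀ = rotMat p q (-t) := by
  simp only [rotMat, Matrix.transpose_add, Matrix.transpose_smul, Matrix.transpose_sub,
    Matrix.transpose_single, Matrix.transpose_one, Real.cos_neg, Real.sin_neg, neg_smul, smul_sub]
  abel

theorem rotMat_zero (p q : Fin 4) : rotMat p q 0 = 1 := by simp [rotMat]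

theorem transpose_mul_rotMat {p q : Fin 4} (h : p ≠ q) (t : ℝ) :
    (rotMat p q t)ᵀ * rotMat p q t = 1 := by
  rw [rotMat_transpose, rotMat_mul h, neg_add_cancel, rotMat_zero]

theorem det_rotMat {p q : Fin 4} (h : p ≠ q) (t : ℝ) : (rotMat p q t).det = 1 := by
  have h1 := congrArg Matrix.det (transpose_mul_rotMat h (t / 2))
  rw [Matrix.det_mul, Matrix.det_transpose, Matrix.det_one] at h1
  rw [← add_halves t, ← rotMat_mul h, Matrix.det_mul, h1]

/-- The rotation by the angle one as an element of `K`. -/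
def rot {p q : Fin 4} (h : p ≠ q) : K :=
  ⟨Matrix.fromBlocks (rotMat p q 1) 0 0 1, ⟨⟨by
      rw [gam, LieAlgebra.Orthogonal.indefiniteDiagonal, ← Matrix.fromBlocks_diagonal,
        Matrix.fromBlocks_transpose, Matrix.fromBlocks_multiply, Matrix.fromBlocks_multiply]
      have e1 : (Matrix.diagonal fun _ : Fin 4 => (1 : ℝ)) = 1 := Matrix.diagonal_one
      simp [e1, transpose_mul_rotMat h],
    by rw [Matrix.det_fromBlocks_zero₂₁, det_rotMat h, Matrix.det_one, mul_one], by simp⟩, by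
      rw [Matrix.fromBlocks_transpose, Matrix.fromBlocks_multiply]
      simp [transpose_mul_rotMat h]⟩⟩

theorem k4_rot_mulVec {p q : Fin 4} (h : p ≠ q) (v : Fin 4 → ℂ) :
    (k4 (rot h)).mulVec v = v + ((Real.cos 1 : ℂ) - 1) • (v p • std p + v q • std q)
      + (Real.sin 1 : ℂ) • (v q • std p - v p • std q) := by
  have e : k4 (rot h) = 1 + ((Real.cos 1 : ℂ) - 1) • (Matrix.single p p 1 + Matrix.single q q 1)
      + (Real.sin 1 : ℂ) • (Matrix.single p q 1 - Matrix.single q p 1) := by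
    ext i j
    change ((rotMat p q 1 i j : ℝ) : ℂ) = _
    simp only [rotMat, Matrix.add_apply, Matrix.smul_apply, Matrix.sub_apply, Matrix.single_apply,
      Matrix.one_apply, smul_eq_mul]
    split_ifs <;> push_cast <;> ring
  rw [e, Matrix.add_mulVec, Matrix.add_mulVec, Matrix.one_mulVec, Matrix.smul_mulVec,
    Matrix.smul_mulVec, Matrix.add_mulVec, Matrix.sub_mulVec]
  ext a
  simp [Matrix.single_mulVec, Function.update_apply, Pi.single_apply]

theorem lie_mulVec (p q : Fin 4) (v : Fin 4 → ℂ) :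
    (e p q 1 - (e p q 1)ᵀ).mulVec v = v q • std p - v p • std q := by
  rw [Matrix.transpose_single, Matrix.sub_mulVec]
  ext a
  simp [Matrix.single_mulVec, Function.update_apply, Pi.single_apply]

end Rotations

/-! ### Fixed vectors of `K` commute with the diagonal copy of `𝔨` -/

section Infinitesimal

theorem eq_top_of_iU_mem (T : Subalgebra ℂ U) (h : ∀ X, iU X ∈ T) : T = ⊤ := by
  let f : LieG →ₗ⁅ℂ⁆ T :=
    { toFun := fun X => ⟨iU X, h X⟩
      map_add' := fun X Y => Subtype.ext (map_add iU X Y)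
      map_smul' := fun c X => Subtype.ext (map_smul iU c X)
      map_lie' := fun {X Y} => Subtype.ext (LieHom.map_lie iU X Y) }
  have e : T.val.comp (UniversalEnvelopingAlgebra.lift ℂ f) = AlgHom.id ℂ U := by
    apply UniversalEnvelopingAlgebra.hom_ext
    ext1 X
    change T.val (UniversalEnvelopingAlgebra.lift ℂ f (iU X)) = iU X
    rw [UniversalEnvelopingAlgebra.lift_ι_apply]
    rfl
  rw [eq_top_iff]
  intro u _
  have := DFunLike.congr_fun e u
  rw [← AlgHom.id_apply (R := ℂ) u, ← this]
  exact Subtype.property _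

/-- `U(𝔤)` is generated by `𝔭`, as `𝔨 = [𝔭, 𝔭]`. -/
theorem eq_top_of_pU_mem (T : Subalgebra ℂ U) (h : ∀ v, pU v ∈ T) : T = ⊤ := by
  have hk : ∀ i j, iU (kLin (e i j 1) : LieG) ∈ T := by
    intro i j
    have h1 : iU (kLin (e i j 1) : LieG) = pU (std i) * pU (std j) - pU (std j) * pU (std i) := by
      rw [pU_apply, pU_apply, ← LieRing.of_associative_ring_bracket, ← LieHom.map_lie,
        lie_pElt_pElt, ← kVec_apply, kVec_std]
    rw [h1]
    exact sub_mem (mul_mem (h _) (h _)) (mul_mem (h _) (h _))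
  refine eq_top_of_iU_mem T fun X => ?_
  obtain ⟨A, v, rfl⟩ := exists_kElt_add_pElt X
  rw [map_add]
  refine add_mem ?_ (h v)
  rw [← kLin_apply, Matrix.matrix_eq_sum_single A]
  have h2 : ∀ i j, iU (kLin (Matrix.single i j (A i j)) : LieG) ∈ T := by
    intro i j
    rw [kLin_e]
    have := Subalgebra.smul_mem T (hk i j) (A i j)
    rwa [← map_smul] at this
  simp only [map_sum, AddSubmonoidClass.coe_finsetSum]
  exact sum_mem fun i _ => sum_mem fun j _ => h2 i j

theorem eq_top_of_mem (T : Subalgebra ℂ UC) (hU : ∀ v, pU v ⊗ₜ 1 ∈ T) (hC : ∀ v, 1 ⊗ₜ cLin v ∈ T) :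
    T = ⊤ := by
  have h1 : T.comap Algebra.TensorProduct.includeLeft = ⊤ := eq_top_of_pU_mem _ hU
  have h2 : T.comap Algebra.TensorProduct.includeRight = ⊤ := by
    rw [eq_top_iff, ← CliffordAlgebra.adjoin_range_ι]
    refine Algebra.adjoin_le ?_
    rintro _ ⟨X, rfl⟩
    obtain ⟨v, rfl⟩ := pEquiv.surjective X
    exact hC v
  rw [eq_top_iff]
  intro x _
  induction x using TensorProduct.induction_on with
  | zero => exact zero_mem T
  | add x y hx hy => exact add_mem (hx trivial) (hy trivial)
  | tmul u c =>
    have hu : u ∈ T.comap Algebra.TensorProduct.includeLeft := h1 ▸ Algebra.mem_top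
    have hc : c ∈ T.comap Algebra.TensorProduct.includeRight := h2 ▸ Algebra.mem_top
    have := mul_mem ((Subalgebra.mem_comap _ _ _).1 hu) ((Subalgebra.mem_comap _ _ _).1 hc)
    rwa [Algebra.TensorProduct.includeLeft_apply, Algebra.TensorProduct.includeRight_apply,
      Algebra.TensorProduct.tmul_mul_tmul, mul_one, one_mul] at this

/-- The diagonal embedding of `𝔨` in `U(𝔤) ⊗ C(𝔭)`. -/
def delta : LieK →ₗ[ℂ] UC :=
  ((TensorProduct.mk ℂ U Cl).flip 1) ∘ₗ (iU : LieG →ₗ[ℂ] U) ∘ₗ LieK.subtype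
    + (TensorProduct.mk ℂ U Cl 1) ∘ₗ alphaLin

theorem delta_apply (X : LieK) : delta X = iU (X : LieG) ⊗ₜ 1 + 1 ⊗ₜ alpha X := rfl

theorem delta_lie_pU (A : Matrix (Fin 4) (Fin 4) ℂ) (v : Fin 4 → ℂ) :
    delta (kElt A) * pU v ⊗ₜ 1 - pU v ⊗ₜ 1 * delta (kElt A) = pU ((A - Aᵀ).mulVec v) ⊗ₜ 1 := by
  have h : iU (kElt A : LieG) * pU v - pU v * iU (kElt A : LieG) = pU ((A - Aᵀ).mulVec v) := by
    rw [pU_apply, ← LieRing.of_associative_ring_bracket, ← LieHom.map_lie, lie_kElt_pElt, pU_apply]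
  rw [delta_apply, add_mul, mul_add, Algebra.TensorProduct.tmul_mul_tmul,
    Algebra.TensorProduct.tmul_mul_tmul, Algebra.TensorProduct.tmul_mul_tmul,
    Algebra.TensorProduct.tmul_mul_tmul, mul_one, mul_one, mul_one, one_mul, one_mul,
    add_sub_add_right_eq_sub, ← TensorProduct.sub_tmul, h]

theorem delta_lie_cLin (A : Matrix (Fin 4) (Fin 4) ℂ) (v : Fin 4 → ℂ) :
    delta (kElt A) * 1 ⊗ₜ cLin v - 1 ⊗ₜ cLin v * delta (kElt A) = 1 ⊗ₜ cLin ((A - Aᵀ).mulVec v) := by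
  rw [delta_apply, add_mul, mul_add, Algebra.TensorProduct.tmul_mul_tmul,
    Algebra.TensorProduct.tmul_mul_tmul, Algebra.TensorProduct.tmul_mul_tmul,
    Algebra.TensorProduct.tmul_mul_tmul, mul_one, mul_one, one_mul, mul_one, one_mul,
    add_sub_add_left_eq_sub, ← TensorProduct.tmul_sub, alpha_lie]

/-- The weight vectors of integral weight `n` for the rotation in the plane of `p` and `q`: the
eigenvectors with eigenvalue `in` for its infinitesimal generator, acting by commutators, that are
also eigenvectors with eigenvalue `exp(in)` for the rotation by the angle one. -/
def wt {p q : Fin 4} (h : p ≠ q) (n : ℤ) : Submodule ℂ UC where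
  carrier := {x | delta (kElt (e p q 1)) * x - x * delta (kElt (e p q 1)) = (Complex.I * n) • x ∧
    SOe41.act (rot h) x = Complex.exp (Complex.I * n) • x}
  zero_mem' := ⟨by rw [mul_zero, zero_mul, sub_zero, smul_zero], by rw [map_zero, smul_zero]⟩
  add_mem' := by
    rintro x y ⟨hx, hx'⟩ ⟨hy, hy'⟩
    exact ⟨by rw [mul_add, add_mul, add_sub_add_comm, hx, hy, smul_add],
      by rw [map_add, hx', hy', smul_add]⟩
  smul_mem' := by
    rintro c x ⟨hx, hx'⟩
    exact ⟨by rw [mul_smul_comm, smul_mul_assoc, ← smul_sub, hx, smul_comm],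
      by rw [map_smul, hx', smul_comm]⟩

theorem mem_wt {p q : Fin 4} (h : p ≠ q) (n : ℤ) (x : UC) : x ∈ wt h n ↔
    delta (kElt (e p q 1)) * x - x * delta (kElt (e p q 1)) = (Complex.I * n) • x ∧
      SOe41.act (rot h) x = Complex.exp (Complex.I * n) • x := Iff.rfl

theorem mul_mem_wt {p q : Fin 4} (h : p ≠ q) {m n : ℤ} {x y : UC} (hx : x ∈ wt h m)
    (hy : y ∈ wt h n) : x * y ∈ wt h (m + n) := by
  rw [mem_wt] at hx hy ⊢
  constructor
  · have e1 : delta (kElt (e p q 1)) * (x * y) - x * y * delta (kElt (e p q 1))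
        = (delta (kElt (e p q 1)) * x - x * delta (kElt (e p q 1))) * y
          + x * (delta (kElt (e p q 1)) * y - y * delta (kElt (e p q 1))) := by noncomm_ring
    rw [e1, hx.1, hy.1, smul_mul_assoc, mul_smul_comm, ← add_smul]
    push_cast
    rw [mul_add]
  · rw [map_mul, hx.2, hy.2, smul_mul_smul_comm, ← Complex.exp_add]
    push_cast
    rw [mul_add]

/-- An eigenvector of a plane rotation in `ℂ⁴` gives weight vectors. -/
theorem tmul_mem_wt {p q : Fin 4} (h : p ≠ q) {n : ℤ} {v : Fin 4 → ℂ}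
    (h1 : v q • std p - v p • std q = (Complex.I * n) • v)
    (h2 : (k4 (rot h)).mulVec v = Complex.exp (Complex.I * n) • v) :
    pU v ⊗ₜ 1 ∈ wt h n ∧ 1 ⊗ₜ cLin v ∈ wt h n := by
  rw [mem_wt, mem_wt, delta_lie_pU, delta_lie_cLin, lie_mulVec, h1, act_tmul, act_tmul, actU_pU,
    actCl_cLin, h2]
  simp only [map_smul, map_one, TensorProduct.smul_tmul', TensorProduct.tmul_smul, and_self]

/-- `U(𝔤) ⊗ C(𝔭)` is spanned by weight vectors, since it is generated by two copies of `𝔭` and the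
products of weight vectors are weight vectors. -/
theorem iSup_wt {p q : Fin 4} (h : p ≠ q) : ⨆ n, wt h n = ⊤ := by
  let S : Submonoid UC :=
    { carrier := {x | ∃ n, x ∈ wt h n}
      one_mem' := ⟨0, by rw [mem_wt]; simp⟩
      mul_mem' := fun ⟨m, hm⟩ ⟨n, hn⟩ => ⟨m + n, mul_mem_wt h hm hn⟩ }
  have hS : (S : Set UC) ⊆ (⨆ n, wt h n : Submodule ℂ UC) := by
    rintro x ⟨n, hn⟩
    exact Submodule.mem_iSup_of_mem n hn
  have hspan : (Algebra.adjoin ℂ (S : Set UC)).toSubmodule ≤ ⨆ n, wt h n := by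
    rw [Algebra.adjoin_eq_span, Submonoid.closure_eq]
    exact Submodule.span_le.2 hS
  -- the eigenvectors of the rotation span `ℂ⁴`
  let E : Submodule ℂ (Fin 4 → ℂ) := Submodule.span ℂ
    {v | ∃ n : ℤ, v q • std p - v p • std q = (Complex.I * n) • v ∧
      (k4 (rot h)).mulVec v = Complex.exp (Complex.I * n) • v}
  have hplane : ∀ n : ℤ, n = 1 ∨ n = -1 → std p + (Complex.I * n) • std q ∈ E := by
    intro n hn
    have hp : (std p + (Complex.I * n) • std q : Fin 4 → ℂ) p = 1 := by simp [h]
    have hq : (std p + (Complex.I * n) • std q : Fin 4 → ℂ) q = Complex.I * n := by simp [h.symm]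
    have hI : (Complex.I * n) * (Complex.I * n) = -1 := by
      rcases hn with rfl | rfl <;> simp
    refine Submodule.subset_span ⟨n, ?_, ?_⟩
    · rw [hp, hq, smul_add, smul_smul, hI, neg_smul, sub_eq_add_neg]
    · have hexp : Complex.exp (Complex.I * n) = Complex.cos 1 + Complex.sin 1 * (Complex.I * n) := by
        rcases hn with rfl | rfl
        · rw [mul_comm]; simpa using Complex.exp_mul_I 1
        · have h3 := Complex.exp_mul_I (-1)
          rw [Complex.cos_neg, Complex.sin_neg] at h3
          push_cast
          rw [mul_comm Complex.I, h3]; ring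
      rw [k4_rot_mulVec, hp, hq, hexp, Complex.ofReal_cos, Complex.ofReal_sin, Complex.ofReal_one]
      match_scalars
      · ring
      · linear_combination (-Complex.sin 1) * hI
  have hE : ∀ v, v ∈ E := by
    have hstd : ∀ i, std i ∈ E := by
      intro i
      have h1 := hplane 1 (Or.inl rfl)
      have h2 := hplane (-1) (Or.inr rfl)
      by_cases hip : i = p
      · subst hip
        have h3 := E.smul_mem (1 / 2 : ℂ) (E.add_mem h1 h2)
        convert h3 using 1
        match_scalars <;> ring
      by_cases hiq : i = q
      · subst hiq
        have h3 := E.smul_mem (-Complex.I / 2 : ℂ) (E.sub_mem h1 h2)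
        convert h3 using 1
        match_scalars
        · ring_nf; simp
        · ring
      refine Submodule.subset_span ⟨0, ?_, ?_⟩
      · simp [Ne.symm hip, Ne.symm hiq]
      · rw [k4_rot_mulVec]
        simp [Ne.symm hip, Ne.symm hiq]
    intro v
    rw [← sum_std v]
    exact E.sum_mem fun i _ => E.smul_mem _ (hstd i)
  have htop : Algebra.adjoin ℂ (S : Set UC) = ⊤ := by
    refine eq_top_of_mem _ (fun v => ?_) fun v => ?_
    · induction hE v using Submodule.span_induction with
      | mem v hv =>
        obtain ⟨n, h1, h2⟩ := hv
        exact Algebra.subset_adjoin ⟨n, (tmul_mem_wt h h1 h2).1⟩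
      | zero => rw [map_zero, TensorProduct.zero_tmul]; exact zero_mem _
      | add v w _ _ hv hw => rw [map_add, TensorProduct.add_tmul]; exact add_mem hv hw
      | smul c v _ hv => rw [map_smul, ← TensorProduct.smul_tmul']; exact Subalgebra.smul_mem _ hv c
    · induction hE v using Submodule.span_induction with
      | mem v hv =>
        obtain ⟨n, h1, h2⟩ := hv
        exact Algebra.subset_adjoin ⟨n, (tmul_mem_wt h h1 h2).2⟩
      | zero => rw [map_zero, TensorProduct.tmul_zero]; exact zero_mem _
      | add v w _ _ hv hw => rw [map_add, TensorProduct.tmul_add]; exact add_mem hv hw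
      | smul c v _ hv => rw [map_smul, TensorProduct.tmul_smul]; exact Subalgebra.smul_mem _ hv c
  rw [eq_top_iff]
  refine le_trans ?_ hspan
  rw [htop, Algebra.top_toSubmodule]

/-- The numbers `exp(in)` are pairwise distinct, because `π` is irrational. Hence the rotation by
the angle one separates the weights. -/
theorem exp_I_mul_intCast_injective :
    Function.Injective fun n : ℤ => Complex.exp (Complex.I * n) := by
  intro m n hmn
  obtain ⟨k, hk⟩ := Complex.exp_eq_exp_iff_exists_int.1 hmn
  have h1 : ((m - n : ℤ) : ℝ) = k * (2 * Real.pi) := by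
    have h2 : Complex.I * ((m : ℂ) - n - k * (2 * Real.pi)) = 0 := by
      rw [mul_sub, mul_sub, hk]; ring
    have h3 := (mul_eq_zero.1 h2).resolve_left Complex.I_ne_zero
    rw [sub_eq_zero] at h3
    exact_mod_cast h3
  by_contra hne
  have hk0 : k ≠ 0 := by
    rintro rfl
    rw [Int.cast_zero, zero_mul, Int.cast_eq_zero, sub_eq_zero] at h1
    exact hne h1
  refine irrational_pi ⟨(m - n : ℤ) / (2 * k : ℤ), ?_⟩
  have hk1 : (k : ℝ) ≠ 0 := Int.cast_ne_zero.2 hk0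
  push_cast at h1 ⊢
  rw [h1]
  field_simp

/-- An element of `U(𝔤) ⊗ C(𝔭)` fixed by `K` commutes with the diagonal copy of `𝔨`. A vector fixed
by a plane rotation by the angle one has weight zero, hence is killed by its infinitesimal
generator. -/
theorem commute_delta {x : UC} (hx : ∀ k : K, SOe41.act k x = x) (X : LieK) :
    delta X * x = x * delta X := by
  have key : ∀ p q : Fin 4, p ≠ q →
      delta (kElt (e p q 1)) * x - x * delta (kElt (e p q 1)) = 0 := by
    intro p q h
    have hmem : x ∈ ⨆ n, wt h n := by rw [iSup_wt]; trivial
    obtain ⟨f, hf, hfx⟩ := (Submodule.mem_iSup_iff_exists_finsupp _ _).1 hmem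
    let W : Submodule ℂ UC := LinearMap.ker ((SOe41.act (rot h)).toLinearMap - LinearMap.id)
    have hW : ∀ y, y ∈ W ↔ SOe41.act (rot h) y = y := by
      intro y
      rw [LinearMap.mem_ker, LinearMap.sub_apply, sub_eq_zero]; rfl
    -- the weight components of `x` are fixed by the rotation, since its fixed space is stable
    have h1 := mem_of_sum_eigenvectors_mem (SOe41.act (rot h)).toLinearMap W
      (fun y hy => by
        have hy' := (hW y).1 hy
        rw [AlgHom.toLinearMap_apply, hy']; exact hy)
      f.support (fun n : ℤ => Complex.exp (Complex.I * n)) exp_I_mul_intCast_injective f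
      (fun n => ((mem_wt h n _).1 (hf n)).2) (by
        have : ∑ i ∈ f.support, f i = x := hfx
        rw [this]; exact (hW x).2 (hx _))
    -- only the component of weight zero can be fixed
    have h2 : ∀ n ∈ f.support, (Complex.I * n) • f n = 0 := by
      intro n hn
      have h3 := (hW _).1 (h1 n hn)
      rw [((mem_wt h n _).1 (hf n)).2] at h3
      by_cases hn0 : n = 0
      · simp [hn0]
      · have h4 : Complex.exp (Complex.I * n) ≠ 1 := by
          intro h5
          refine hn0 (exp_I_mul_intCast_injective ?_)
          simpa using h5
        have h5 : (Complex.exp (Complex.I * n) - 1) • f n = 0 := by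
          rw [sub_smul, h3, one_smul, sub_self]
        rw [(smul_eq_zero.1 h5).resolve_left (sub_ne_zero.2 h4), smul_zero]
    have h3 : x = ∑ i ∈ f.support, f i := hfx.symm
    rw [h3, Finset.mul_sum, Finset.sum_mul, ← Finset.sum_sub_distrib]
    exact Finset.sum_eq_zero fun n hn => by
      rw [((mem_wt h n _).1 (hf n)).1]; exact h2 n hn
  obtain ⟨A, rfl⟩ : ∃ A, kLin A = X := by
    obtain ⟨A, v, hAv⟩ := exists_kElt_add_pElt (X : LieG)
    have hv : v = 0 := by
      ext i
      have h1 := congrFun (congrFun (mem_LieK.1 X.2) (Sum.inl i)) (Sum.inr 0)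
      rw [hAv] at h1
      simpa [kElt, pElt, neg_eq_self] using h1
    refine ⟨A, Subtype.ext ?_⟩
    rw [hAv, hv, ← pEquiv_apply, map_zero, Submodule.coe_zero, add_zero]
    rfl
  rw [← sub_eq_zero]
  let T : Matrix (Fin 4) (Fin 4) ℂ →ₗ[ℂ] UC :=
    (LinearMap.mulRight ℂ x - LinearMap.mulLeft ℂ x) ∘ₗ delta ∘ₗ kLin
  change T A = 0
  rw [Matrix.matrix_eq_sum_single A, map_sum]
  refine Finset.sum_eq_zero fun i _ => ?_
  rw [map_sum]
  refine Finset.sum_eq_zero fun j _ => ?_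
  have h2 : Matrix.single i j (A i j) = A i j • e i j 1 := by
    rw [Matrix.smul_single, smul_eq_mul, mul_one]
  rw [h2, map_smul]
  by_cases hij : i = j
  · subst hij
    change A i i • (LinearMap.mulRight ℂ x - LinearMap.mulLeft ℂ x) (delta (kLin (e i i 1))) = 0
    rw [kLin_single_diag, map_zero, map_zero, smul_zero]
  · change A i j • (delta (kElt (e i j 1)) * x - x * delta (kElt (e i j 1))) = 0
    rw [key i j hij, smul_zero]

end Infinitesimal

/-! ### The moment matrix -/

section Moment

/-- The raising elements of the two ideals `𝔰𝔩₂` of `𝔨`. -/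
def raiseK : Fin 2 → LieK := ![E1, E2]
/-- The lowering elements of the two ideals `𝔰𝔩₂` of `𝔨`. -/
def lowerK : Fin 2 → LieK := ![F1, F2]
/-- The semisimple elements of the two ideals `𝔰𝔩₂` of `𝔨`. -/
def cartanK : Fin 2 → LieK := ![H1 + H2, H1 - H2]

theorem spin_alpha_raiseK (b : Fin 2) : spin (alpha (raiseK b)) = unit b 0 1 := by
  fin_cases b
  exacts [spin_alpha_E1, spin_alpha_E2]

theorem spin_alpha_lowerK (b : Fin 2) : spin (alpha (lowerK b)) = unit b 1 0 := by
  fin_cases b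
  exacts [spin_alpha_F1, spin_alpha_F2]

theorem spin_alpha_cartanK (b : Fin 2) : spin (alpha (cartanK b)) = cartan b := by
  fin_cases b
  exacts [spin_alpha_H1_add_H2, spin_alpha_H1_sub_H2]

/-- The isomorphism of `𝔤 ≅ 𝔰𝔭(4)` with the symmetric square of the spinor space, on products of
basis vectors: the diagonal blocks give `𝔨`, the other ones `𝔭`. -/
def xiLie (i j : I) : LieG :=
  (!![-(2 : ℂ) • (F1 : LieG), ((H1 + H2 : LieK) : LieG), (F3 : LieG), (F4 : LieG);
     ((H1 + H2 : LieK) : LieG), (2 : ℂ) • (E1 : LieG), (E4 : LieG), -(E3 : LieG);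
     (F3 : LieG), (E4 : LieG), -(2 : ℂ) • (F2 : LieG), ((H1 - H2 : LieK) : LieG);
     (F4 : LieG), -(E3 : LieG), ((H1 - H2 : LieK) : LieG), (2 : ℂ) • (E2 : LieG)] :
    Matrix (Fin 4) (Fin 4) LieG) (![![0, 1], ![2, 3]] i.1 i.2) (![![0, 1], ![2, 3]] j.1 j.2)

theorem xiLie_symm (i j : I) : xiLie i j = xiLie j i := by
  obtain ⟨a, i⟩ := i
  obtain ⟨b, j⟩ := j
  fin_cases a <;> fin_cases b <;> fin_cases i <;> fin_cases j <;> rfl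

/-- The elements of `U(𝔤)` indexed by the symmetric square of the spinor space. -/
def xi : Sym2 I → U := Sym2.lift ⟨fun i j => iU (xiLie i j), fun i j => by
  change iU (xiLie i j) = iU (xiLie j i)
  rw [xiLie_symm]⟩

/-- The symmetric matrix of the elements `xi`. -/
def xiMat : Matrix I I U := Matrix.of fun i j => xi s(i, j)

/-- The matrix of the elements `xi`, turned by the symplectic form into an endomorphism of the
spinor space: the image of `genEnd` in `U(𝔤)`. -/
def moment : Matrix I I U := -(xiMat * symp U)

theorem toMat_kTerm_apply (X Y : LieK) (i j : I) :
    toMat (kTerm X Y) i j = spin (alpha Y) i j • iU (X : LieG) := toMat_tmul_apply _ _ _ _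

theorem alpha_smul (c : ℂ) (X : LieK) : alpha (c • X) = c • alpha X := map_smul alphaLin c X

theorem toMat_Dk_apply (i j : I) : toMat Dk i j =
    (2 * unit 0 1 0 i j) • iU (E1 : LieG) + (2 * unit 1 1 0 i j) • iU (E2 : LieG)
      + (2 * unit 0 0 1 i j) • iU (F1 : LieG) + (2 * unit 1 0 1 i j) • iU (F2 : LieG)
      + cartan 1 i j • iU ((H1 - H2 : LieK) : LieG) + cartan 0 i j • iU ((H1 + H2 : LieK) : LieG) := by
  rw [Dk, map_add, map_add, map_add, map_add, map_add]
  simp only [Matrix.add_apply, toMat_kTerm_apply, alpha_smul, map_smul, spin_alpha_E1,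
    spin_alpha_E2, spin_alpha_F1, spin_alpha_F2, spin_alpha_H1_add_H2, spin_alpha_H1_sub_H2,
    Matrix.smul_apply, smul_eq_mul]

theorem toMat_D_apply (i j : I) : toMat D i j =
    (1 / 4 * spin (iC F3) i j) • iU (E3 : LieG) + (1 / 4 * spin (iC F4) i j) • iU (E4 : LieG)
      + (1 / 4 * spin (iC E3) i j) • iU (F3 : LieG) + (1 / 4 * spin (iC E4) i j) • iU (F4 : LieG) := by
  rw [D, Fin.sum_univ_four, map_add, map_add, map_add]
  simp only [Matrix.add_apply, toMat_tmul_apply, bas, dual, Matrix.cons_val, map_smul,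
    Matrix.smul_apply, smul_eq_mul]

theorem proj_mul_mul_proj_apply (b c : Fin 2) (M : Matrix I I U) (i j : I) :
    (proj U b * M * proj U c) i j = (if i.1 = b then 1 else 0) * M i j * (if j.1 = c then 1 else 0) := by
  rw [proj, proj, Matrix.mul_diagonal, Matrix.diagonal_mul]

theorem mul_symp_apply_zero (M : Matrix I I U) (i : I) (b : Fin 2) :
    (M * symp U) i (b, 0) = -M i (b, 1) := by
  simp only [Matrix.mul_apply, Fintype.sum_prod_type, Fin.sum_univ_two]
  fin_cases b <;> simp [symp, eps]

theorem mul_symp_apply_one (M : Matrix I I U) (i : I) (b : Fin 2) :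
    (M * symp U) i (b, 1) = M i (b, 0) := by
  simp only [Matrix.mul_apply, Fintype.sum_prod_type, Fin.sum_univ_two]
  fin_cases b <;> simp [symp, eps]

theorem moment_apply_zero (i : I) (b : Fin 2) : moment i (b, 0) = iU (xiLie i (b, 1)) := by
  rw [moment, Matrix.neg_apply, mul_symp_apply_zero, neg_neg]; rfl

theorem moment_apply_one (i : I) (b : Fin 2) : moment i (b, 1) = -iU (xiLie i (b, 0)) := by
  rw [moment, Matrix.neg_apply, mul_symp_apply_one]; rfl

/-- The diagonal blocks of the moment matrix are the `𝔨`-Dirac operator, and the other two blocks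
are multiples of those of the Dirac operator. -/
theorem moment_eq : moment = toMat Dk + (2 : ℂ) • (proj U 0 * toMat D * proj U 1)
    - proj U 1 * toMat D * proj U 0 := by
  ext1 ⟨a, i⟩ ⟨b, j⟩
  rw [Matrix.sub_apply, Matrix.add_apply, Matrix.smul_apply, proj_mul_mul_proj_apply,
    proj_mul_mul_proj_apply, toMat_Dk_apply, toMat_D_apply, spin_E3, spin_E4, spin_F3, spin_F4]
  fin_cases j
  · change moment (a, i) (b, 0) = _
    rw [moment_apply_zero]
    fin_cases a <;> fin_cases b <;> fin_cases i <;>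
      simp [xiLie, cartan, unit, smul_smul] <;> norm_num
  · change moment (a, i) (b, 1) = _
    rw [moment_apply_one]
    fin_cases a <;> fin_cases b <;> fin_cases i <;>
      simp [xiLie, cartan, unit, smul_smul] <;> (try norm_num) <;> (try exact add_comm _ _)

/-- The volume element separates the two blocks. -/
theorem toMat_rhoI : toMat rhoI = (16 : ℂ) • (proj U 1 - proj U 0) := by
  rw [rhoI, toMat_tmul, spin_tau, one_smul, ← proj_map (B := U) 1, ← proj_map (B := U) 0]
  ext1 i j
  rw [Matrix.map_apply, Matrix.smul_apply, Matrix.smul_apply, smul_eq_mul, map_mul,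
    Matrix.sub_apply, map_sub, Matrix.sub_apply, Algebra.smul_def]
  rfl

end Moment

/-! ### The adjoint action on spinor-indexed generators -/

section Triple

/-- The diagonal copy of `𝔨` in matrix form. -/
theorem toMat_delta (X : LieK) : toMat (delta X) =
    Matrix.scalar I (iU (X : LieG)) + (spin (alpha X)).map (algebraMap ℂ U) := by
  ext1 i j
  rw [delta_apply, map_add, Matrix.add_apply, Matrix.add_apply, toMat_tmul_apply, toMat_tmul_apply,
    Matrix.map_apply, map_one, Matrix.scalar_apply, Matrix.diagonal_apply, Matrix.one_apply,
    Algebra.algebraMap_eq_smul_one]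
  split_ifs <;> simp

theorem scalar_commute_map (y : U) (m : Matrix I I ℂ) :
    Matrix.scalar I y * m.map (algebraMap ℂ U) = m.map (algebraMap ℂ U) * Matrix.scalar I y := by
  ext1 i j
  rw [Matrix.scalar_apply, Matrix.diagonal_mul, Matrix.mul_diagonal, Matrix.map_apply,
    Algebra.commutes]

theorem symp_mul_scalar (y : U) : symp U * Matrix.scalar I y = Matrix.scalar I y * symp U := by
  rw [← symp_map (B := U), scalar_commute_map]

/-- `m` belongs to the Lie algebra of the symplectic group of the spinor space. -/
def IsSymplectic (m : Matrix I I ℂ) : Prop := m * symp ℂ = -(symp ℂ * mᵀ)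

theorem isSymplectic_raise (b : Fin 2) : IsSymplectic (unit b 0 1) := by
  ext1 ⟨a, i⟩ ⟨c, j⟩
  rw [Matrix.neg_apply, Matrix.mul_apply, Matrix.mul_apply, Fintype.sum_prod_type,
    Fintype.sum_prod_type]
  fin_cases b <;> fin_cases a <;> fin_cases c <;> fin_cases i <;> fin_cases j <;>
    simp [unit, symp, eps]

theorem isSymplectic_lower (b : Fin 2) : IsSymplectic (unit b 1 0) := by
  ext1 ⟨a, i⟩ ⟨c, j⟩
  rw [Matrix.neg_apply, Matrix.mul_apply, Matrix.mul_apply, Fintype.sum_prod_type,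
    Fintype.sum_prod_type]
  fin_cases b <;> fin_cases a <;> fin_cases c <;> fin_cases i <;> fin_cases j <;>
    simp [unit, symp, eps]

theorem isSymplectic_cartan (b : Fin 2) : IsSymplectic (cartan b) := by
  ext1 ⟨a, i⟩ ⟨c, j⟩
  rw [Matrix.neg_apply, Matrix.mul_apply, Matrix.mul_apply, Fintype.sum_prod_type,
    Fintype.sum_prod_type]
  fin_cases b <;> fin_cases a <;> fin_cases c <;> fin_cases i <;> fin_cases j <;>
    simp [cartan, unit, symp, eps]

theorem IsSymplectic.map {m : Matrix I I ℂ} (hm : IsSymplectic m) :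
    m.map (algebraMap ℂ U) * symp U = -(symp U * (m.map (algebraMap ℂ U))ᵀ) := by
  have h := congrArg (fun N : Matrix I I ℂ => N.map (algebraMap ℂ U)) hm
  have e : ∀ N : Matrix I I ℂ, (-N).map (algebraMap ℂ U) = -(N.map (algebraMap ℂ U)) := by
    intro N; ext1 i j; exact map_neg (algebraMap ℂ U) (N i j)
  simp only [Matrix.map_mul, e, symp_map] at h
  exact h

theorem IsSymplectic.map_transpose {m : Matrix I I ℂ} (hm : IsSymplectic m) :
    (m.map (algebraMap ℂ U))ᵀ * symp U = -(symp U * m.map (algebraMap ℂ U)) := by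
  have h := congrArg (fun N => symp U * N * symp U) hm.map
  have hs := symp_mul_symp (A := U)
  generalize m.map (algebraMap ℂ U) = M at h ⊢
  have e1 : symp U * (M * symp U) * symp U = -(symp U * M) := by
    rw [mul_assoc, mul_assoc, hs, mul_neg, mul_one, mul_neg]
  have e2 : symp U * -(symp U * Mᵀ) * symp U = Mᵀ * symp U := by
    rw [mul_neg, ← mul_assoc, hs, neg_mul 1, one_mul, neg_mul, neg_mul, neg_neg]
  change symp U * (M * symp U) * symp U = symp U * -(symp U * Mᵀ) * symp U at h
  rw [e1, e2] at h
  exact h.symm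

theorem lieOpU_eq (y : U) (m : Matrix I I ℂ) (M : Matrix I I U) :
    lieOpU y m M = Matrix.scalar I y * M - M * Matrix.scalar I y
      + m.map (algebraMap ℂ U) * M + M * (m.map (algebraMap ℂ U))ᵀ := by
  have e : (Matrix.of fun i j => y * M i j - M i j * y)
      = Matrix.scalar I y * M - M * Matrix.scalar I y := by
    ext1 i j
    rw [Matrix.sub_apply, Matrix.scalar_apply, Matrix.diagonal_mul, Matrix.mul_diagonal]; rfl
  rw [lieOpU, e]

/-- Commutation with an element of the diagonal copy of `𝔨`, in endomorphism form, is the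
infinitesimal invariance of the corresponding bilinear form. -/
theorem lieOpU_symp_mul {m : Matrix I I ℂ} (hm : IsSymplectic m) {y : U} {M : Matrix I I U}
    (h : (Matrix.scalar I y - (m.map (algebraMap ℂ U))ᵀ) * M
      = M * (Matrix.scalar I y - (m.map (algebraMap ℂ U))ᵀ)) :
    lieOpU y m (symp U * M) = 0 := by
  have h1 := hm.map
  have h2 := symp_mul_scalar y
  rw [lieOpU_eq]
  generalize m.map (algebraMap ℂ U) = T at *
  generalize Matrix.scalar I y = Y at *
  rw [sub_mul, mul_sub] at h
  calc Y * (symp U * M) - symp U * M * Y + T * (symp U * M) + symp U * M * Tᵀ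
      = Y * symp U * M - symp U * (M * Y) + T * symp U * M + symp U * (M * Tᵀ) := by
        simp only [mul_assoc]
    _ = symp U * ((Y * M - Tᵀ * M) - (M * Y - M * Tᵀ)) := by
        rw [← h2, h1, mul_sub, mul_sub, mul_sub, neg_mul, mul_assoc, mul_assoc]; abel
    _ = 0 := by rw [h, sub_self, mul_zero]

theorem moment_mul_symp : moment * symp U = xiMat := by
  rw [moment, neg_mul, mul_assoc, symp_mul_symp, mul_neg, mul_one, neg_neg]

theorem ordered_act_X (x : Sym2 I → U) (m : Matrix I I ℂ) (i j : I) :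
    ordered x (SpinorInvariants.act m (MvPolynomial.X s(i, j))) =
      ((m.map (algebraMap ℂ U))ᵀ * Matrix.of (fun i j => x s(i, j))
        + Matrix.of (fun i j => x s(i, j)) * m.map (algebraMap ℂ U)) i j := by
  rw [act_X, Matrix.add_apply, Matrix.add_apply, map_add, Matrix.mul_apply, Matrix.mul_apply,
    Matrix.mul_apply, Matrix.mul_apply, map_sum, map_sum]
  congr 1
  · refine Finset.sum_congr rfl fun k _ => ?_
    change ordered x (algebraMap ℂ R (m k i) * MvPolynomial.X s(k, j))
      = algebraMap ℂ U (m k i) * x s(k, j)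
    rw [← Algebra.smul_def, ← Algebra.smul_def, map_smul, ordered_X]
  · refine Finset.sum_congr rfl fun k _ => ?_
    change ordered x (MvPolynomial.X s(i, k) * algebraMap ℂ R (m k j))
      = x s(i, k) * algebraMap ℂ U (m k j)
    rw [← Algebra.commutes, ← Algebra.commutes, ← Algebra.smul_def, ← Algebra.smul_def, map_smul,
      ordered_X]

/-- Commutation of the moment matrix with an element of the diagonal copy of `𝔨` gives the bracket
of that element with the generators `xi`. -/
theorem lie_xi_of_commute {m : Matrix I I ℂ} (hm : IsSymplectic m) {y : U}
    (h : (Matrix.scalar I y - (m.map (algebraMap ℂ U))ᵀ) * moment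
      = moment * (Matrix.scalar I y - (m.map (algebraMap ℂ U))ᵀ)) (s : Sym2 I) :
    y * xi s - xi s * y = ordered xi (SpinorInvariants.act m (MvPolynomial.X s)) := by
  induction s using Sym2.ind with
  | _ i j =>
  rw [ordered_act_X]
  have e : y * xi s(i, j) - xi s(i, j) * y
      = (Matrix.scalar I y * xiMat - xiMat * Matrix.scalar I y) i j := by
    rw [Matrix.sub_apply, Matrix.scalar_apply, Matrix.diagonal_mul, Matrix.mul_diagonal]; rfl
  rw [e]
  refine congrFun (congrFun ?_ i) j
  change _ = (m.map (algebraMap ℂ U))ᵀ * xiMat + xiMat * m.map (algebraMap ℂ U)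
  have h1 := hm.map_transpose
  have h2 := symp_mul_scalar y
  rw [← moment_mul_symp]
  generalize m.map (algebraMap ℂ U) = T at *
  generalize Matrix.scalar I y = Y at *
  rw [sub_mul, mul_sub, sub_eq_sub_iff_sub_eq_sub] at h
  calc Y * (moment * symp U) - moment * symp U * Y = (Y * moment - moment * Y) * symp U := by
        rw [mul_assoc moment, h2, sub_mul, mul_assoc, mul_assoc]
    _ = Tᵀ * (moment * symp U) - moment * (Tᵀ * symp U) := by
        rw [h, sub_mul, mul_assoc, mul_assoc]
    _ = Tᵀ * (moment * symp U) + moment * symp U * T := by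
        rw [h1, mul_neg, sub_neg_eq_add, mul_assoc moment]

theorem scalar_sub_raise (b : Fin 2) : Matrix.scalar I (-iU (lowerK b : LieG))
    - ((unit b 0 1).map (algebraMap ℂ U))ᵀ = -toMat (delta (lowerK b)) := by
  rw [toMat_delta, spin_alpha_lowerK, map_neg, neg_add', ← Matrix.transpose_map, unit,
    Matrix.transpose_single]

theorem scalar_sub_lower (b : Fin 2) : Matrix.scalar I (-iU (raiseK b : LieG))
    - ((unit b 1 0).map (algebraMap ℂ U))ᵀ = -toMat (delta (raiseK b)) := by
  rw [toMat_delta, spin_alpha_raiseK, map_neg, neg_add', ← Matrix.transpose_map, unit,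
    Matrix.transpose_single]

theorem scalar_sub_cartan (b : Fin 2) : Matrix.scalar I (-iU (cartanK b : LieG))
    - ((cartan b).map (algebraMap ℂ U))ᵀ = -toMat (delta (cartanK b)) := by
  rw [toMat_delta, spin_alpha_cartanK, map_neg, neg_add', ← Matrix.transpose_map, cartan, unit, unit,
    Matrix.transpose_sub, Matrix.transpose_single, Matrix.transpose_single]

/-- Invariants commute with the diagonal copy of `𝔨`, stated with the sign with which its elements
act as an `𝔰𝔩₂`-triple on the generators. -/
theorem commute_of_mem_invariants {M : Matrix I I U}
    (hM : M ∈ invariants.map toMat.toAlgHom) (X : LieK) :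
    -toMat (delta X) * M = M * -toMat (delta X) := by
  obtain ⟨w, hw, rfl⟩ := hM
  change -toMat (delta X) * toMat w = toMat w * -toMat (delta X)
  rw [neg_mul, mul_neg, ← map_mul, ← map_mul, commute_delta ((mem_invariants w).1 hw)]

theorem proj_mem_of_rhoI_mem {A : Subalgebra ℂ (Matrix I I U)} (hI : toMat rhoI ∈ A) (b : Fin 2) :
    proj U b ∈ A := by
  have h : proj U 0 + proj U 1 = 1 := by
    rw [proj, proj, Matrix.diagonal_add, ← Matrix.diagonal_one]
    congr 1; ext ⟨a, i⟩; fin_cases a <;> simp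
  have hI' : (16 : ℂ)⁻¹ • toMat rhoI ∈ A := A.smul_mem hI _
  rw [toMat_rhoI, smul_smul, inv_mul_cancel₀ (by norm_num), one_smul] at hI'
  fin_cases b
  · have e : proj U 0 = (1 / 2 : ℂ) • (1 - (proj U 1 - proj U 0)) := by
      rw [← h]; match_scalars <;> norm_num
    change proj U 0 ∈ A
    rw [e]
    exact A.smul_mem (sub_mem (one_mem A) hI') _
  · have e : proj U 1 = (1 / 2 : ℂ) • (1 + (proj U 1 - proj U 0)) := by
      rw [← h]; match_scalars <;> norm_num
    change proj U 1 ∈ A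
    rw [e]
    exact A.smul_mem (add_mem (one_mem A) hI') _

theorem moment_mem {A : Subalgebra ℂ (Matrix I I U)} (hI : toMat rhoI ∈ A) (hD : toMat D ∈ A)
    (hDk : toMat Dk ∈ A) : moment ∈ A := by
  have hp := proj_mem_of_rhoI_mem hI
  rw [moment_eq]
  exact sub_mem (add_mem hDk (A.smul_mem (mul_mem (mul_mem (hp 0) hD) (hp 1)) _))
    (mul_mem (mul_mem (hp 1) hD) (hp 0))

theorem toMat_mem_invariants {w : UC} (hw : ∀ k, SOe41.act k w = w) :
    toMat w ∈ invariants.map toMat.toAlgHom := ⟨w, (mem_invariants w).2 hw, rfl⟩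

theorem moment_mem_invariants : moment ∈ invariants.map toMat.toAlgHom :=
  moment_mem (toMat_mem_invariants act_rhoI) (toMat_mem_invariants act_D)
    (toMat_mem_invariants act_Dk)

theorem proj_mem_invariants (b : Fin 2) : proj U b ∈ invariants.map toMat.toAlgHom :=
  proj_mem_of_rhoI_mem (toMat_mem_invariants act_rhoI) b

/-- The brackets of `𝔨` with the generators, read off from the invariance of the Dirac operators. -/
theorem isSpinorTriple_xi : IsSpinorTriple xi (fun b => -iU (lowerK b : LieG))
    (fun b => -iU (raiseK b : LieG)) (fun b => -iU (cartanK b : LieG)) where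
  lie_e b s := lie_xi_of_commute (isSymplectic_raise b) (by
    rw [scalar_sub_raise]; exact commute_of_mem_invariants moment_mem_invariants _) s
  lie_f b s := lie_xi_of_commute (isSymplectic_lower b) (by
    rw [scalar_sub_lower]; exact commute_of_mem_invariants moment_mem_invariants _) s
  lie_h b s := lie_xi_of_commute (isSymplectic_cartan b) (by
    rw [scalar_sub_cartan]; exact commute_of_mem_invariants moment_mem_invariants _) s

/-- Invariants are killed by the raising and the semisimple elements of both ideals. -/
theorem lieOpU_of_mem_invariants {M : Matrix I I U} (hM : M ∈ invariants.map toMat.toAlgHom)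
    (b : Fin 2) : lieOpU (-iU (lowerK b : LieG)) (unit b 0 1) (symp U * M) = 0 ∧
      lieOpU (-iU (cartanK b : LieG)) (cartan b) (symp U * M) = 0 :=
  ⟨lieOpU_symp_mul (isSymplectic_raise b) (by
    rw [scalar_sub_raise]; exact commute_of_mem_invariants hM _),
   lieOpU_symp_mul (isSymplectic_cartan b) (by
    rw [scalar_sub_cartan]; exact commute_of_mem_invariants hM _)⟩

end Triple

/-! ### The Casimir elements -/

section Casimir

theorem sigma_pair (X Y : LieG) : sigma ![X, Y] = (1 / 2 : ℂ) • (iU X * iU Y + iU Y * iU X) := by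
  have h : (Finset.univ : Finset (Equiv.Perm (Fin 2))) = {1, Equiv.swap 0 1} := by decide
  rw [sigma, h, Finset.sum_insert (by decide), Finset.sum_singleton]
  simp [List.ofFn_succ]

/-- The Casimir element of an ideal of `𝔨`, up to normalization: minus the symmetrized determinant
of the diagonal block of the generators. -/
def casimir (b : Fin 2) : U := xi s((b, 0), (b, 1)) ^ 2
  - (1 / 2 : ℂ) • (xi s((b, 0), (b, 0)) * xi s((b, 1), (b, 1))
    + xi s((b, 1), (b, 1)) * xi s((b, 0), (b, 0)))

theorem xi_zero_zero (b : Fin 2) : xi s((b, 0), (b, 0)) = (-2 : ℂ) • iU (lowerK b : LieG) := by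
  rw [← map_smul]
  fin_cases b
  · exact congrArg iU (by change -(2 : ℂ) • (F1 : LieG) = (-2 : ℂ) • (F1 : LieG); rfl)
  · exact congrArg iU (by change -(2 : ℂ) • (F2 : LieG) = (-2 : ℂ) • (F2 : LieG); rfl)

theorem xi_one_one (b : Fin 2) : xi s((b, 1), (b, 1)) = (2 : ℂ) • iU (raiseK b : LieG) := by
  rw [← map_smul]
  fin_cases b <;> rfl

theorem xi_zero_one (b : Fin 2) : xi s((b, 0), (b, 1)) = iU (cartanK b : LieG) := by
  fin_cases b <;> rfl

theorem casimir_eq (b : Fin 2) : casimir b = sigma ![(cartanK b : LieG), (cartanK b : LieG)]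
    + (4 : ℂ) • sigma ![(raiseK b : LieG), (lowerK b : LieG)] := by
  rw [casimir, sigma_pair, sigma_pair, xi_zero_zero, xi_one_one, xi_zero_one, pow_two]
  simp only [smul_mul_assoc, mul_smul_comm]
  match_scalars <;> norm_num

theorem rhoA1_eq : rhoA1 = casimir 0 ⊗ₜ 1 := by rw [casimir_eq]; rfl

theorem rhoA2_eq : rhoA2 = casimir 1 ⊗ₜ 1 := by rw [casimir_eq]; rfl

theorem toMat_tmul_one (u : U) : toMat (u ⊗ₜ 1) = Matrix.scalar I u := by
  ext1 i j
  rw [toMat_tmul_apply, map_one, Matrix.scalar_apply, Matrix.diagonal_apply, Matrix.one_apply]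
  split_ifs <;> simp

theorem lie_cartanK_xi (b : Fin 2) (i j : I) :
    -iU (cartanK b : LieG) * xi s(i, j) - xi s(i, j) * -iU (cartanK b : LieG)
      = ((if i = (b, 0) then 1 else 0) - (if i = (b, 1) then 1 else 0)
        + (if j = (b, 0) then 1 else 0) - (if j = (b, 1) then 1 else 0) : ℂ) • xi s(i, j) := by
  rw [isSpinorTriple_xi.lie_h, ordered_act_X]
  have h : cartan b = Matrix.diagonal fun i => (if i = (b, 0) then 1 else 0)
      - (if i = (b, 1) then 1 else 0) := by
    ext1 k l
    simp only [cartan, unit, Matrix.sub_apply, Matrix.diagonal_apply, Matrix.single_apply]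
    by_cases h1 : k = l
    · subst h1; simp [eq_comm]
    · rw [if_neg h1, if_neg, if_neg, sub_zero]
      · rintro ⟨rfl, h2⟩; exact h1 h2
      · rintro ⟨rfl, h2⟩; exact h1 h2
  rw [h, Matrix.diagonal_map (map_zero _), Matrix.diagonal_transpose, Matrix.add_apply,
    Matrix.diagonal_mul, Matrix.mul_diagonal, Matrix.of_apply, ← Algebra.commutes,
    ← Algebra.smul_def, ← Algebra.smul_def, ← add_smul]
  congr 1
  ring

theorem lie_zero_one_zero_zero (b : Fin 2) :
    xi s((b, 0), (b, 1)) * xi s((b, 0), (b, 0)) - xi s((b, 0), (b, 0)) * xi s((b, 0), (b, 1))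
      = (-2 : ℂ) • xi s((b, 0), (b, 0)) := by
  have h := lie_cartanK_xi b (b, 0) (b, 0)
  rw [← xi_zero_one] at h
  have e : ∀ x y : U, x * y - y * x = -(-x * y - y * -x) := by intro x y; noncomm_ring
  rw [e, h, ← neg_smul]
  congr 1
  simp; norm_num

theorem lie_zero_one_one_one (b : Fin 2) :
    xi s((b, 0), (b, 1)) * xi s((b, 1), (b, 1)) - xi s((b, 1), (b, 1)) * xi s((b, 0), (b, 1))
      = (2 : ℂ) • xi s((b, 1), (b, 1)) := by
  have h := lie_cartanK_xi b (b, 1) (b, 1)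
  rw [← xi_zero_one] at h
  have e : ∀ x y : U, x * y - y * x = -(-x * y - y * -x) := by intro x y; noncomm_ring
  rw [e, h, ← neg_smul]
  congr 1
  simp; norm_num

theorem lie_zero_zero_one_one (b : Fin 2) :
    xi s((b, 0), (b, 0)) * xi s((b, 1), (b, 1)) - xi s((b, 1), (b, 1)) * xi s((b, 0), (b, 0))
      = (4 : ℂ) • xi s((b, 0), (b, 1)) := by
  have h := isSpinorTriple_xi.lie_e b s((b, 1), (b, 1))
  rw [ordered_act_X, Matrix.add_apply, unit, Matrix.map_single,
    Matrix.transpose_single] at h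
  have h1 : (Matrix.single (b, 1) (b, 0) (algebraMap ℂ U 1) * xiMat : Matrix I I U)
      (b, 1) (b, 1) = xi s((b, 0), (b, 1)) := by
    rw [map_one, Matrix.single_mul_apply_same, one_mul]; rfl
  have h2 : (xiMat * Matrix.single (b, 0) (b, 1) (algebraMap ℂ U 1) : Matrix I I U)
      (b, 1) (b, 1) = xi s((b, 0), (b, 1)) := by
    rw [map_one, Matrix.mul_single_apply_same, mul_one, Sym2.eq_swap]; rfl
  change _ = (Matrix.single (b, 1) (b, 0) (algebraMap ℂ U 1) * xiMat : Matrix I I U) (b, 1) (b, 1)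
    + (xiMat * Matrix.single (b, 0) (b, 1) (algebraMap ℂ U 1) : Matrix I I U) (b, 1) (b, 1) at h
  rw [h1, h2] at h
  rw [xi_zero_zero]
  have e : ∀ x y : U, ((-2 : ℂ) • x) * y - y * ((-2 : ℂ) • x) = (2 : ℂ) • (-x * y - y * -x) := by
    intro x y
    simp only [smul_mul_assoc, mul_smul_comm, neg_mul, mul_neg]
    match_scalars <;> norm_num
  rw [e, h]
  match_scalars; norm_num

/-- Elements with the brackets of an `𝔰𝔩₂`-triple, arranged in a `2 × 2` matrix `M`, satisfy `M² + 2
M = c`, where `c` is the Casimir element. -/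
theorem lie_fin_two {x y z c : U} (hxy : x * y - y * x = (-2 : ℂ) • y)
    (hxz : x * z - z * x = (2 : ℂ) • z) (hyz : y * z - z * y = (4 : ℂ) • x)
    (hc : c = x ^ 2 - (1 / 2 : ℂ) • (y * z + z * y)) :
    x * x + -y * z + (2 : ℂ) • x = c ∧ x * -y + -y * -x + (2 : ℂ) • -y = 0 ∧
      z * x + -x * z + (2 : ℂ) • z = 0 ∧ z * -y + -x * -x + (2 : ℂ) • -x = c := by
  subst hc
  simp only [neg_mul, mul_neg, neg_neg, pow_two]
  refine ⟨?_, ?_, ?_, ?_⟩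
  · linear_combination (norm := module) (-1 / 2 : ℂ) • hyz
  · linear_combination (norm := module) (-1 : ℂ) • hxy
  · linear_combination (norm := module) (-1 : ℂ) • hxz
  · linear_combination (norm := module) (1 / 2 : ℂ) • hyz

/-- The Cayley-Hamilton identity for the diagonal blocks of the moment matrix, with the Casimir
element as the coefficient. -/
theorem block_sq (b : Fin 2) :
    proj U b * moment * proj U b * (proj U b * moment * proj U b)
      + (2 : ℂ) • (proj U b * moment * proj U b) = Matrix.scalar I (casimir b) * proj U b := by
  obtain ⟨h1, h2, h3, h4⟩ := lie_fin_two (lie_zero_one_zero_zero b) (lie_zero_one_one_one b)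
    (lie_zero_zero_one_one b) (c := casimir b) rfl
  have e00 : moment (b, 0) (b, 0) = xi s((b, 0), (b, 1)) := moment_apply_zero _ _
  have e01 : moment (b, 0) (b, 1) = -xi s((b, 0), (b, 0)) := moment_apply_one _ _
  have e10 : moment (b, 1) (b, 0) = xi s((b, 1), (b, 1)) := moment_apply_zero _ _
  have e11 : moment (b, 1) (b, 1) = -xi s((b, 0), (b, 1)) := by
    rw [Sym2.eq_swap]; exact moment_apply_one _ _
  rw [← e11, ← e01, ← e10] at h4
  rw [← e11, ← e00, ← e10] at h3
  rw [← e11, ← e00, ← e01] at h2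
  rw [← e00, ← e01, ← e10] at h1
  ext1 ⟨a, i⟩ ⟨c, j⟩
  rw [Matrix.add_apply, Matrix.smul_apply, Matrix.mul_apply, Fintype.sum_prod_type]
  simp only [proj_mul_mul_proj_apply, Fin.sum_univ_two, Matrix.scalar_apply]
  rw [Matrix.diagonal_mul, proj, Matrix.diagonal_apply]
  clear e00 e01 e10 e11
  obtain rfl | rfl : b = 0 ∨ b = 1 := by fin_cases b <;> simp
  all_goals
    fin_cases a <;> fin_cases c <;> fin_cases i <;> fin_cases j <;>
    first
    | (simp; done)
    | simpa using h1
    | simpa using h2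
    | simpa using h3
    | simpa using h4

end Casimir

/-! ### Invariance of the generators -/

section Invariance

/-- The Casimir elements are `K`-invariant: by the Cayley-Hamilton identity the Casimir element of
an ideal of `𝔨`, times the projection to its block, is a polynomial in the invariant moment matrix.
-/
theorem act_casimir (k : K) (b : Fin 2) :
    SOe41.act k (casimir b ⊗ₜ 1) = casimir b ⊗ₜ 1 := by
  obtain ⟨p, hp, hpb⟩ := proj_mem_invariants b
  have hq : Matrix.scalar I (casimir b) * proj U b ∈ invariants.map toMat.toAlgHom := by
    rw [← block_sq]
    have h := mul_mem (mul_mem (proj_mem_invariants b) moment_mem_invariants) (proj_mem_invariants b)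
    exact add_mem (mul_mem h h) (Subalgebra.smul_mem _ h _)
  change toMat p = proj U b at hpb
  have hcp : casimir b ⊗ₜ 1 * p ∈ invariants := by
    obtain ⟨q, hq, hqb⟩ := hq
    rw [← hpb, ← toMat_tmul_one, ← map_mul] at hqb
    rwa [← toMat.injective hqb]
  have h := (mem_invariants _).1 hcp k
  rw [map_mul, (mem_invariants _).1 hp k, act_tmul, map_one] at h
  have h1 := congrArg toMat h
  rw [map_mul, map_mul, hpb, toMat_tmul_one, toMat_tmul_one] at h1
  have h2 := congrFun (congrFun h1 (b, 0)) (b, 0)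
  rw [Matrix.scalar_apply, Matrix.scalar_apply, Matrix.diagonal_mul, Matrix.diagonal_mul, proj,
    Matrix.diagonal_apply_eq, if_pos rfl, mul_one, mul_one] at h2
  rw [act_tmul, map_one, h2]

theorem adjoin_le_invariants :
    Algebra.adjoin ℂ {rhoA1, rhoA2, rhoI, D, Dk} ≤ invariants := by
  refine Algebra.adjoin_le ?_
  rintro x (rfl | rfl | rfl | rfl | rfl)
  · exact (mem_invariants _).2 fun k => by rw [rhoA1_eq, act_casimir]
  · exact (mem_invariants _).2 fun k => by rw [rhoA2_eq, act_casimir]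
  · exact (mem_invariants _).2 act_rhoI
  · exact (mem_invariants _).2 act_D
  · exact (mem_invariants _).2 act_Dk

end Invariance

/-! ### The generators span the Lie algebra -/

section Span

theorem exists_xi_eq (s : Sym2 I) : ∃ X, xi s = iU X := by
  induction s using Sym2.ind with
  | _ i j => exact ⟨xiLie i j, rfl⟩

theorem kLin_mem {V : Submodule ℂ LieK} (hE1 : E1 ∈ V) (hF1 : F1 ∈ V) (hE2 : E2 ∈ V)
    (hF2 : F2 ∈ V) (hp : H1 + H2 ∈ V) (hm : H1 - H2 ∈ V) (A : Matrix (Fin 4) (Fin 4) ℂ) :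
    kLin A ∈ V := by
  have e01 : kLin (e 0 1 1) = (-Complex.I / 2) • ((H1 + H2) + (H1 - H2)) := by
    rw [H1, H2, ← kLin_apply, ← kLin_apply, kLin_e 0 1 Complex.I,
      kLin_e 2 3 Complex.I]
    match_scalars <;> ring_nf <;> simp
  have e23 : kLin (e 2 3 1) = (-Complex.I / 2) • ((H1 + H2) - (H1 - H2)) := by
    rw [H1, H2, ← kLin_apply, ← kLin_apply, kLin_e 0 1 Complex.I,
      kLin_e 2 3 Complex.I]
    match_scalars <;> ring_nf <;> simp
  have e02 : kLin (e 0 2 1) = (1 / 2 : ℂ) • (E1 - F1 + E2 - F2) := by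
    simp only [E1, E2, F1, F2, ← kLin_apply, map_add, map_sub]
    match_scalars <;> norm_num
  have e13 : kLin (e 1 3 1) = (1 / 2 : ℂ) • (E2 - F2 - E1 + F1) := by
    simp only [E1, E2, F1, F2, ← kLin_apply, map_add, map_sub]
    match_scalars <;> norm_num
  have e12 : kLin (e 1 2 1) = (Complex.I / 2) • (E1 + F1 + E2 + F2) := by
    simp only [E1, E2, F1, F2, ← kLin_apply, map_add, map_sub]
    rw [kLin_e 1 2 Complex.I, kLin_e 0 3 Complex.I]
    match_scalars <;> ring_nf <;> simp
  have e03 : kLin (e 0 3 1) = (Complex.I / 2) • (E1 + F1 - E2 - F2) := by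
    simp only [E1, E2, F1, F2, ← kLin_apply, map_add, map_sub]
    rw [kLin_e 1 2 Complex.I, kLin_e 0 3 Complex.I]
    match_scalars <;> ring_nf <;> simp
  have m01 : kLin (e 0 1 1) ∈ V := by rw [e01]; exact V.smul_mem _ (add_mem hp hm)
  have m23 : kLin (e 2 3 1) ∈ V := by rw [e23]; exact V.smul_mem _ (sub_mem hp hm)
  have m02 : kLin (e 0 2 1) ∈ V := by
    rw [e02]; exact V.smul_mem _ (sub_mem (add_mem (sub_mem hE1 hF1) hE2) hF2)
  have m13 : kLin (e 1 3 1) ∈ V := by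
    rw [e13]; exact V.smul_mem _ (add_mem (sub_mem (sub_mem hE2 hF2) hE1) hF1)
  have m12 : kLin (e 1 2 1) ∈ V := by
    rw [e12]; exact V.smul_mem _ (add_mem (add_mem (add_mem hE1 hF1) hE2) hF2)
  have m03 : kLin (e 0 3 1) ∈ V := by
    rw [e03]; exact V.smul_mem _ (sub_mem (sub_mem (add_mem hE1 hF1) hE2) hF2)
  have key : ∀ i j : Fin 4, kLin (e i j 1) ∈ V := by
    intro i j
    have h0 : ∀ i, kLin (e i i 1) ∈ V := fun i => by rw [kLin_single_diag]; exact zero_mem V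
    have hs : ∀ i j, kLin (e i j 1) ∈ V → kLin (e j i 1) ∈ V := by
      intro i j h
      rw [kLin_single_swap]; exact neg_mem h
    fin_cases i <;> fin_cases j
    exacts [h0 0, m01, m02, m03, hs _ _ m01, h0 1, m12, m13, hs _ _ m02, hs _ _ m12, h0 2, m23,
      hs _ _ m03, hs _ _ m13, hs _ _ m23, h0 3]
  rw [Matrix.matrix_eq_sum_single A, map_sum]
  refine Submodule.sum_mem _ fun i _ => ?_
  rw [map_sum]
  refine Submodule.sum_mem _ fun j _ => ?_
  rw [kLin_e]
  exact V.smul_mem _ (key i j)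

theorem pEquiv_mem {V : Submodule ℂ LieP} (hE3 : E3 ∈ V) (hF3 : F3 ∈ V) (hE4 : E4 ∈ V)
    (hF4 : F4 ∈ V) (v : Fin 4 → ℂ) : pEquiv v ∈ V := by
  have hv : v = ((v 0 + Complex.I * v 1) / 2) • ![1, -Complex.I, 0, 0]
      + ((v 0 - Complex.I * v 1) / 2) • ![1, Complex.I, 0, 0]
      + ((v 2 + Complex.I * v 3) / 2) • ![0, 0, 1, -Complex.I]
      + ((v 2 - Complex.I * v 3) / 2) • ![0, 0, 1, Complex.I] := by
    have hI := Complex.I_sq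
    ext i
    fin_cases i <;> simp <;> ring_nf <;> rw [hI] <;> ring
  rw [hv, map_add, map_add, map_add, map_smul, map_smul, map_smul, map_smul]
  exact add_mem (add_mem (add_mem (V.smul_mem _ hE3) (V.smul_mem _ hF3)) (V.smul_mem _ hE4))
    (V.smul_mem _ hF4)

theorem iU_mem_span (X : LieG) : iU X ∈ Submodule.span ℂ (Set.range xi) := by
  set S := Submodule.span ℂ (Set.range xi)
  have hx : ∀ i j, iU (xiLie i j) ∈ S := fun i j => Submodule.subset_span ⟨s(i, j), rfl⟩
  have hr : ∀ b, iU (raiseK b : LieG) ∈ S := by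
    intro b
    refine (S.smul_mem_iff (two_ne_zero (α := ℂ))).1 ?_
    rw [← xi_one_one]; exact hx _ _
  have hl : ∀ b, iU (lowerK b : LieG) ∈ S := by
    intro b
    refine (S.smul_mem_iff (neg_ne_zero.2 (two_ne_zero (α := ℂ)))).1 ?_
    rw [← xi_zero_zero]; exact hx _ _
  have hh : ∀ b, iU (cartanK b : LieG) ∈ S := by
    intro b
    rw [← xi_zero_one]; exact hx _ _
  obtain ⟨A, v, rfl⟩ := exists_kElt_add_pElt X
  rw [map_add]
  refine add_mem ?_ ?_
  · exact kLin_mem (V := S.comap ((iU : LieG →ₗ[ℂ] U) ∘ₗ LieK.subtype)) (hr 0) (hl 0) (hr 1) (hl 1)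
      (hh 0) (hh 1) A
  · have h3 := hx (0, 1) (1, 1)
    refine pEquiv_mem (V := S.comap ((iU : LieG →ₗ[ℂ] U) ∘ₗ LieP.subtype)) ?_ (hx (0, 0) (1, 0))
      (hx (0, 1) (1, 0)) (hx (0, 0) (1, 1)) v
    have h4 := neg_mem h3
    rw [← map_neg] at h4
    change iU (-(-(E3 : LieG))) ∈ S at h4
    rwa [neg_neg] at h4

theorem isLieClosed_xi : IsLieClosed xi := by
  intro s t
  obtain ⟨X, hX⟩ := exists_xi_eq s
  obtain ⟨Y, hY⟩ := exists_xi_eq t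
  rw [hX, hY, ← LieRing.of_associative_ring_bracket, ← LieHom.map_lie]
  exact iU_mem_span _

theorem exists_mem_fil_xi (u : U) : ∃ n, u ∈ fil xi n := by
  have hone : (1 : U) ∈ fil xi 1 := by
    rw [fil_succ, pow_zero]; exact Submodule.one_le.1 le_rfl
  let T : Subalgebra ℂ U :=
    { carrier := {u | ∃ n, u ∈ fil xi n}
      mul_mem' := by
        rintro u v ⟨n, hn⟩ ⟨m, hm⟩
        exact ⟨n + m, mul_mem_fil (fil_le_succ xi n hn) hm⟩
      add_mem' := by
        rintro u v ⟨n, hn⟩ ⟨m, hm⟩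
        exact ⟨max n m, add_mem (fil_mono xi (le_max_left n m) hn)
          (fil_mono xi (le_max_right n m) hm)⟩
      algebraMap_mem' := by
        intro c
        exact ⟨1, by rw [Algebra.algebraMap_eq_smul_one]; exact Submodule.smul_mem _ _ hone⟩ }
  have hT : T = ⊤ := eq_top_of_iU_mem T fun X => ⟨2, span_le_fil_two (iU_mem_span X)⟩
  have : u ∈ T := by rw [hT]; trivial
  exact this

end Span

/-! ### Generation of the invariants -/

section Generation

theorem genEnd_map_ordered : genEnd.map (ordered xi) = moment := by
  ext1 i ⟨b, j⟩
  rw [Matrix.map_apply]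
  fin_cases j
  · change ordered xi (genEnd i (b, 0)) = moment i (b, 0)
    rw [genEnd_apply_zero, moment_apply_zero, gen_apply, ordered_X]; rfl
  · change ordered xi (genEnd i (b, 1)) = moment i (b, 1)
    rw [genEnd_apply_one, moment_apply_one, map_neg, gen_apply, ordered_X]; rfl

/-- Minus the Casimir element of an ideal of `𝔨` lifts the determinant of the corresponding block.
-/
theorem isSymbol_casimir (b : Fin 2) :
    IsSymbol xi 2 (Matrix.scalar I (-casimir b)) (blockDet b • 1) := by
  have hX := fun s : Sym2 I => MvPolynomial.isHomogeneous_X ℂ s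
  have hdet : (blockDet b).IsHomogeneous 2 :=
    ((hX _).mul (hX _)).sub ((hX _).pow 2)
  have hmem : -casimir b - ordered xi (blockDet b) ∈ fil xi 2 := by
    have h1 := ordered_mul isLieClosed_xi (hX s((b, 0), (b, 0))) (hX s((b, 1), (b, 1)))
    have h2 := ordered_mul isLieClosed_xi (hX s((b, 0), (b, 1))) (hX s((b, 0), (b, 1)))
    rw [ordered_X, ordered_X] at h1
    rw [ordered_X] at h2
    have h3 : xi s((b, 0), (b, 1)) ∈ fil xi 2 := mem_fil_two _
    have h4 := lie_zero_zero_one_one b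
    have h5 := add_mem (add_mem (neg_mem h1) h2) (Submodule.smul_mem _ (-2 : ℂ) h3)
    have e : blockDet b = MvPolynomial.X s((b, 0), (b, 0)) * MvPolynomial.X s((b, 1), (b, 1))
        - MvPolynomial.X s((b, 0), (b, 1)) * MvPolynomial.X s((b, 0), (b, 1)) := by
      rw [blockDet, gen_apply, gen_apply, gen_apply, pow_two]
    convert h5 using 1
    rw [e, map_sub, casimir, pow_two]
    linear_combination (norm := module) (-1 / 2 : ℂ) • h4
  intro i j
  rw [Matrix.smul_apply, Matrix.scalar_apply, Matrix.diagonal_apply, Matrix.one_apply]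
  split_ifs with h
  · rw [smul_eq_mul, mul_one]
    exact ⟨hdet, hmem⟩
  · rw [smul_zero, map_zero, sub_zero]
    exact ⟨MvPolynomial.isHomogeneous_zero _ _ _, zero_mem _⟩

theorem invariants_le_adjoin :
    invariants ≤ Algebra.adjoin ℂ {rhoA1, rhoA2, rhoI, D, Dk} := by
  intro w hw
  set S := Algebra.adjoin ℂ {rhoA1, rhoA2, rhoI, D, Dk} with hS
  have hgen : ∀ x ∈ ({rhoA1, rhoA2, rhoI, D, Dk} : Set UC), toMat x ∈ S.map toMat.toAlgHom :=
    fun x hx => ⟨x, Algebra.subset_adjoin hx, rfl⟩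
  have hI := hgen rhoI (by simp)
  have hcas : ∀ b, Matrix.scalar I (-casimir b) ∈ S.map toMat.toAlgHom := by
    intro b
    rw [map_neg, ← toMat_tmul_one]
    refine neg_mem ?_
    fin_cases b
    · change toMat (casimir 0 ⊗ₜ 1) ∈ _
      rw [← rhoA1_eq]; exact hgen _ (by simp)
    · change toMat (casimir 1 ⊗ₜ 1) ∈ _
      rw [← rhoA2_eq]; exact hgen _ (by simp)
  have h : toMat w ∈ S.map toMat.toAlgHom := by
    refine mem_of_lieOpU_eq_zero isLieClosed_xi isSpinorTriple_xi exists_mem_fil_xi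
      (S.map toMat.toAlgHom) (fun M hM b => lieOpU_of_mem_invariants ?_ b)
      (proj_mem_of_rhoI_mem hI) ?_ (fun b => ⟨_, hcas b, isSymbol_casimir b⟩)
      (lieOpU_of_mem_invariants ⟨w, hw, rfl⟩)
    · exact Subalgebra.map_mono adjoin_le_invariants hM
    · rw [genEnd_map_ordered]
      exact moment_mem hI (hgen _ (by simp)) (hgen _ (by simp))
  obtain ⟨w', hw', e⟩ := h
  rwa [← toMat.injective e]

end Generation

end SpinorInvariants

end

theorem mainTheorem1 :
    Algebra.adjoin ℂ {SOe41.rhoA1, SOe41.rhoA2, SOe41.rhoI, SOe41.D, SOe41.Dk}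
      = SOe41.invariants :=
  le_antisymm SpinorInvariants.adjoin_le_invariants SpinorInvariants.invariants_le_adjoin
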